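/- **Setting.** Unit $1$ is treated after period $T_0$; periods $1,\dots,T_0$ are pre-treatment and $T_0+1,\dots,T$ with $T=T_0+T_1$ are post-treatment; $T_1=T_1(T_0)$, $D_{1,t}=1$ if $t>T_0$ and $D_{1,t}=0$ otherwise. The treated unit has $Y_{1,t}=Y^N_{1,t}+\alpha_{1,t}D_{1,t}$, and $\alpha_1=\mathbb E(\alpha_{1,t})$ is its average treatment effect, the same for all post-treatment $t$ (with $\alpha_{1,t}$ square integrable). The $J$ control units ($J$ fixed) are split into three groups: $\mathcal J_1$, observed at the baseline frequency ($Y_{j,t}$); $\mathcal J_2$, observed at a lower frequency (only at multiples of $\widetilde m_j$); $\mathcal J_3$, observed $m_j$ times per period ($Y^{(m_j)}_{j,t-k/m_j}$, $0\le k<m_j$). All units have $Q$ covariates $X_{j,q,t}$ at the baseline frequency. The aligned control outcomes are $\widetilde{\mathbf Y}_t(\theta)=(\widetilde Y_{j,t})_j$ with $\widetilde Y_{j,t}=Y_{j,t}$ for $j\in\mathcal J_1$; $\widetilde Y_{j,t}=\hat a_j+\sum_{p=0}^{P}\hat\beta_{j,p}'\mathbf X_{j,t-p}$ for $j\in\mathcal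 J_2$, with any estimated coefficients; $\widetilde Y_{j,t}=\sum_{k=1}^{m_j}B_j(k;\zeta_j)Y^{(m_j)}_{j,t-(k-1)/m_j}$ for $j\in\mathcal J_3$, where $B_j$ is a given parametric weight function and $\theta=(\zeta_j)_{j\in\mathcal J_3}$ is normalized by $\sum_kB_j(k;\zeta_j)=1$. Let $\mathcal H$ be the unit simplex of $\mathbb R^J$, and let $(\hat{\mathbf w},\hat\theta)$ minimize, over $\mathbf w\in\mathcal H$ and normalized $\theta$, $$\frac1{T_0}\Big\{\sum_{t=1}^{T_0}\Big(Y_{1,t}-\sum_jw_j\widetilde Y_{j,t}(\theta)\Big)^2+\sum_{q=1}^Q\sum_{t=1}^{T_0}\Big(\tfrac{X_{1,q,t}}{T_0}-\sum_jw_j\tfrac{X_{j,q,t}}{T_0}\Big)^2\Big\}.$$ Write $\widetilde{\mathbf Y}_t=\widetilde{\mathbf Y}_t(\hat\theta)$. The $T_z=(Q+1)T_0$ squared terms define regression rows $(Z_{1,\tilde t},\widetilde{\mathbf Z}_{\tilde t})$ (the first $T_0$ are $(Y_{1,t},\widetilde{\mathbf Y}_t)$, the others are the covariates divided by $T_0$).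 For a true weight $\mathbf w_0\in\mathcal H$ let $u_{\tilde t}=Z_{1,\tilde t}-\widetilde{\mathbf Z}_{\tilde t}'\mathbf w_0$, and let $u_t=Y_{1,t}-\widetilde{\mathbf Y}_t'\mathbf w_0-D_{1,t}\alpha_{1,t}$ for $1\le t\le T$. Put $v_{1,t}=\alpha_{1,t}-\alpha_1+u_t$ for $t>T_0$ and $\boldsymbol\omega_t=(Y_{1,t},\widetilde{\mathbf Y}_t',\alpha_{1,t}D_{1,t})$. "Weakly dependent stationary" means strictly stationary and strongly ($\alpha$-)mixing with mixing coefficients tending to $0$. **Assumptions.** All limits are for $T_0\to\infty$, and $T_1\to\infty$. (A6) The untreated baseline-frequency outcomes (those of the treated unit and of $\mathcal J_1$), each low-frequency outcome at its observation times, the high-frequency outcomes and the covariates are weakly dependent stationary, the covariates with finite second moments; $\mathbb E(\widetilde{\mathbf Y}_t\widetilde{\mathbf Y}_t')$ is positive definite for $t\le T_0$; $\sqrt{T_1/T_0}\to\phi$ with $0\le\phi<\infty$. (A7) The $u_{\tilde t}$ have mean zero and finite variance, the $\widetilde{\mathbf Z}_{\tilde t}u_{\tilde t}$ are square integrable, and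 $T_z^{-1/2}\sum_{\tilde t}\widetilde{\mathbf Z}_{\tilde t}u_{\tilde t}\xrightarrow{d}N(0,\Sigma_1)$ with $\Sigma_1=\lim T_z^{-1}\sum_{t,s=1}^{T_z}\mathbb E(u_tu_s\widetilde{\mathbf Z}_t\widetilde{\mathbf Z}_s')$. (A8) The $v_{1,t}$ have mean zero and finite variance, and $T_1^{-1/2}\sum_{t=T_0+1}^{T}v_{1,t}\xrightarrow{d}N(0,\Sigma_v)$ with $\Sigma_v=\lim T_1^{-1}\sum_{t,s=T_0+1}^{T}\mathbb E(v_{1,t}v_{1,s})$ and $\Sigma_v>0$. (A9) $\boldsymbol\omega_t$ is square integrable; $\{\boldsymbol\omega_t\}_{t=1}^{T_0}$ and $\{\boldsymbol\omega_t\}_{t=T_0+1}^{T}$ are each a stretch of a strictly stationary process whose law does not depend on $T_0$; $\{\boldsymbol\omega_t\}_{t=1}^{T}$ is $\alpha$-mixing uniformly in $T_0$; and for some $0<\lambda<1$ the maximum $\rho(\nu)$ of $|\mathrm{corr}(\omega_{i,t},\omega_{j,t+\nu})|$ over $t\geq 1$, $t+\nu\le T$ and $1\le i,j\le J+1$ is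 $O(\lambda^\nu)$, uniformly in $T_0$. (U) $\{u_t\}_{t=1}^T$ and $\{v_{1,t}\}_{t=T_0+1}^T$ are serially uncorrelated. **Interval.** Let $\hat\alpha_{1,t}=Y_{1,t}-\widetilde{\mathbf Y}_t'\hat{\mathbf w}$, $\hat\alpha_1=T_1^{-1}\sum_{t>T_0}\hat\alpha_{1,t}$ and $\hat\Sigma_v=T_1^{-1}\sum_{t>T_0}(\hat\alpha_{1,t}-\hat\alpha_1)^2$. For each block of $m=m(T_0)$ consecutive pre-treatment periods let $\hat{\mathbf w}^*_m$ minimize $\sum(Y_{1,t}-\widetilde{\mathbf Y}_t'\mathbf w)^2$ over $\mathbf w\in\mathcal H$, the sum being over the block. In each of $N=N(T_0)$ replications, draw one of the $T_0-m+1$ overlapping blocks uniformly and, given the data, $v^*_{1,t}$ i.i.d. $N(0,\hat\Sigma_v)$, all draws being independent, and put $$\hat E^*=-\sqrt{\tfrac{T_1}{T_0}}\Big[\tfrac1{T_1}\sum_{t=T_0+1}^T\widetilde{\mathbf Y}_t'\Big]\sqrt m\,(\hat{\mathbf w}^*_m-\hat{\mathbf w})+\tfrac1{\sqrt{T_1}}\sum_{t=T_0+1}^Tv^*_{1,t}.$$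 Let $\hat E^*_{(x)}$ be the $\lceil x\rceil$-th smallest of the $N$ values. **Theorem.** Assume (A6)–(A9) and (U), and let $m\to\infty$, $m/T_0\to0$ and $N\to\infty$ as $T_0\to\infty$. Then for every $\alpha\in(0,1)$ $$\mathbb P\Big(\alpha_1\in\big[\hat\alpha_1-T_1^{-1/2}\hat E^*_{((1-\alpha/2)N)},\ \hat\alpha_1-T_1^{-1/2}\hat E^*_{((\alpha/2)N)}\big]\Big)\to1-\alpha\qquad(T_0\to\infty).$$ -/

import Mathlib

open MeasureTheory ProbabilityTheory Filter Topology

noncomputable section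

/-! Weak dependence of sequences and triangular arrays. An array `ξ i t` is observed for the
times `t ∈ I i`; a single sequence is the case of a one-point index type. -/

/-- Strict stationarity: a window of any length has the same joint law wherever it is placed,
inside one row of the array or in two different rows. -/
def StrictlyStationary {ι Ω E : Type*} [MeasurableSpace Ω] [MeasurableSpace E]
    (μ : Measure Ω) (I : ι → Set ℕ) (ξ : ι → ℕ → Ω → E) : Prop :=
  ∀ (i i' : ι) (k s s' : ℕ), (∀ r < k, s + r ∈ I i) → (∀ r < k, s' + r ∈ I i') →
    IdentDistrib (fun ω (r : Fin k) => ξ i (s + r) ω) (fun ω (r : Fin k) => ξ i' (s' + r) ω) μ μ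

/-- Strong (alpha-)mixing: the mixing coefficients at gap `g` tend to zero as `g → ∞`,
uniformly over the rows of the array. -/
def StronglyMixing {ι Ω E : Type*} [MeasurableSpace Ω] [MeasurableSpace E]
    (μ : Measure Ω) (I : ι → Set ℕ) (ξ : ι → ℕ → Ω → E) : Prop :=
  ∃ a : ℕ → ℝ, Tendsto a atTop (𝓝 0) ∧
    ∀ (i : ι) (k g : ℕ) (A B : Set Ω),
      MeasurableSet[⨆ t ∈ {t | t ∈ I i ∧ t ≤ k}, MeasurableSpace.comap (ξ i t) inferInstance] A →
      MeasurableSet[⨆ t ∈ {t | t ∈ I i ∧ k + g ≤ t},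
        MeasurableSpace.comap (ξ i t) inferInstance] B →
      |μ.real (A ∩ B) - μ.real A * μ.real B| ≤ a g

/-- A weakly dependent (strongly mixing) strictly stationary sequence `ξ 1, ξ 2, …`. -/
def WeaklyDependentStationary {Ω E : Type*} [MeasurableSpace Ω] [MeasurableSpace E]
    (μ : Measure Ω) (ξ : ℕ → Ω → E) : Prop :=
  StrictlyStationary μ (fun _ : Unit => Set.Ici 1) (fun _ => ξ) ∧
    StronglyMixing μ (fun _ : Unit => Set.Ici 1) (fun _ => ξ)

/-- Raw mixed-frequency data with `Q` covariates; `l` is the dimension of the parameter of a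
MIDAS weight function. The treated unit is observed at the baseline frequency. The control units
are split into `S` (baseline frequency), `L` (lower frequency) and `H` (higher frequency).
Among all units `none` is the treated one and `some j` are the controls. Time starts at `1`;
covariates also have presample values, which enter distributed lags. -/
structure MFPanel (S L H Ω : Type*) [MeasurableSpace Ω] (Q l : ℕ) where
  /-- an outcome of `j ∈ L` is observed once in `mLow j` basic periods -/
  mLow : L → ℕ+
  /-- an outcome of `j ∈ H` is observed `mHigh j` times in each basic period -/
  mHigh : H → ℕ+
  /-- untreated potential outcome of the treated unit -/
  treatedN : ℕ → Ω → ℝ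
  /-- `effect T0 t`: treatment effect at time `t` when `T0` is the last pre-treatment period -/
  effect : ℕ → ℕ → Ω → ℝ
  same : S → ℕ → Ω → ℝ
  /-- low-frequency outcome; observed at the multiples of `mLow j` only -/
  low : L → ℕ → Ω → ℝ
  /-- `high j t k` is the outcome observed at time `t - k / mHigh j` -/
  high : (j : H) → ℕ → Fin (mHigh j) → Ω → ℝ
  covariate : Option (S ⊕ L ⊕ H) → Fin Q → ℤ → Ω → ℝ
  /-- MIDAS weight function: `midas j k ζ` is the weight of lag `k / mHigh j` -/
  midas : (j : H) → Fin (mHigh j) → (Fin l → ℝ) → ℝ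
  measurable_treatedN : ∀ t, Measurable (treatedN t)
  measurable_effect : ∀ T0 t, Measurable (effect T0 t)
  measurable_same : ∀ j t, Measurable (same j t)
  measurable_low : ∀ j t, Measurable (low j t)
  measurable_high : ∀ j t k, Measurable (high j t k)
  measurable_covariate : ∀ j q t, Measurable (covariate j q t)
  measurable_midas : ∀ j k, Measurable (midas j k)

/-- The random quantities computed from the data when `T0` is the last pre-treatment period:
estimated distributed-lag coefficients for the low-frequency controls, estimated MIDAS parameters,
weights, and the weights computed on the block of the periods `b + 1, …, b + m`. -/
structure MFEstimates (S L H Ω : Type*) [MeasurableSpace Ω] (Q l lag : ℕ) where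
  intercept : ℕ → L → Ω → ℝ
  slope : ℕ → L → Fin (lag + 1) → Fin Q → Ω → ℝ
  zeta : ℕ → Ω → H → Fin l → ℝ
  weight : ℕ → Ω → (S ⊕ L ⊕ H) → ℝ
  blockWeight : ℕ → ℕ → Ω → (S ⊕ L ⊕ H) → ℝ
  measurable_intercept : ∀ T0 j, Measurable (intercept T0 j)
  measurable_slope : ∀ T0 j p q, Measurable (slope T0 j p q)
  measurable_zeta : ∀ T0, Measurable (zeta T0)
  measurable_weight : ∀ T0, Measurable (weight T0)
  measurable_blockWeight : ∀ T0 b, Measurable (blockWeight T0 b)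

namespace MFPanel

variable {S L H Ω : Type*} [Fintype S] [Fintype L] [Fintype H] [MeasurableSpace Ω] {Q l lag : ℕ}

/-- Observed outcome of the treated unit. -/
def observed (D : MFPanel S L H Ω Q l) (T0 t : ℕ) (ω : Ω) : ℝ :=
  D.treatedN t ω + if T0 < t then D.effect T0 t ω else 0

/-- Control outcomes aligned to the baseline frequency, for MIDAS parameters `ζ`. -/
def aligned (D : MFPanel S L H Ω Q l) (est : MFEstimates S L H Ω Q l lag) (T0 : ℕ)
    (ζ : H → Fin l → ℝ) (t : ℕ) (ω : Ω) : (S ⊕ L ⊕ H) → ℝ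
  | .inl j => D.same j t ω
  | .inr (.inl j) => est.intercept T0 j ω + ∑ p : Fin (lag + 1), ∑ q : Fin Q,
      est.slope T0 j p q ω * D.covariate (some (.inr (.inl j))) q ((t : ℤ) - (p : ℕ)) ω
  | .inr (.inr j) => ∑ k, D.midas j k (ζ j) * D.high j t k ω

/-- Control outcomes aligned with the estimated MIDAS parameters. -/
def tildeY (D : MFPanel S L H Ω Q l) (est : MFEstimates S L H Ω Q l lag) (T0 t : ℕ) (ω : Ω) :
    (S ⊕ L ⊕ H) → ℝ :=
  D.aligned est T0 (est.zeta T0 ω) t ω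

/-! The rows of the weight regression: `(none, t)` is the outcome at time `t`, and `(some q, t)`
is the `q`-th covariate at time `t`, divided by `T0`; here `1 ≤ t ≤ T0`. -/

/-- The set of the `(Q + 1) * T0` rows. -/
def rows (Q T0 : ℕ) : Finset (Option (Fin Q) × ℕ) := Finset.univ ×ˢ Finset.Icc 1 T0

def rowTreated (D : MFPanel S L H Ω Q l) (T0 : ℕ) (ω : Ω) : Option (Fin Q) × ℕ → ℝ
  | (none, t) => D.observed T0 t ω
  | (some q, t) => D.covariate none q t ω / T0

def rowControl (D : MFPanel S L H Ω Q l) (est : MFEstimates S L H Ω Q l lag) (T0 : ℕ)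
    (ζ : H → Fin l → ℝ) (ω : Ω) : Option (Fin Q) × ℕ → (S ⊕ L ⊕ H) → ℝ
  | (none, t), j => D.aligned est T0 ζ t ω j
  | (some q, t), j => D.covariate (some j) q t ω / T0

/-- The least squares criterion for the weights and the MIDAS parameters. -/
def loss (D : MFPanel S L H Ω Q l) (est : MFEstimates S L H Ω Q l lag) (T0 : ℕ)
    (w : (S ⊕ L ⊕ H) → ℝ) (ζ : H → Fin l → ℝ) (ω : Ω) : ℝ :=
  (T0 : ℝ)⁻¹ * ∑ r ∈ rows Q T0,
    (D.rowTreated T0 ω r - ∑ j, w j * D.rowControl est T0 ζ ω r j) ^ 2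

/-- MIDAS parameters whose lag weights sum to one. -/
def midasParams (D : MFPanel S L H Ω Q l) : Set (H → Fin l → ℝ) :=
  {ζ | ∀ j, ∑ k, D.midas j k (ζ j) = 1}

/-- The estimated weights and MIDAS parameters jointly minimize the criterion over the unit
simplex and the normalized parameters. -/
def IsEstimate (D : MFPanel S L H Ω Q l) (est : MFEstimates S L H Ω Q l lag)
    (μ : Measure Ω) : Prop :=
  ∀ T0, ∀ᵐ ω ∂μ, est.weight T0 ω ∈ stdSimplex ℝ (S ⊕ L ⊕ H) ∧
    est.zeta T0 ω ∈ D.midasParams ∧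
    ∀ w ∈ stdSimplex ℝ (S ⊕ L ⊕ H), ∀ ζ ∈ D.midasParams,
      D.loss est T0 (est.weight T0 ω) (est.zeta T0 ω) ω ≤ D.loss est T0 w ζ ω

/-- Sum of squares on the block of the periods `b + 1, …, b + m`. -/
def blockLoss (D : MFPanel S L H Ω Q l) (est : MFEstimates S L H Ω Q l lag) (T0 m b : ℕ)
    (w : (S ⊕ L ⊕ H) → ℝ) (ω : Ω) : ℝ :=
  ∑ t ∈ Finset.Icc (b + 1) (b + m),
    (D.observed T0 t ω - ∑ j, w j * D.tildeY est T0 t ω j) ^ 2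

/-- The block weights solve the constrained least squares problem on each of the
`T0 - m + 1` overlapping blocks. -/
def IsBlockEstimate (D : MFPanel S L H Ω Q l) (est : MFEstimates S L H Ω Q l lag)
    (m : ℕ → ℕ) (μ : Measure Ω) : Prop :=
  ∀ T0 b, b + m T0 ≤ T0 → ∀ᵐ ω ∂μ,
    est.blockWeight T0 b ω ∈ stdSimplex ℝ (S ⊕ L ⊕ H) ∧
    ∀ w ∈ stdSimplex ℝ (S ⊕ L ⊕ H),
      D.blockLoss est T0 (m T0) b (est.blockWeight T0 b ω) ω ≤ D.blockLoss est T0 (m T0) b w ω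

/-- Error of a regression row, for the true weights `w₀`. -/
def rowError (D : MFPanel S L H Ω Q l) (est : MFEstimates S L H Ω Q l lag)
    (w₀ : (S ⊕ L ⊕ H) → ℝ) (T0 : ℕ) (r : Option (Fin Q) × ℕ) (ω : Ω) : ℝ :=
  D.rowTreated T0 ω r - ∑ j, w₀ j * D.rowControl est T0 (est.zeta T0 ω) ω r j

/-- Error `u t` of the outcome model
`observed t = ∑ j, w₀ j * tildeY t j + 1_{t > T0} * effect t + u t`. -/
def error (D : MFPanel S L H Ω Q l) (est : MFEstimates S L H Ω Q l lag)
    (w₀ : (S ⊕ L ⊕ H) → ℝ) (T0 t : ℕ) (ω : Ω) : ℝ :=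
  D.observed T0 t ω - ∑ j, w₀ j * D.tildeY est T0 t ω j - if T0 < t then D.effect T0 t ω else 0

/-- `v t = effect t - ate + u t`, where `ate` is the average treatment effect. -/
def effectError (D : MFPanel S L H Ω Q l) (est : MFEstimates S L H Ω Q l lag)
    (w₀ : (S ⊕ L ⊕ H) → ℝ) (ate : ℝ) (T0 t : ℕ) (ω : Ω) : ℝ :=
  D.effect T0 t ω - ate + D.error est w₀ T0 t ω

/-- The joint observation (outcome, aligned control outcomes, effect times treatment dummy). -/
def joint (D : MFPanel S L H Ω Q l) (est : MFEstimates S L H Ω Q l lag) (T0 t : ℕ) (ω : Ω) :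
    ℝ × ((S ⊕ L ⊕ H) → ℝ) × ℝ :=
  (D.observed T0 t ω, D.tildeY est T0 t ω, if T0 < t then D.effect T0 t ω else 0)

/-- Outcome components of the joint observation: treated unit and aligned controls. -/
def outcomes (D : MFPanel S L H Ω Q l) (est : MFEstimates S L H Ω Q l lag) (T0 t : ℕ) :
    Option (S ⊕ L ⊕ H) → Ω → ℝ
  | none => D.observed T0 t
  | some j => fun ω => D.tildeY est T0 t ω j

/-- In the post-treatment periods the treatment effect is square integrable with mean `ate`. -/
def IsATE (D : MFPanel S L H Ω Q l) (T1 : ℕ → ℕ) (μ : Measure Ω) (ate : ℝ) : Prop :=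
  ∀ T0, ∀ t ∈ Finset.Ioc T0 (T0 + T1 T0),
    MemLp (D.effect T0 t) 2 μ ∧ ∫ ω, D.effect T0 t ω ∂μ = ate

/-- Regularity of the data: the untreated baseline-frequency outcomes, each low-frequency outcome
at its observation times, the high-frequency outcomes and the covariates are weakly dependent
stationary; the second moment matrix of the aligned outcomes is positive definite; and
`√(T1 / T0) → φ`. -/
def DataRegular (D : MFPanel S L H Ω Q l) (est : MFEstimates S L H Ω Q l lag) (T1 : ℕ → ℕ)
    (μ : Measure Ω) (φ : ℝ) : Prop :=
  WeaklyDependentStationary μ (fun t ω => (D.treatedN t ω, fun j => D.same j t ω)) ∧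
  (∀ j, WeaklyDependentStationary μ (fun n => D.low j (n * D.mLow j))) ∧
  WeaklyDependentStationary μ
    (fun t ω => fun jk : (Σ j : H, Fin (D.mHigh j)) => D.high jk.1 t jk.2 ω) ∧
  WeaklyDependentStationary μ
    (fun t ω => fun jq : Option (S ⊕ L ⊕ H) × Fin Q => D.covariate jq.1 jq.2 t ω) ∧
  (∀ j q (t : ℕ), 1 ≤ t → MemLp (D.covariate j q t) 2 μ) ∧
  (∀ T0, ∀ t ∈ Finset.Icc 1 T0,
    (Matrix.of fun i j => ∫ ω, D.tildeY est T0 t ω i * D.tildeY est T0 t ω j ∂μ).PosDef) ∧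
  Tendsto (fun T0 : ℕ => √((T1 T0 : ℝ) / T0)) atTop (𝓝 φ)

/-- The regression errors are centred and the score satisfies a central limit theorem whose
covariance `Σ₁` is the limit of the normalized second moments of the score. -/
def ScoreCLT [DecidableEq S] [DecidableEq L] [DecidableEq H] (D : MFPanel S L H Ω Q l) (est : MFEstimates S L H Ω Q l lag)
    (w₀ : (S ⊕ L ⊕ H) → ℝ) (μ : Measure Ω) [IsProbabilityMeasure μ]
    (Sig : Matrix (S ⊕ L ⊕ H) (S ⊕ L ⊕ H) ℝ) : Prop :=
  let score : ℕ → Option (Fin Q) × ℕ → Ω → (S ⊕ L ⊕ H) → ℝ := fun T0 r ω j =>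
    D.rowControl est T0 (est.zeta T0 ω) ω r j * D.rowError est w₀ T0 r ω
  (∀ T0, ∀ r ∈ rows Q T0, MemLp (D.rowError est w₀ T0 r) 2 μ ∧
    ∫ ω, D.rowError est w₀ T0 r ω ∂μ = 0) ∧
  (∀ T0, ∀ r ∈ rows Q T0, ∀ j, MemLp (fun ω => score T0 r ω j) 2 μ) ∧
  (∀ i j, Tendsto (fun T0 : ℕ => (((Q + 1) * T0 : ℕ) : ℝ)⁻¹ *
      ∑ r ∈ rows Q T0, ∑ s ∈ rows Q T0, ∫ ω, score T0 r ω i * score T0 s ω j ∂μ)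
    atTop (𝓝 (Sig i j))) ∧
  TendstoInDistribution
    (fun T0 ω => (WithLp.toLp 2 fun j => (√(((Q + 1) * T0 : ℕ) : ℝ))⁻¹ *
      ∑ r ∈ rows Q T0, score T0 r ω j : EuclideanSpace ℝ (S ⊕ L ⊕ H)))
    atTop id (fun _ => μ) (multivariateGaussian 0 Sig)

/-- The post-treatment errors `v t` are centred and satisfy a central limit theorem whose variance
is the limit of the normalized second moments. -/
def EffectCLT (D : MFPanel S L H Ω Q l) (est : MFEstimates S L H Ω Q l lag)
    (w₀ : (S ⊕ L ⊕ H) → ℝ) (T1 : ℕ → ℕ) (μ : Measure Ω) [IsProbabilityMeasure μ]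
    (ate : ℝ) (sigv : NNReal) : Prop :=
  (∀ T0, ∀ t ∈ Finset.Ioc T0 (T0 + T1 T0), MemLp (D.effectError est w₀ ate T0 t) 2 μ ∧
    ∫ ω, D.effectError est w₀ ate T0 t ω ∂μ = 0) ∧
  Tendsto (fun T0 : ℕ => (T1 T0 : ℝ)⁻¹ *
      ∑ t ∈ Finset.Ioc T0 (T0 + T1 T0), ∑ s ∈ Finset.Ioc T0 (T0 + T1 T0),
        ∫ ω, D.effectError est w₀ ate T0 t ω * D.effectError est w₀ ate T0 s ω ∂μ)
    atTop (𝓝 (sigv : ℝ)) ∧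
  TendstoInDistribution
    (fun T0 ω => (√(T1 T0 : ℝ))⁻¹ *
      ∑ t ∈ Finset.Ioc T0 (T0 + T1 T0), D.effectError est w₀ ate T0 t ω)
    atTop id (fun _ => μ) (gaussianReal 0 sigv)

/-- The joint observations are square integrable; before and after the treatment they are pieces
of stationary processes whose laws do not depend on `T0`; they are weakly dependent over
`1, …, T0 + T1`; and the cross-correlations of the outcomes decay geometrically. -/
def JointWeakDependence (D : MFPanel S L H Ω Q l) (est : MFEstimates S L H Ω Q l lag)
    (T1 : ℕ → ℕ) (μ : Measure Ω) : Prop :=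
  (∀ T0, ∀ t ∈ Finset.Icc 1 (T0 + T1 T0), MemLp (D.joint est T0 t) 2 μ) ∧
  StrictlyStationary μ (fun T0 => Set.Icc 1 T0) (D.joint est) ∧
  StrictlyStationary μ (fun T0 => Set.Ioc T0 (T0 + T1 T0)) (D.joint est) ∧
  StronglyMixing μ (fun T0 => Set.Icc 1 (T0 + T1 T0)) (D.joint est) ∧
  ∃ C lam : ℝ, 0 < lam ∧ lam < 1 ∧ ∀ T0 ν t : ℕ, 1 ≤ t → t + ν ≤ T0 + T1 T0 → ∀ i j,
    |cov[D.outcomes est T0 t i, D.outcomes est T0 (t + ν) j; μ] /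
      √(Var[D.outcomes est T0 t i; μ] * Var[D.outcomes est T0 (t + ν) j; μ])| ≤ C * lam ^ ν

/-- The errors `u t` and the post-treatment errors `v t` are serially uncorrelated. -/
def SeriallyUncorrelated (D : MFPanel S L H Ω Q l) (est : MFEstimates S L H Ω Q l lag)
    (w₀ : (S ⊕ L ⊕ H) → ℝ) (T1 : ℕ → ℕ) (μ : Measure Ω) (ate : ℝ) : Prop :=
  (∀ T0, ∀ t ∈ Finset.Icc 1 (T0 + T1 T0), ∀ s ∈ Finset.Icc 1 (T0 + T1 T0), t ≠ s →
    cov[D.error est w₀ T0 t, D.error est w₀ T0 s; μ] = 0) ∧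
  (∀ T0, ∀ t ∈ Finset.Ioc T0 (T0 + T1 T0), ∀ s ∈ Finset.Ioc T0 (T0 + T1 T0), t ≠ s →
    cov[D.effectError est w₀ ate T0 t, D.effectError est w₀ ate T0 s; μ] = 0)

/-- Estimated treatment effect at time `t`. -/
def effectHat (D : MFPanel S L H Ω Q l) (est : MFEstimates S L H Ω Q l lag) (T0 t : ℕ)
    (ω : Ω) : ℝ :=
  D.observed T0 t ω - ∑ j, est.weight T0 ω j * D.tildeY est T0 t ω j

/-- Estimated average treatment effect. -/
def ateHat (D : MFPanel S L H Ω Q l) (est : MFEstimates S L H Ω Q l lag) (T1 : ℕ → ℕ)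
    (T0 : ℕ) (ω : Ω) : ℝ :=
  (T1 T0 : ℝ)⁻¹ * ∑ t ∈ Finset.Ioc T0 (T0 + T1 T0), D.effectHat est T0 t ω

/-- Estimated variance of the post-treatment errors. -/
def varHat (D : MFPanel S L H Ω Q l) (est : MFEstimates S L H Ω Q l lag) (T1 : ℕ → ℕ)
    (T0 : ℕ) (ω : Ω) : ℝ :=
  (T1 T0 : ℝ)⁻¹ * ∑ t ∈ Finset.Ioc T0 (T0 + T1 T0),
    (D.effectHat est T0 t ω - D.ateHat est T1 T0 ω) ^ 2

/-- The subsampling-bootstrap statistic for the block starting after period `b` and the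
standard normal draws `ξ`; the bootstrap errors `√varHat * ξ t` are then i.i.d. centred normal with
variance `varHat`, conditionally on the data. -/
def bootStat (D : MFPanel S L H Ω Q l) (est : MFEstimates S L H Ω Q l lag) (T1 m : ℕ → ℕ)
    (T0 : ℕ) (ω : Ω) (b : ℕ) (ξ : Fin (T1 T0) → ℝ) : ℝ :=
  -√((T1 T0 : ℝ) / T0) *
      ∑ j, ((T1 T0 : ℝ)⁻¹ * ∑ t ∈ Finset.Ioc T0 (T0 + T1 T0), D.tildeY est T0 t ω j) *
        (√(m T0 : ℝ) * (est.blockWeight T0 b ω j - est.weight T0 ω j)) +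
    (√(T1 T0 : ℝ))⁻¹ * ∑ t, √(D.varHat est T1 T0 ω) * ξ t

end MFPanel

/-- The `k`-th smallest of `N` numbers, `1 ≤ k ≤ N` (and `0` for other `k`). -/
def orderStat {N : ℕ} (x : Fin N → ℝ) (k : ℕ) : ℝ :=
  if h : 1 ≤ k ∧ k ≤ N then x (Tuple.sort x ⟨k - 1, by omega⟩) else 0

/-- Law of the simulation draws of `N` replications: independent block indices, uniform on
`{0, …, K}`, and, independent of them, independent standard normal draws. -/
def simLaw (N K T1 : ℕ) : Measure ((Fin N → Fin (K + 1)) × (Fin N → Fin T1 → ℝ)) :=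
  (Measure.pi fun _ => uniformOn Set.univ).prod
    (Measure.pi fun _ => Measure.pi fun _ => gaussianReal 0 1)

/-- The confidence interval for the average treatment effect computed from the data `ω` and the
simulation draws `z`; the order statistic of a non-integer rank `x` is that of rank `⌈x⌉`. -/
def confInterval {S L H Ω : Type*} [Fintype S] [Fintype L] [Fintype H] [MeasurableSpace Ω]
    {Q l lag : ℕ} (D : MFPanel S L H Ω Q l) (est : MFEstimates S L H Ω Q l lag)
    (T1 m N : ℕ → ℕ) (α : ℝ) (T0 : ℕ) (ω : Ω)
    (z : (Fin (N T0) → Fin (T0 - m T0 + 1)) × (Fin (N T0) → Fin (T1 T0) → ℝ)) : Set ℝ :=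
  let E : Fin (N T0) → ℝ := fun n => D.bootStat est T1 m T0 ω (z.1 n) (z.2 n)
  Set.Icc
    (D.ateHat est T1 T0 ω - (√(T1 T0 : ℝ))⁻¹ * orderStat E ⌈(1 - α / 2) * N T0⌉₊)
    (D.ateHat est T1 T0 ω - (√(T1 T0 : ℝ))⁻¹ * orderStat E ⌈α / 2 * N T0⌉₊)

end

/-! Write e_t = Y_t - Ỹ_t'w₀ for the residual at the true weights. After the treatment e_t - `ate`
is the error v_t. With M̂ the post-treatment mean of the aligned controls, this gives the exact
identity √T₁ (α̂ - `ate`) = -√(T₁/T₀) M̂' √T₀ (ŵ - w₀) + T₁^(-1/2) ∑ v_t. The proof finds the limit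
law of the right-hand side and shows that the conditional law of the simulated statistic has the
same limit, in probability.

Weights. The simplex is polyhedral, so near w₀ it coincides with w₀ plus its tangent cone. After
rescaling, constrained least squares becomes a strongly convex quadratic programme on that cone. Its
solution P(score), given by `coneSolution`, is Lipschitz in the score and stable under small errors
of the Gram matrix (`absSum_smul_sub_coneSolution_le`, `vanishesInProb_sqrt_mul_sub_coneSolution`).
The same P serves the full sample and the blocks. Covariate rows are divided by T₀ and disappear in
the limit. The limit of √T₀ (ŵ - w₀) is P of a Gaussian vector Z, which need not be normal, but the
argument only uses that P is continuous.

Limit law. Up to a vanishing error the first term is a function of the pre-treatment score, while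
the second is a post-treatment sum. Dropping a fixed number of initial terms of that sum costs
O(T₁^(-1/2)) and opens a gap, so mixing makes the two terms asymptotically independent
(`IsRegressionArray.tendsto_integral_mul_sub_past_post`). The limit is the law of -φ M'P(Z)
convolved with N(0, Σ_v); as Σ_v > 0, its distribution function is continuous and strictly
increasing.

Simulation. Centring the block weights at ŵ rather than w₀ changes √m (ŵ* - w₀) by √(m/T₀) O_p(1),
which vanishes. By stationarity each block score has the law of the score of a sample of length m,
and as m/T₀ → 0 most pairs of blocks are far apart. Averages over blocks of bounded functions of the
score therefore concentrate (`IsRegressionArray.vanishesInProb_average_blockScore_sub`). Given the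
data, the added noise is exactly N(0, Σ̂_v), and Σ̂_v tends to Var v, which equals Σ_v because the
v_t are uncorrelated. So the conditional distribution function converges
(`IsRegressionArray.vanishesInProb_drawLaw_real_sub`). Chebyshev's inequality passes to the
empirical distribution function of the N replications, and the simulated quantiles converge to those
of the limit law (`tendsto_prod_simLaw_quantile_interval`). -/

/-! Stochastic order calculus for real random sequences. -/

section StochasticOrder

variable {Ω : Type*} [MeasurableSpace Ω] {μ : Measure Ω}

/-- Convergence to zero in probability. -/
def VanishesInProb (μ : Measure Ω) (X : ℕ → Ω → ℝ) : Prop :=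
  ∀ ε > 0, ∀ᶠ n in atTop, μ.real {ω | ε ≤ |X n ω|} ≤ ε

/-- Boundedness in probability. -/
def BoundedInProb (μ : Measure Ω) (X : ℕ → Ω → ℝ) : Prop :=
  ∀ ε > 0, ∃ M > 0, ∀ᶠ n in atTop, μ.real {ω | M ≤ |X n ω|} ≤ ε

variable [IsProbabilityMeasure μ] {X Y Z : ℕ → Ω → ℝ}

lemma measureReal_le_of_ae_subset {s t : Set Ω} (h : ∀ᵐ ω ∂μ, ω ∈ s → ω ∈ t) :
    μ.real s ≤ μ.real t :=
  ENNReal.toReal_mono (measure_ne_top _ _) (measure_mono_ae h)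

lemma measureReal_le_add_of_ae_subset {s t u : Set Ω} (h : ∀ᵐ ω ∂μ, ω ∈ s → ω ∈ t ∨ ω ∈ u) :
    μ.real s ≤ μ.real t + μ.real u :=
  (measureReal_le_of_ae_subset (t := t ∪ u) h).trans (measureReal_union_le _ _)

/-- The definition uses a single ε for the size of the deviation and for its probability. Applying
it at a smaller ε separates the two. -/
lemma VanishesInProb.tendsto (hX : VanishesInProb μ X) {ε : ℝ} (hε : 0 < ε) :
    Tendsto (fun n => μ.real {ω | ε ≤ |X n ω|}) atTop (𝓝 0) := by
  rw [Metric.tendsto_nhds]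
  intro δ hδ
  filter_upwards [hX (min ε (δ / 2)) (by positivity)] with n hn
  rw [Real.dist_eq, sub_zero, abs_of_nonneg measureReal_nonneg]
  calc μ.real {ω | ε ≤ |X n ω|} ≤ μ.real {ω | min ε (δ / 2) ≤ |X n ω|} :=
        measureReal_mono fun ω (h : ε ≤ _) => (min_le_left _ _).trans h
    _ ≤ δ / 2 := hn.trans (min_le_right _ _)
    _ < δ := by linarith

omit [IsProbabilityMeasure μ] in
lemma VanishesInProb.of_tendsto
    (h : ∀ ε > 0, Tendsto (fun n => μ.real {ω | ε ≤ |X n ω|}) atTop (𝓝 0)) :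
    VanishesInProb μ X := fun ε hε =>
  ((h ε hε).eventually_lt_const hε).mono fun _ h => h.le

lemma vanishesInProb_iff_tendstoInMeasure :
    VanishesInProb μ X ↔ TendstoInMeasure μ X atTop 0 := by
  rw [tendstoInMeasure_iff_measureReal_norm]
  simp only [Pi.zero_apply, sub_zero, Real.norm_eq_abs]
  exact ⟨fun h ε hε => h.tendsto hε, VanishesInProb.of_tendsto⟩

/-- It suffices to control the sequence outside of events of small probability. -/
lemma VanishesInProb.of_exceptional
    (h : ∀ ε > 0, ∀ᶠ n in atTop, ∃ B : Set Ω, μ.real B ≤ ε ∧ ∀ᵐ ω ∂μ, ω ∉ B → |X n ω| < ε) :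
    VanishesInProb μ X := by
  intro ε hε
  filter_upwards [h ε hε] with n ⟨B, hB, hX⟩
  refine (measureReal_le_of_ae_subset ?_).trans hB
  filter_upwards [hX] with ω h1 h2
  by_contra h3
  exact absurd (h1 h3) (not_lt.mpr h2)

lemma VanishesInProb.exceptional (hX : VanishesInProb μ X) {ε η : ℝ} (hε : 0 < ε) (hη : 0 < η) :
    ∀ᶠ n in atTop, μ.real {ω | ε ≤ |X n ω|} ≤ η :=
  ((hX.tendsto hε).eventually_lt_const hη).mono fun _ h => h.le

lemma VanishesInProb.of_abs_le (hX : VanishesInProb μ X)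
    (h : ∀ᶠ n in atTop, ∀ᵐ ω ∂μ, |Y n ω| ≤ |X n ω|) : VanishesInProb μ Y := by
  intro ε hε
  filter_upwards [hX ε hε, h] with n hn hle
  refine (measureReal_le_of_ae_subset ?_).trans hn
  filter_upwards [hle] with ω h1 h2
  exact le_trans h2 h1

lemma VanishesInProb.congr' (hX : VanishesInProb μ X)
    (h : ∀ᶠ n in atTop, ∀ᵐ ω ∂μ, Y n ω = X n ω) : VanishesInProb μ Y :=
  hX.of_abs_le (h.mono fun _ hn => hn.mono fun ω hω => by rw [hω])

lemma VanishesInProb.congr (hX : VanishesInProb μ X) (h : ∀ n ω, Y n ω = X n ω) :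
    VanishesInProb μ Y :=
  hX.congr' (.of_forall fun n => .of_forall (h n))

omit [IsProbabilityMeasure μ] in
lemma vanishesInProb_zero : VanishesInProb μ (fun _ _ => (0 : ℝ)) := by
  intro ε hε
  simp [not_le.mpr hε, hε.le]

lemma VanishesInProb.of_tendsto_const {c : ℕ → ℝ} (hc : Tendsto c atTop (𝓝 0)) :
    VanishesInProb μ (fun n _ => c n) := by
  refine .of_exceptional fun ε hε => ?_
  filter_upwards [(Metric.tendsto_nhds.mp hc) ε hε] with n hn
  refine ⟨∅, by simpa using hε.le, .of_forall fun ω _ => ?_⟩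
  simpa [Real.dist_eq] using hn

lemma VanishesInProb.add (hX : VanishesInProb μ X) (hY : VanishesInProb μ Y) :
    VanishesInProb μ (fun n ω => X n ω + Y n ω) := by
  intro ε hε
  filter_upwards [hX (ε / 2) (by positivity), hY (ε / 2) (by positivity)] with n h1 h2
  refine (measureReal_le_add_of_ae_subset (t := {ω | ε / 2 ≤ |X n ω|})
    (u := {ω | ε / 2 ≤ |Y n ω|}) (.of_forall fun ω (h : ε ≤ |_|) => ?_)).trans (by linarith)
  simp only [Set.mem_ofPred_eq]
  by_contra! hcon
  linarith [abs_add_le (X n ω) (Y n ω)]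

lemma VanishesInProb.neg (hX : VanishesInProb μ X) : VanishesInProb μ (fun n ω => -X n ω) :=
  hX.of_abs_le (.of_forall fun _ => .of_forall fun _ => by rw [abs_neg])

lemma VanishesInProb.abs (hX : VanishesInProb μ X) : VanishesInProb μ (fun n ω => |X n ω|) :=
  hX.of_abs_le (.of_forall fun _ => .of_forall fun _ => by rw [abs_abs])

lemma VanishesInProb.sub (hX : VanishesInProb μ X) (hY : VanishesInProb μ Y) :
    VanishesInProb μ (fun n ω => X n ω - Y n ω) :=
  (hX.add hY.neg).congr fun _ _ => sub_eq_add_neg _ _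

lemma VanishesInProb.sum {ι : Type*} (s : Finset ι) {X : ι → ℕ → Ω → ℝ}
    (hX : ∀ i ∈ s, VanishesInProb μ (X i)) :
    VanishesInProb μ (fun n ω => ∑ i ∈ s, X i n ω) := by
  classical
  induction s using Finset.induction_on with
  | empty => simpa using vanishesInProb_zero
  | insert a s ha ih =>
    simp only [Finset.sum_insert ha]
    exact (hX a (by simp)).add (ih fun i hi => hX i (by simp [hi]))

lemma VanishesInProb.boundedInProb (hX : VanishesInProb μ X) : BoundedInProb μ X :=
  fun _ hε => ⟨1, one_pos, hX.exceptional one_pos hε⟩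

lemma BoundedInProb.of_abs_le (hX : BoundedInProb μ X)
    (h : ∀ᶠ n in atTop, ∀ᵐ ω ∂μ, |Y n ω| ≤ |X n ω|) : BoundedInProb μ Y := by
  intro ε hε
  obtain ⟨M, hM, hX⟩ := hX ε hε
  refine ⟨M, hM, ?_⟩
  filter_upwards [hX, h] with n hn hle
  refine (measureReal_le_of_ae_subset ?_).trans hn
  filter_upwards [hle] with ω h1 h2
  exact le_trans h2 h1

lemma BoundedInProb.congr (hX : BoundedInProb μ X) (h : ∀ n ω, Y n ω = X n ω) :
    BoundedInProb μ Y :=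
  hX.of_abs_le (.of_forall fun n => .of_forall fun ω => by rw [h])

omit [IsProbabilityMeasure μ] in
lemma BoundedInProb.of_tendsto_const {c : ℕ → ℝ} {a : ℝ} (hc : Tendsto c atTop (𝓝 a)) :
    BoundedInProb μ (fun n _ => c n) := by
  intro ε hε
  refine ⟨|a| + 1, by positivity, ?_⟩
  filter_upwards [hc.abs.eventually_lt_const (lt_add_one |a|)] with n hn
  simp [not_le.mpr hn, hε.le]

omit [IsProbabilityMeasure μ] in
lemma boundedInProb_const (a : ℝ) : BoundedInProb μ (fun _ _ => a) :=
  .of_tendsto_const tendsto_const_nhds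

lemma BoundedInProb.add (hX : BoundedInProb μ X) (hY : BoundedInProb μ Y) :
    BoundedInProb μ (fun n ω => X n ω + Y n ω) := by
  intro ε hε
  obtain ⟨M, hM, hX⟩ := hX (ε / 2) (by positivity)
  obtain ⟨M', hM', hY⟩ := hY (ε / 2) (by positivity)
  refine ⟨M + M', by positivity, ?_⟩
  filter_upwards [hX, hY] with n h1 h2
  refine (measureReal_le_add_of_ae_subset (t := {ω | M ≤ |X n ω|})
    (u := {ω | M' ≤ |Y n ω|}) (.of_forall fun ω (h : M + M' ≤ |_|) => ?_)).trans (by linarith)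
  simp only [Set.mem_ofPred_eq]
  by_contra! hcon
  linarith [abs_add_le (X n ω) (Y n ω)]

lemma BoundedInProb.mul (hX : BoundedInProb μ X) (hY : BoundedInProb μ Y) :
    BoundedInProb μ (fun n ω => X n ω * Y n ω) := by
  intro ε hε
  obtain ⟨M, hM, hX⟩ := hX (ε / 2) (by positivity)
  obtain ⟨M', hM', hY⟩ := hY (ε / 2) (by positivity)
  refine ⟨M * M', by positivity, ?_⟩
  filter_upwards [hX, hY] with n h1 h2
  refine (measureReal_le_add_of_ae_subset (t := {ω | M ≤ |X n ω|})
    (u := {ω | M' ≤ |Y n ω|}) (.of_forall fun ω (h : M * M' ≤ |_|) => ?_)).trans (by linarith)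
  simp only [Set.mem_ofPred_eq]
  by_contra! hcon
  rw [abs_mul] at h
  exact absurd h (not_le.mpr (mul_lt_mul'' hcon.1 hcon.2 (abs_nonneg _) (abs_nonneg _)))

lemma BoundedInProb.sum {ι : Type*} (s : Finset ι) {X : ι → ℕ → Ω → ℝ}
    (hX : ∀ i ∈ s, BoundedInProb μ (X i)) :
    BoundedInProb μ (fun n ω => ∑ i ∈ s, X i n ω) := by
  classical
  induction s using Finset.induction_on with
  | empty => simpa using boundedInProb_const (μ := μ) 0
  | insert a s ha ih =>
    simp only [Finset.sum_insert ha]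
    exact (hX a (by simp)).add (ih fun i hi => hX i (by simp [hi]))

lemma VanishesInProb.mul_bounded (hX : VanishesInProb μ X) (hY : BoundedInProb μ Y) :
    VanishesInProb μ (fun n ω => X n ω * Y n ω) := by
  intro ε hε
  obtain ⟨M, hM, hY⟩ := hY (ε / 2) (by positivity)
  filter_upwards [hX.exceptional (ε := ε / M) (η := ε / 2) (by positivity) (by positivity), hY]
    with n h1 h2
  refine (measureReal_le_add_of_ae_subset (t := {ω | ε / M ≤ |X n ω|})
    (u := {ω | M ≤ |Y n ω|}) (.of_forall fun ω (h : ε ≤ |_|) => ?_)).trans (by linarith)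
  simp only [Set.mem_ofPred_eq]
  by_contra! hcon
  rw [abs_mul] at h
  have := mul_lt_mul'' hcon.1 hcon.2 (abs_nonneg _) (abs_nonneg _)
  rw [div_mul_cancel₀ _ hM.ne'] at this
  linarith

lemma BoundedInProb.mul_vanishes (hY : BoundedInProb μ Y) (hX : VanishesInProb μ X) :
    VanishesInProb μ (fun n ω => Y n ω * X n ω) :=
  (hX.mul_bounded hY).congr fun _ _ => mul_comm _ _

lemma VanishesInProb.const_mul (c : ℝ) (hX : VanishesInProb μ X) :
    VanishesInProb μ (fun n ω => c * X n ω) :=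
  (boundedInProb_const c).mul_vanishes hX

lemma BoundedInProb.of_sub_const {a : ℝ} (hX : VanishesInProb μ (fun n ω => X n ω - a)) :
    BoundedInProb μ X :=
  (hX.boundedInProb.add (boundedInProb_const a)).congr fun _ _ => by ring

/-- Product rule for limits in probability. -/
lemma VanishesInProb.mul_sub_mul {a b : ℝ} (hX : VanishesInProb μ (fun n ω => X n ω - a))
    (hY : VanishesInProb μ (fun n ω => Y n ω - b)) :
    VanishesInProb μ (fun n ω => X n ω * Y n ω - a * b) :=
  ((hX.mul_bounded (.of_sub_const hY)).add (hY.const_mul a)).congr fun _ _ => by ring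

/-- Continuous mapping theorem for a limit in probability. -/
lemma VanishesInProb.comp_continuousAt {a : ℝ} (hX : VanishesInProb μ (fun n ω => X n ω - a))
    {g : ℝ → ℝ} (hg : ContinuousAt g a) : VanishesInProb μ (fun n ω => g (X n ω) - g a) := by
  intro ε hε
  obtain ⟨δ, hδ, hgδ⟩ := Metric.continuousAt_iff.mp hg ε hε
  filter_upwards [hX.exceptional hδ hε] with n hn
  refine (measureReal_mono fun ω (h : ε ≤ |_|) => ?_).trans hn
  by_contra hcon
  exact absurd h (not_le.mpr (hgδ (not_le.mp hcon)))

omit [IsProbabilityMeasure μ] in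
lemma VanishesInProb.of_integral_abs (hi : ∀ᶠ n in atTop, Integrable (X n) μ)
    (h : Tendsto (fun n => ∫ ω, |X n ω| ∂μ) atTop (𝓝 0)) : VanishesInProb μ X := by
  refine .of_tendsto fun ε hε => ?_
  have h0 : Tendsto (fun n => ε⁻¹ * ∫ ω, |X n ω| ∂μ) atTop (𝓝 0) := by
    simpa using h.const_mul ε⁻¹
  refine squeeze_zero' (.of_forall fun _ => measureReal_nonneg) ?_ h0
  filter_upwards [hi] with n hn
  rw [← div_eq_inv_mul, le_div_iff₀ hε, mul_comm]
  exact mul_meas_ge_le_integral_of_nonneg (.of_forall fun _ => abs_nonneg _) hn.abs ε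

/-- Bounded convergence: off the event where |X n| is at least δ/4 the integrand is below δ/4, and
on it the bound C is weighted by a small probability. The extra 1 in 4(C + 1) covers C = 0. -/
lemma VanishesInProb.tendsto_integral_abs (hX : VanishesInProb μ X) {C : ℝ}
    (hm : ∀ n, AEStronglyMeasurable (X n) μ) (hC : ∀ n ω, |X n ω| ≤ C) :
    Tendsto (fun n => ∫ ω, |X n ω| ∂μ) atTop (𝓝 0) := by
  rw [Metric.tendsto_nhds]
  intro δ hδ
  have hC0 : 0 ≤ C := by
    obtain ⟨ω⟩ := μ.nonempty_of_neZero
    exact (abs_nonneg _).trans (hC 0 ω)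
  filter_upwards [hX.exceptional (ε := δ / 4) (η := δ / (4 * (C + 1))) (by positivity)
    (by positivity)] with n hn
  rw [Real.dist_eq, sub_zero, abs_of_nonneg (integral_nonneg fun _ => abs_nonneg _)]
  have hnull : NullMeasurableSet {ω | δ / 4 ≤ |X n ω|} μ :=
    nullMeasurableSet_le aemeasurable_const (hm n).norm.aemeasurable
  have hint : Integrable (fun ω => |X n ω|) μ :=
    Integrable.of_bound (hm n).norm C (.of_forall fun ω => by simpa using hC n ω)
  have hind : Integrable ({ω | δ / 4 ≤ |X n ω|}.indicator fun _ => C) μ :=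
    (integrable_const C).indicator₀ hnull
  have hle : ∀ ω, |X n ω| ≤ δ / 4 + {ω | δ / 4 ≤ |X n ω|}.indicator (fun _ => C) ω := by
    intro ω
    by_cases h : δ / 4 ≤ |X n ω|
    · rw [Set.indicator_of_mem (by exact h)]
      linarith [hC n ω]
    · rw [Set.indicator_of_notMem (by exact h)]
      linarith
  calc ∫ ω, |X n ω| ∂μ ≤ ∫ ω, (δ / 4 + {ω | δ / 4 ≤ |X n ω|}.indicator (fun _ => C) ω) ∂μ :=
        integral_mono hint ((integrable_const _).add hind) hle
    _ = δ / 4 + μ.real {ω | δ / 4 ≤ |X n ω|} * C := by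
        rw [integral_add (integrable_const _) hind, integral_indicator₀ hnull]
        simp
    _ ≤ δ / 4 + δ / (4 * (C + 1)) * C := by gcongr
    _ ≤ δ / 4 + δ / (4 * (C + 1)) * (C + 1) := by gcongr; linarith
    _ = δ / 2 := by field_simp; ring
    _ < δ := by linarith

omit [IsProbabilityMeasure μ] in
/-- A sequence with the same laws as a sequence bounded in probability is bounded in probability. -/
lemma BoundedInProb.of_identDistrib (hX : BoundedInProb μ X)
    (h : ∀ᶠ n in atTop, IdentDistrib (X n) (Y n) μ μ) : BoundedInProb μ Y := by
  intro ε hε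
  obtain ⟨M, hM, hX⟩ := hX ε hε
  refine ⟨M, hM, ?_⟩
  filter_upwards [hX, h] with n hn hid
  have := hid.measure_mem_eq (s := {x | M ≤ |x|}) (measurableSet_le measurable_const (by fun_prop))
  rw [measureReal_def] at hn ⊢
  exact (congrArg ENNReal.toReal this).symm.trans_le hn

end StochasticOrder

/-! Strong mixing: covariance inequality and weak laws of large numbers. -/

section Mixing

variable {Ω : Type*} [mΩ : MeasurableSpace Ω] {μ : Measure Ω}

lemma integral_eq_intervalIntegral_measureReal_lt (ν : Measure Ω) [IsFiniteMeasure ν]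
    {Y : Ω → ℝ} (hY : Measurable Y) (h0 : ∀ ω, 0 ≤ Y ω) (h1 : ∀ ω, Y ω ≤ 1) :
    ∫ ω, Y ω ∂ν = ∫ t in (0 : ℝ)..1, ν.real {ω | t < Y ω} := by
  have hint : Integrable Y ν := Integrable.of_bound hY.aestronglyMeasurable 1
    (.of_forall fun ω => by rw [Real.norm_of_nonneg (h0 ω)]; exact h1 ω)
  rw [hint.integral_eq_integral_meas_lt (.of_forall h0),
    intervalIntegral.integral_of_le zero_le_one]
  refine setIntegral_eq_of_subset_of_forall_sdiff_eq_zero measurableSet_Ioi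
    (fun t ht => ht.1) fun t ht => ?_
  have : {ω | t < Y ω} = ∅ := by
    ext ω
    simp only [Set.mem_ofPred_eq, Set.mem_empty_iff_false, iff_false, not_lt]
    by_contra hc
    exact ht.2 ⟨ht.1, (not_le.mp hc).le.trans (h1 ω)⟩
  rw [this, measureReal_empty]

lemma intervalIntegrable_measureReal_lt (ν : Measure Ω) [IsFiniteMeasure ν] (Y : Ω → ℝ) :
    IntervalIntegrable (fun t => ν.real {ω | t < Y ω}) volume 0 1 :=
  Antitone.intervalIntegrable fun _ _ hst =>
    measureReal_mono fun _ h => lt_of_le_of_lt hst h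

/-- By the layer-cake formula both integrals are averages of tail masses over levels in (0, 1), so a
bound uniform in the level passes to the integrals without loss of a constant. -/
lemma abs_integral_sub_le_of_forall_lt (ν₁ ν₂ : Measure Ω) [IsFiniteMeasure ν₁]
    [IsFiniteMeasure ν₂] {Y : Ω → ℝ} (hY : Measurable Y) (h0 : ∀ ω, 0 ≤ Y ω)
    (h1 : ∀ ω, Y ω ≤ 1) {c a : ℝ}
    (h : ∀ t, |ν₁.real {ω | t < Y ω} - c * ν₂.real {ω | t < Y ω}| ≤ a) :
    |∫ ω, Y ω ∂ν₁ - c * ∫ ω, Y ω ∂ν₂| ≤ a := by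
  rw [integral_eq_intervalIntegral_measureReal_lt ν₁ hY h0 h1,
    integral_eq_intervalIntegral_measureReal_lt ν₂ hY h0 h1,
    ← intervalIntegral.integral_const_mul,
    ← intervalIntegral.integral_sub (intervalIntegrable_measureReal_lt _ _)
      ((intervalIntegrable_measureReal_lt _ _).const_mul _)]
  simpa using intervalIntegral.norm_integral_le_of_norm_le_const (a := (0 : ℝ)) (b := 1)
    (C := a) (f := fun t => ν₁.real {ω | t < Y ω} - c * ν₂.real {ω | t < Y ω}) fun t _ => h t

variable [IsProbabilityMeasure μ]

/-- Covariance inequality for functions with values in the unit interval. -/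
lemma abs_covariance_le_of_unitInterval {Ω : Type*} {m₁ m₂ : MeasurableSpace Ω}
    [mΩ : MeasurableSpace Ω] {μ : Measure Ω} [IsProbabilityMeasure μ] (hm₁ : m₁ ≤ mΩ)
    (hm₂ : m₂ ≤ mΩ) {a : ℝ}
    (h : ∀ A B, MeasurableSet[m₁] A → MeasurableSet[m₂] B →
      |μ.real (A ∩ B) - μ.real A * μ.real B| ≤ a)
    {X Y : Ω → ℝ} (hX : Measurable[m₁] X) (hY : Measurable[m₂] Y)
    (hX0 : ∀ ω, 0 ≤ X ω) (hX1 : ∀ ω, X ω ≤ 1) (hY0 : ∀ ω, 0 ≤ Y ω) (hY1 : ∀ ω, Y ω ≤ 1) :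
    |∫ ω, X ω * Y ω ∂μ - (∫ ω, X ω ∂μ) * ∫ ω, Y ω ∂μ| ≤ a := by
  have hX' : Measurable X := hX.mono hm₁ le_rfl
  have hY' : Measurable Y := hY.mono hm₂ le_rfl
  have hXi : Integrable X μ := Integrable.of_bound hX'.aestronglyMeasurable 1
    (.of_forall fun ω => by rw [Real.norm_of_nonneg (hX0 ω)]; exact hX1 ω)
  -- The two events of the mixing bound are replaced by functions one after the other. Here `X`
  -- replaces the first; `Y` then replaces the second under the measure with density `X`, whose mass
  -- on B is the integral bounded here.
  have hstep : ∀ B, MeasurableSet[m₂] B →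
      |∫ ω in B, X ω ∂μ - μ.real B * ∫ ω, X ω ∂μ| ≤ a := by
    intro B hB
    refine abs_integral_sub_le_of_forall_lt (μ.restrict B) μ hX' hX0 hX1 fun t => ?_
    have hA : MeasurableSet[m₁] {ω | t < X ω} := measurableSet_lt measurable_const hX
    rw [measureReal_restrict_apply (hm₁ _ hA), mul_comm]
    exact h _ _ hA hB
  set ν := μ.withDensity fun ω => ENNReal.ofReal (X ω) with hν
  have : IsFiniteMeasure ν := isFiniteMeasure_withDensity_ofReal hXi.2
  have hνB : ∀ B, MeasurableSet B → ν.real B = ∫ ω in B, X ω ∂μ := by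
    intro B hB
    rw [measureReal_def, hν, withDensity_apply _ hB,
      ← ofReal_integral_eq_lintegral_ofReal hXi.integrableOn (.of_forall hX0),
      ENNReal.toReal_ofReal (setIntegral_nonneg hB fun ω _ => hX0 ω)]
  have hνY : ∫ ω, Y ω ∂ν = ∫ ω, X ω * Y ω ∂μ := by
    rw [hν, integral_withDensity_eq_integral_toReal_smul (by fun_prop) (by simp)]
    simp [ENNReal.toReal_ofReal, hX0]
  rw [← hνY]
  refine abs_integral_sub_le_of_forall_lt ν μ hY' hY0 hY1 fun t => ?_
  have hB : MeasurableSet[m₂] {ω | t < Y ω} := measurableSet_lt measurable_const hY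
  rw [hνB _ (hm₂ _ hB), mul_comm]
  exact hstep _ hB

/-- Covariance inequality for bounded functions. -/
lemma abs_covariance_le_of_bounded {Ω : Type*} {m₁ m₂ : MeasurableSpace Ω}
    [mΩ : MeasurableSpace Ω] {μ : Measure Ω} [IsProbabilityMeasure μ] (hm₁ : m₁ ≤ mΩ)
    (hm₂ : m₂ ≤ mΩ) {a : ℝ}
    (h : ∀ A B, MeasurableSet[m₁] A → MeasurableSet[m₂] B →
      |μ.real (A ∩ B) - μ.real A * μ.real B| ≤ a)
    {X Y : Ω → ℝ} (hX : Measurable[m₁] X) (hY : Measurable[m₂] Y) {C : ℝ} (hC : 0 < C)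
    (hXC : ∀ ω, |X ω| ≤ C) (hYC : ∀ ω, |Y ω| ≤ C) :
    |∫ ω, X ω * Y ω ∂μ - (∫ ω, X ω ∂μ) * ∫ ω, Y ω ∂μ| ≤ 4 * C ^ 2 * a := by
  have hX' : Measurable X := hX.mono hm₁ le_rfl
  have hY' : Measurable Y := hY.mono hm₂ le_rfl
  have hXi : Integrable X μ := Integrable.of_bound hX'.aestronglyMeasurable C (.of_forall hXC)
  have hYi : Integrable Y μ := Integrable.of_bound hY'.aestronglyMeasurable C (.of_forall hYC)
  have hXYi : Integrable (fun ω => X ω * Y ω) μ :=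
    Integrable.of_bound (hX'.mul hY').aestronglyMeasurable (C * C) (.of_forall fun ω => by
      rw [norm_mul]; exact mul_le_mul (hXC ω) (hYC ω) (norm_nonneg _) hC.le)
  -- The affine map x ↦ (x + C)/(2C) sends [-C, C] to the unit interval and divides covariances by
  -- 4C².
  have key := abs_covariance_le_of_unitInterval hm₁ hm₂ h
    (X := fun ω => (X ω + C) / (2 * C)) (Y := fun ω => (Y ω + C) / (2 * C))
    ((hX.add_const C).div_const _) ((hY.add_const C).div_const _)
    (fun ω => div_nonneg (by linarith [neg_le_of_abs_le (hXC ω)]) (by positivity))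
    (fun ω => (div_le_one (by positivity)).mpr (by linarith [le_of_abs_le (hXC ω)]))
    (fun ω => div_nonneg (by linarith [neg_le_of_abs_le (hYC ω)]) (by positivity))
    (fun ω => (div_le_one (by positivity)).mpr (by linarith [le_of_abs_le (hYC ω)]))
  have e1 : ∫ ω, (X ω + C) / (2 * C) * ((Y ω + C) / (2 * C)) ∂μ =
      (∫ ω, X ω * Y ω ∂μ + C * ∫ ω, X ω ∂μ + C * ∫ ω, Y ω ∂μ + C ^ 2) / (4 * C ^ 2) := by
    have i1 : Integrable (fun ω => X ω * Y ω + C * X ω) μ := hXYi.add (hXi.const_mul C)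
    have i2 : Integrable (fun ω => X ω * Y ω + C * X ω + C * Y ω) μ := i1.add (hYi.const_mul C)
    have i3 : ∫ ω, (X ω * Y ω + C * X ω + C * Y ω + C ^ 2) ∂μ =
        ∫ ω, X ω * Y ω ∂μ + C * ∫ ω, X ω ∂μ + C * ∫ ω, Y ω ∂μ + C ^ 2 := by
      rw [integral_add i2 (integrable_const _), integral_add i1 (hYi.const_mul C),
        integral_add hXYi (hXi.const_mul C), integral_const_mul, integral_const_mul]
      simp
    rw [← i3, ← integral_div]
    refine integral_congr_ae (.of_forall fun ω => ?_)
    dsimp only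
    field_simp
    ring
  have e2 : ∀ Z : Ω → ℝ, Integrable Z μ →
      ∫ ω, (Z ω + C) / (2 * C) ∂μ = (∫ ω, Z ω ∂μ + C) / (2 * C) := by
    intro Z hZ
    rw [integral_div, integral_add hZ (integrable_const _)]
    simp
  rw [e1, e2 X hXi, e2 Y hYi] at key
  have e3 : (∫ ω, X ω * Y ω ∂μ + C * ∫ ω, X ω ∂μ + C * ∫ ω, Y ω ∂μ + C ^ 2) / (4 * C ^ 2) -
      (∫ ω, X ω ∂μ + C) / (2 * C) * ((∫ ω, Y ω ∂μ + C) / (2 * C)) =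
      (∫ ω, X ω * Y ω ∂μ - (∫ ω, X ω ∂μ) * ∫ ω, Y ω ∂μ) / (4 * C ^ 2) := by
    field_simp
    ring
  rw [e3, abs_div, abs_of_pos (by positivity : 0 < 4 * C ^ 2), div_le_iff₀ (by positivity)] at key
  linarith

/-- Second moment of the average of bounded centred variables with small covariances at lags of
at least `d`. -/
lemma integral_sq_average_le {Z : ℕ → Ω → ℝ} {K : ℕ} (hK : 0 < K) {C e : ℝ} {d : ℕ}
    (he : 0 ≤ e) (hZ : ∀ t < K, Measurable (Z t)) (hC : ∀ t < K, ∀ ω, |Z t ω| ≤ C)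
    (hcov : ∀ s t, s + d ≤ t → t < K → |∫ ω, Z s ω * Z t ω ∂μ| ≤ e) :
    ∫ ω, ((K : ℝ)⁻¹ * ∑ t ∈ Finset.range K, Z t ω) ^ 2 ∂μ ≤ e + C ^ 2 * (2 * d) / K := by
  have hint : ∀ s ∈ Finset.range K, ∀ t ∈ Finset.range K,
      Integrable (fun ω => Z s ω * Z t ω) μ := by
    intro s hs t ht
    rw [Finset.mem_range] at hs ht
    refine Integrable.of_bound ((hZ s hs).mul (hZ t ht)).aestronglyMeasurable (C * C)
      (.of_forall fun ω => ?_)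
    rw [norm_mul]
    exact mul_le_mul (hC s hs ω) (hC t ht ω) (norm_nonneg _) ((abs_nonneg _).trans (hC s hs ω))
  -- Pairs at lag at least d contribute at most e each. The others, at most 2d in each row of the
  -- double sum, are bounded trivially by C².
  have hbound : ∀ s ∈ Finset.range K, ∀ t ∈ Finset.range K,
      ∫ ω, Z s ω * Z t ω ∂μ ≤ e + if s < t + d ∧ t < s + d then C ^ 2 else 0 := by
    intro s hs t ht
    have hs' := Finset.mem_range.mp hs
    have ht' := Finset.mem_range.mp ht
    split_ifs with hst
    · have : ∫ ω, Z s ω * Z t ω ∂μ ≤ ∫ _ω, C ^ 2 ∂μ := by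
        refine integral_mono (hint s hs t ht) (integrable_const _) fun ω => ?_
        calc Z s ω * Z t ω ≤ |Z s ω * Z t ω| := le_abs_self _
          _ = |Z s ω| * |Z t ω| := abs_mul _ _
          _ ≤ C * C := mul_le_mul (hC s hs' ω) (hC t ht' ω) (abs_nonneg _)
            ((abs_nonneg _).trans (hC s hs' ω))
          _ = C ^ 2 := (sq C).symm
      simp at this
      linarith
    · rw [add_zero]
      rcases le_or_gt (s + d) t with h | h
      · exact (le_abs_self _).trans (hcov s t h ht')
      · have h2 : t + d ≤ s := by
          by_contra h3
          exact hst ⟨by omega, by omega⟩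
        have := hcov t s h2 hs'
        simp only [mul_comm (Z t _)] at this
        exact (le_abs_self _).trans this
  have hcard : ∀ s ∈ Finset.range K,
      ∑ t ∈ Finset.range K, (if s < t + d ∧ t < s + d then C ^ 2 else 0) ≤ C ^ 2 * (2 * d) := by
    intro s _
    rw [← Finset.sum_filter, Finset.sum_const, nsmul_eq_mul, mul_comm]
    refine mul_le_mul_of_nonneg_left ?_ (sq_nonneg C)
    have hsub : (Finset.range K).filter (fun t => s < t + d ∧ t < s + d) ⊆
        Finset.Ico (s - d) (s + d) := by
      intro t ht
      simp only [Finset.mem_filter, Finset.mem_Ico] at ht ⊢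
      omega
    have := Finset.card_le_card hsub
    rw [Nat.card_Ico] at this
    exact_mod_cast (by omega : ((Finset.range K).filter
      (fun t => s < t + d ∧ t < s + d)).card ≤ 2 * d)
  have hK' : (0 : ℝ) < K := by exact_mod_cast hK
  calc ∫ ω, ((K : ℝ)⁻¹ * ∑ t ∈ Finset.range K, Z t ω) ^ 2 ∂μ
      = (K : ℝ)⁻¹ ^ 2 * ∑ s ∈ Finset.range K, ∑ t ∈ Finset.range K, ∫ ω, Z s ω * Z t ω ∂μ := by
        simp_rw [mul_pow]
        rw [integral_const_mul]
        congr 1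
        simp_rw [sq, Finset.sum_mul_sum]
        rw [integral_finsetSum _ fun s hs => integrable_finsetSum _ fun t ht => hint s hs t ht]
        exact Finset.sum_congr rfl fun s hs => integral_finsetSum _ fun t ht => hint s hs t ht
    _ ≤ (K : ℝ)⁻¹ ^ 2 * ∑ s ∈ Finset.range K, (K * e + C ^ 2 * (2 * d)) := by
        refine mul_le_mul_of_nonneg_left (Finset.sum_le_sum fun s hs => ?_) (by positivity)
        refine (Finset.sum_le_sum (hbound s hs)).trans ?_
        rw [Finset.sum_add_distrib]
        refine add_le_add ?_ (hcard s hs)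
        simp
    _ = e + C ^ 2 * (2 * d) / K := by
        rw [Finset.sum_const, Finset.card_range, nsmul_eq_mul]
        field_simp

/-- The sigma-algebra generated by the variables with times in `J` up to `k`. -/
abbrev pastAlgebra {E : Type*} [MeasurableSpace E] (J : Set ℕ) (ξ : ℕ → Ω → E) (k : ℕ) :
    MeasurableSpace Ω :=
  ⨆ t ∈ {t | t ∈ J ∧ t ≤ k}, MeasurableSpace.comap (ξ t) inferInstance

/-- The sigma-algebra generated by the variables with times in `J` from `k` on. -/
abbrev futureAlgebra {E : Type*} [MeasurableSpace E] (J : Set ℕ) (ξ : ℕ → Ω → E) (k : ℕ) :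
    MeasurableSpace Ω :=
  ⨆ t ∈ {t | t ∈ J ∧ k ≤ t}, MeasurableSpace.comap (ξ t) inferInstance

variable {E : Type*} [MeasurableSpace E]

omit [IsProbabilityMeasure μ] in
lemma pastAlgebra_le {J : Set ℕ} {ξ : ℕ → Ω → E} (hξ : ∀ t, Measurable (ξ t)) (k : ℕ) :
    pastAlgebra J ξ k ≤ mΩ :=
  iSup₂_le fun t _ => (hξ t).comap_le

lemma futureAlgebra_le {J : Set ℕ} {ξ : ℕ → Ω → E} (hξ : ∀ t, Measurable (ξ t)) (k : ℕ) :
    futureAlgebra J ξ k ≤ mΩ :=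
  iSup₂_le fun t _ => (hξ t).comap_le

omit mΩ in
lemma measurable_pastAlgebra {J : Set ℕ} {ξ : ℕ → Ω → E} {k t : ℕ} (ht : t ∈ J) (hk : t ≤ k) :
    Measurable[pastAlgebra J ξ k] (ξ t) :=
  (comap_measurable (ξ t)).mono
    (le_iSup₂_of_le (f := fun t (_ : t ∈ {t | t ∈ J ∧ t ≤ k}) =>
      MeasurableSpace.comap (ξ t) inferInstance) t ⟨ht, hk⟩ le_rfl) le_rfl

omit mΩ in
lemma measurable_futureAlgebra {J : Set ℕ} {ξ : ℕ → Ω → E} {k t : ℕ} (ht : t ∈ J)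
    (hk : k ≤ t) : Measurable[futureAlgebra J ξ k] (ξ t) :=
  (comap_measurable (ξ t)).mono
    (le_iSup₂_of_le (f := fun t (_ : t ∈ {t | t ∈ J ∧ k ≤ t}) =>
      MeasurableSpace.comap (ξ t) inferInstance) t ⟨ht, hk⟩ le_rfl) le_rfl

/-- Mixing coefficients bound the covariances of bounded functions of the past and the future. -/
lemma StronglyMixing.exists_covariance_le {ι : Type*} {I : ι → Set ℕ} {ξ : ι → ℕ → Ω → E}
    (h : StronglyMixing μ I ξ) (hξ : ∀ i t, Measurable (ξ i t)) :
    ∃ a : ℕ → ℝ, Tendsto a atTop (𝓝 0) ∧ ∀ (i : ι) (k g : ℕ) (X Y : Ω → ℝ) (C : ℝ), 0 < C →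
      Measurable[pastAlgebra (I i) (ξ i) k] X → Measurable[futureAlgebra (I i) (ξ i) (k + g)] Y →
      (∀ ω, |X ω| ≤ C) → (∀ ω, |Y ω| ≤ C) →
      |∫ ω, X ω * Y ω ∂μ - (∫ ω, X ω ∂μ) * ∫ ω, Y ω ∂μ| ≤ 4 * C ^ 2 * a g := by
  obtain ⟨a, ha, hmix⟩ := h
  exact ⟨a, ha, fun i k g X Y C hC hX hY hXC hYC =>
    abs_covariance_le_of_bounded (pastAlgebra_le (hξ i) k) (futureAlgebra_le (hξ i) (k + g))
      (fun A B hA hB => hmix i k g A B hA hB) hX hY hC hXC hYC⟩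

/-- Dominated convergence in the truncation level: the remainder is dominated by |f| and is zero
once the level exceeds |f x|. -/
lemma exists_truncation_integral_le {ρ : Measure E} {f : E → ℝ} (hf : Measurable f)
    (hfi : Integrable f ρ) {ε : ℝ} (hε : 0 < ε) :
    ∃ C : ℝ, 0 < C ∧ ∫ x, |f x - max (-C) (min (f x) C)| ∂ρ ≤ ε := by
  have hlim : Tendsto (fun n : ℕ => ∫ x, |f x - max (-(n : ℝ)) (min (f x) n)| ∂ρ) atTop
      (𝓝 (∫ _, (0 : ℝ) ∂ρ)) := by
    refine tendsto_integral_of_dominated_convergence (fun x => |f x|)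
      (fun n => by fun_prop) hfi.abs (fun n => .of_forall fun x => ?_)
      (.of_forall fun x => ?_)
    · have hn : (0 : ℝ) ≤ n := n.cast_nonneg
      rw [Real.norm_eq_abs, abs_abs]
      rcases max_cases (-(n : ℝ)) (min (f x) n) with ⟨h1, h2⟩ | ⟨h1, h2⟩ <;>
      rcases min_cases (f x) (n : ℝ) with ⟨h3, h4⟩ | ⟨h3, h4⟩ <;>
      rw [h1] <;> (try rw [h3]) <;> rw [abs_le] <;> constructor <;>
      rcases abs_cases (f x) with ⟨h5, h6⟩ | ⟨h5, h6⟩ <;> linarith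
    · refine tendsto_const_nhds.congr' ?_
      filter_upwards [eventually_ge_atTop ⌈|f x|⌉₊] with n hn
      have hn' : |f x| ≤ n := (Nat.le_ceil _).trans (by exact_mod_cast hn)
      rw [min_eq_left (le_of_abs_le hn'), max_eq_right (neg_le_of_abs_le hn'), sub_self, abs_zero]
  rw [integral_zero] at hlim
  obtain ⟨n, hn0, hn⟩ := ((eventually_gt_atTop 0).and (hlim.eventually_lt_const hε)).exists
  exact ⟨n, by exact_mod_cast hn0, hn.le⟩

/-- Weak law of large numbers in `L¹`, uniform over all windows of a strongly mixing array on which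
the variables are identically distributed. -/
theorem StronglyMixing.exists_integral_abs_average_sub_le {ι : Type*} {I : ι → Set ℕ}
    {ξ : ι → ℕ → Ω → E} (h : StronglyMixing μ I ξ) (hξ : ∀ i t, Measurable (ξ i t))
    {ρ : Measure E} {f : E → ℝ} (hf : Measurable f) (hfi : Integrable f ρ) {ε : ℝ} (hε : 0 < ε) :
    ∃ K : ℕ, ∀ (i : ι) (s k : ℕ), K ≤ k → (∀ r < k, s + r ∈ I i) →
      (∀ r < k, μ.map (ξ i (s + r)) = ρ) →
      ∫ ω, |(k : ℝ)⁻¹ * ∑ r ∈ Finset.range k, f (ξ i (s + r) ω) - ∫ x, f x ∂ρ| ∂μ ≤ ε := by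
  obtain ⟨a, ha, hcov⟩ := h.exists_covariance_le hξ
  -- Only integrability is available, while the covariance bound needs bounded functions. Four
  -- errors of at most ε/5 arise: the truncation remainder, the resulting shift of the mean, and two
  -- from the average of the truncated variables.
  obtain ⟨C, hC, htr⟩ := exists_truncation_integral_le hf hfi (ε := ε / 5) (by positivity)
  set g : E → ℝ := fun x => max (-C) (min (f x) C) with hg
  have hgm : Measurable g := by fun_prop
  have hgC : ∀ x, |g x| ≤ C := fun x => abs_le.mpr
    ⟨le_max_left _ _, max_le (by linarith) (min_le_right _ _)⟩
  -- the centred truncated variables are bounded by `2 * C`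
  have hlag : ∃ d : ℕ, 4 * (2 * C) ^ 2 * |a d| ≤ (ε / 5) ^ 2 / 2 := by
    have h0 : Tendsto (fun d => 4 * (2 * C) ^ 2 * |a d|) atTop (𝓝 0) := by
      simpa using ha.abs.const_mul (4 * (2 * C) ^ 2)
    exact ((h0.eventually_lt_const (by positivity : (0 : ℝ) < (ε / 5) ^ 2 / 2)).exists).imp
      fun _ h => h.le
  obtain ⟨d, hd⟩ := hlag
  -- The mixing bound `a` need not be monotone. Larger gaps reduce to the gap d because the future
  -- from k + g is contained in the future from k + d.
  have hlag' : ∀ g ≥ d, ∀ i (k : ℕ) (X Y : Ω → ℝ),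
      Measurable[pastAlgebra (I i) (ξ i) k] X → Measurable[futureAlgebra (I i) (ξ i) (k + g)] Y →
      (∀ ω, |X ω| ≤ 2 * C) → (∀ ω, |Y ω| ≤ 2 * C) → (∫ ω, X ω ∂μ) = 0 →
      |∫ ω, X ω * Y ω ∂μ| ≤ (ε / 5) ^ 2 / 2 := by
    intro g hg i k X Y hX hY hXC hYC h0
    have hY' : Measurable[futureAlgebra (I i) (ξ i) (k + d)] Y := by
      refine hY.mono ?_ le_rfl
      exact biSup_mono fun t ht => ⟨ht.1, by have := ht.2; omega⟩
    have := hcov i k d X Y (2 * C) (by positivity) hX hY' hXC hYC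
    rw [h0, zero_mul, sub_zero] at this
    refine this.trans (le_trans ?_ hd)
    gcongr
    exact le_abs_self _
  -- From this length on, the pairs at lag below d contribute at most (ε/5)²/2. The choice involves
  -- neither the row nor the position of the window, whence the uniformity.
  obtain ⟨K, hK⟩ := exists_nat_gt ((2 * C) ^ 2 * (2 * d) / ((ε / 5) ^ 2 / 2))
  refine ⟨K + 1, fun i s k hk hI hlaw => ?_⟩
  have hk0 : 0 < k := by omega
  have hk0' : (0 : ℝ) < k := by exact_mod_cast hk0
  have hρ : IsProbabilityMeasure ρ := by
    rw [← hlaw 0 hk0]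
    exact Measure.isProbabilityMeasure_map (hξ i _).aemeasurable
  have hgi : Integrable g ρ := Integrable.of_bound hgm.aestronglyMeasurable C (.of_forall hgC)
  have htransfer : ∀ (φ : E → ℝ), Measurable φ → ∀ r < k,
      ∫ ω, φ (ξ i (s + r) ω) ∂μ = ∫ x, φ x ∂ρ := by
    intro φ hφ r hr
    rw [← hlaw r hr, integral_map (hξ i _).aemeasurable hφ.aestronglyMeasurable]
  have htransferi : ∀ (φ : E → ℝ), Measurable φ → Integrable φ ρ → ∀ r < k,
      Integrable (fun ω => φ (ξ i (s + r) ω)) μ := by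
    intro φ hφ hi r hr
    rw [← hlaw r hr] at hi
    exact hi.comp_measurable (hξ i _)
  set c := ∫ x, g x ∂ρ with hc
  have hcC : |c| ≤ C := by
    simpa using norm_integral_le_of_norm_le_const (μ := ρ) (f := g) (.of_forall hgC)
  set Z : ℕ → Ω → ℝ := fun r ω => g (ξ i (s + r) ω) - c with hZ
  have hZm : ∀ r, Measurable (Z r) := fun r => (hgm.comp (hξ i _)).sub_const c
  have hZC : ∀ r ω, |Z r ω| ≤ 2 * C := fun r ω => by
    have h1 := abs_le.mp (hgC (ξ i (s + r) ω))
    have h2 := abs_le.mp hcC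
    exact abs_le.mpr ⟨by simp only [hZ]; linarith, by simp only [hZ]; linarith⟩
  have hZ0 : ∀ r < k, ∫ ω, Z r ω ∂μ = 0 := by
    intro r hr
    simp only [hZ]
    rw [integral_sub (htransferi g hgm hgi r hr) (integrable_const _), htransfer g hgm r hr]
    simp [hc]
  have hsq : ∫ ω, ((k : ℝ)⁻¹ * ∑ r ∈ Finset.range k, Z r ω) ^ 2 ∂μ ≤ (ε / 5) ^ 2 := by
    refine (integral_sq_average_le hk0 (e := (ε / 5) ^ 2 / 2) (d := d) (C := 2 * C)
      (by positivity) (fun t _ => hZm t) (fun t _ => hZC t) ?_).trans ?_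
    · intro p q hpq hq
      refine hlag' (q - p) (by omega) i (s + p) (Z p) (Z q) ?_ ?_ (hZC p) (hZC q)
        (hZ0 p (by omega))
      · exact (hgm.comp (measurable_pastAlgebra (hI p (by omega)) le_rfl)).sub_const c
      · exact (hgm.comp (measurable_futureAlgebra (hI q hq) (by omega))).sub_const c
    · have h1 : (2 * C) ^ 2 * (2 * d) / k ≤ (ε / 5) ^ 2 / 2 := by
        rw [div_le_iff₀ hk0']
        rw [div_lt_iff₀ (by positivity)] at hK
        have : (K : ℝ) ≤ k := by exact_mod_cast (by omega : K ≤ k)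
        nlinarith [hK, this, sq_nonneg (ε / 5)]
      linarith
  have hWi : Integrable (fun ω => ((k : ℝ)⁻¹ * ∑ r ∈ Finset.range k, Z r ω) ^ 2) μ := by
    refine Integrable.of_bound (by fun_prop) ((2 * C) ^ 2) (.of_forall fun ω => ?_)
    rw [norm_pow]
    gcongr
    rw [norm_mul, norm_inv, Real.norm_natCast, ← div_eq_inv_mul, div_le_iff₀ hk0']
    refine (norm_sum_le _ _).trans ((Finset.sum_le_sum fun r _ => hZC r ω).trans ?_)
    simp [mul_comm]
  have hres : ∀ r < k, ∫ ω, |f (ξ i (s + r) ω) - g (ξ i (s + r) ω)| ∂μ ≤ ε / 5 := by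
    intro r hr
    rw [htransfer (fun x => |f x - g x|) (by fun_prop) r hr]
    exact htr
  have hresi : ∀ r < k, Integrable (fun ω => |f (ξ i (s + r) ω) - g (ξ i (s + r) ω)|) μ :=
    fun r hr => htransferi (fun x => |f x - g x|) (by fun_prop) (hfi.sub hgi).abs r hr
  have hmean : |c - ∫ x, f x ∂ρ| ≤ ε / 5 := by
    rw [hc, ← integral_sub hgi hfi, ← abs_neg, ← integral_neg]
    refine (abs_integral_le_integral_abs).trans (le_trans (le_of_eq ?_) htr)
    exact integral_congr_ae (.of_forall fun x => by dsimp only; rw [neg_sub])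
  have hpt : ∀ ω, |(k : ℝ)⁻¹ * ∑ r ∈ Finset.range k, f (ξ i (s + r) ω) - ∫ x, f x ∂ρ| ≤
      (k : ℝ)⁻¹ * ∑ r ∈ Finset.range k, |f (ξ i (s + r) ω) - g (ξ i (s + r) ω)| +
      (ε / 5 + (ε / 5)⁻¹ * ((k : ℝ)⁻¹ * ∑ r ∈ Finset.range k, Z r ω) ^ 2) + ε / 5 := by
    intro ω
    set W := (k : ℝ)⁻¹ * ∑ r ∈ Finset.range k, Z r ω with hW
    have hW1 : W = (k : ℝ)⁻¹ * ∑ r ∈ Finset.range k, g (ξ i (s + r) ω) - c := by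
      simp only [hW, hZ, Finset.sum_sub_distrib, Finset.sum_const, Finset.card_range, nsmul_eq_mul]
      field_simp
    -- Passage from the second to the first absolute moment through |W| ≤ η + W²/η with η = ε/5.
    have hW2 : |W| ≤ ε / 5 + (ε / 5)⁻¹ * W ^ 2 := by
      have h5 : 0 < ε / 5 := by positivity
      rcases le_or_gt |W| (ε / 5) with hle | hgt
      · have : 0 ≤ (ε / 5)⁻¹ * W ^ 2 := by positivity
        linarith
      · have : |W| ≤ (ε / 5)⁻¹ * W ^ 2 := by
          rw [← div_eq_inv_mul, le_div_iff₀ h5, ← sq_abs, sq]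
          exact mul_le_mul_of_nonneg_left hgt.le (abs_nonneg _)
        linarith
    have hsplit : (k : ℝ)⁻¹ * ∑ r ∈ Finset.range k, f (ξ i (s + r) ω) - ∫ x, f x ∂ρ =
        (k : ℝ)⁻¹ * ∑ r ∈ Finset.range k, (f (ξ i (s + r) ω) - g (ξ i (s + r) ω)) + W +
        (c - ∫ x, f x ∂ρ) := by
      rw [hW1, Finset.sum_sub_distrib]
      ring
    rw [hsplit]
    have h1 : |(k : ℝ)⁻¹ * ∑ r ∈ Finset.range k, (f (ξ i (s + r) ω) - g (ξ i (s + r) ω))| ≤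
        (k : ℝ)⁻¹ * ∑ r ∈ Finset.range k, |f (ξ i (s + r) ω) - g (ξ i (s + r) ω)| := by
      rw [abs_mul, abs_of_pos (inv_pos.mpr hk0')]
      gcongr
      exact Finset.abs_sum_le_sum_abs _ _
    refine (abs_add_le _ _).trans (add_le_add ((abs_add_le _ _).trans (add_le_add h1 hW2)) hmean)
  have hi1 : Integrable (fun ω => (k : ℝ)⁻¹ * ∑ r ∈ Finset.range k,
      |f (ξ i (s + r) ω) - g (ξ i (s + r) ω)|) μ :=
    (integrable_finsetSum _ fun r hr => hresi r (Finset.mem_range.mp hr)).const_mul _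
  have hi2 : Integrable (fun ω => ε / 5 + (ε / 5)⁻¹ *
      ((k : ℝ)⁻¹ * ∑ r ∈ Finset.range k, Z r ω) ^ 2) μ :=
    (integrable_const _).add (hWi.const_mul _)
  refine (integral_mono_of_nonneg (.of_forall fun _ => abs_nonneg _)
    ((hi1.add hi2).add (integrable_const (ε / 5))) (.of_forall hpt)).trans ?_
  rw [integral_add' (hi1.add hi2) (integrable_const _), integral_add' hi1 hi2,
    integral_add (integrable_const _) (hWi.const_mul _), integral_const_mul, integral_const_mul,
    integral_finsetSum _ fun r hr => hresi r (Finset.mem_range.mp hr)]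
  have h1 : (k : ℝ)⁻¹ * ∑ r ∈ Finset.range k,
      ∫ ω, |f (ξ i (s + r) ω) - g (ξ i (s + r) ω)| ∂μ ≤ ε / 5 := by
    rw [← div_eq_inv_mul, div_le_iff₀ hk0']
    refine (Finset.sum_le_sum fun r hr => hres r (Finset.mem_range.mp hr)).trans ?_
    simp [mul_comm]
  have h2 : (ε / 5)⁻¹ * ∫ ω, ((k : ℝ)⁻¹ * ∑ r ∈ Finset.range k, Z r ω) ^ 2 ∂μ ≤ ε / 5 := by
    rw [← div_eq_inv_mul, div_le_iff₀ (by positivity), ← sq]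
    exact hsq
  simp only [integral_const, probReal_univ, one_smul]
  linarith

end Mixing

/-! Least squares over the unit simplex: linearization at a point of the simplex. -/

section QuadraticProgram

open Matrix

variable {ι : Type*} [Fintype ι]

/-- The sum of the absolute values of the coordinates. -/
def absSum (x : ι → ℝ) : ℝ := ∑ i, |x i|

lemma absSum_nonneg (x : ι → ℝ) : 0 ≤ absSum x := Finset.sum_nonneg fun _ _ => abs_nonneg _

lemma abs_le_absSum (x : ι → ℝ) (i : ι) : |x i| ≤ absSum x :=
  Finset.single_le_sum (f := fun i => |x i|) (fun _ _ => abs_nonneg _) (Finset.mem_univ i)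

lemma absSum_smul (a : ℝ) (x : ι → ℝ) : absSum (a • x) = |a| * absSum x := by
  simp [absSum, abs_mul, Finset.mul_sum]

lemma eq_zero_of_absSum_eq_zero {x : ι → ℝ} (h : absSum x = 0) : x = 0 := by
  ext i
  have := abs_le_absSum x i
  rw [h] at this
  simpa using this

lemma continuous_absSum : Continuous (absSum : (ι → ℝ) → ℝ) := by
  unfold absSum
  fun_prop

lemma abs_dotProduct_le {x y : ι → ℝ} {M : ℝ} (hx : ∀ i, |x i| ≤ M) :
    |x ⬝ᵥ y| ≤ M * absSum y := by
  rw [dotProduct, absSum, Finset.mul_sum]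
  refine (Finset.abs_sum_le_sum_abs _ _).trans (Finset.sum_le_sum fun i _ => ?_)
  rw [abs_mul]
  exact mul_le_mul_of_nonneg_right (hx i) (abs_nonneg _)

lemma abs_mulVec_le {B : Matrix ι ι ℝ} {δ : ℝ} (hB : ∀ i j, |B i j| ≤ δ) (x : ι → ℝ) (i : ι) :
    |(B *ᵥ x) i| ≤ δ * absSum x :=
  abs_dotProduct_le (hB i)

/-- The form attains a positive minimum on the compact ℓ¹ sphere, and homogeneity extends the bound.
If the sphere is empty, every vector is zero and any constant works. -/
lemma Matrix.PosDef.exists_absSum_sq_le {A : Matrix ι ι ℝ} (hA : A.PosDef) :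
    ∃ c > 0, ∀ x : ι → ℝ, c * absSum x ^ 2 ≤ x ⬝ᵥ A *ᵥ x := by
  have hcont : Continuous fun x : ι → ℝ => x ⬝ᵥ A *ᵥ x := by fun_prop
  have hcpt : IsCompact {x : ι → ℝ | absSum x = 1} := by
    refine (isCompact_closedBall (0 : ι → ℝ) 1).of_isClosed_subset
      (isClosed_eq continuous_absSum continuous_const) fun x (hx : absSum x = 1) => ?_
    rw [mem_closedBall_zero_iff, pi_norm_le_iff_of_nonneg zero_le_one]
    exact fun i => hx ▸ abs_le_absSum x i
  rcases Set.eq_empty_or_nonempty {x : ι → ℝ | absSum x = 1} with hem | hne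
  · refine ⟨1, one_pos, fun x => ?_⟩
    have h0 : absSum x = 0 := by
      by_contra h
      have : (absSum x)⁻¹ • x ∈ {x : ι → ℝ | absSum x = 1} := by
        rw [Set.mem_ofPred_eq, absSum_smul, abs_of_nonneg (inv_nonneg.mpr (absSum_nonneg x)),
          inv_mul_cancel₀ h]
      rw [hem] at this
      exact this
    rw [eq_zero_of_absSum_eq_zero h0]
    simp [absSum]
  · obtain ⟨x₀, hx₀, hmin⟩ := hcpt.exists_isMinOn hne hcont.continuousOn
    have hx₀ne : x₀ ≠ 0 := by
      rintro rfl
      simp [absSum] at hx₀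
    refine ⟨x₀ ⬝ᵥ A *ᵥ x₀, by simpa using hA.dotProduct_mulVec_pos hx₀ne, fun x => ?_⟩
    rcases eq_or_ne (absSum x) 0 with h0 | h0
    · rw [eq_zero_of_absSum_eq_zero h0]
      simp [absSum]
    · have hmem : (absSum x)⁻¹ • x ∈ {x : ι → ℝ | absSum x = 1} := by
        rw [Set.mem_ofPred_eq, absSum_smul, abs_of_nonneg (inv_nonneg.mpr (absSum_nonneg x)),
          inv_mul_cancel₀ h0]
      have h1 : x₀ ⬝ᵥ A *ᵥ x₀ ≤ (absSum x)⁻¹ • x ⬝ᵥ A *ᵥ ((absSum x)⁻¹ • x) := hmin hmem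
      rw [mulVec_smul, dotProduct_smul, smul_dotProduct, smul_eq_mul, smul_eq_mul] at h1
      calc x₀ ⬝ᵥ A *ᵥ x₀ * absSum x ^ 2
          ≤ (absSum x)⁻¹ * ((absSum x)⁻¹ * x ⬝ᵥ A *ᵥ x) * absSum x ^ 2 := by gcongr
        _ = x ⬝ᵥ A *ᵥ x := by field_simp

/-- First-order condition at an endpoint: if b < 0, then at s = min(1, -b/(2a)) the quadratic is at
most bs/2, which is negative. -/
lemma nonneg_of_forall_quadratic {a b : ℝ}
    (h : ∀ s : ℝ, 0 ≤ s → s ≤ 1 → 0 ≤ a * s ^ 2 + b * s) : 0 ≤ b := by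
  by_contra! hb
  have ha : 0 < a := by
    have := h 1 zero_le_one le_rfl
    linarith
  have hs : 0 < min 1 (-b / (2 * a)) := lt_min one_pos (div_pos (by linarith) (by linarith))
  have h1 := h _ hs.le (min_le_left _ _)
  have h2 : a * min 1 (-b / (2 * a)) ≤ -b / 2 := by
    calc a * min 1 (-b / (2 * a)) ≤ a * (-b / (2 * a)) := by gcongr; exact min_le_right _ _
      _ = -b / 2 := by field_simp
  nlinarith

/-- The tangent cone of the unit simplex at `w₀`. -/
def simplexCone (w₀ : ι → ℝ) : Set (ι → ℝ) := {x | ∑ i, x i = 0 ∧ ∀ i, w₀ i = 0 → 0 ≤ x i}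

lemma zero_mem_simplexCone (w₀ : ι → ℝ) : (0 : ι → ℝ) ∈ simplexCone w₀ := by
  simp [simplexCone]

lemma isClosed_simplexCone (w₀ : ι → ℝ) : IsClosed (simplexCone w₀) := by
  have : simplexCone w₀ = {x | ∑ i, x i = 0} ∩ ⋂ i, ⋂ _ : w₀ i = 0, {x | 0 ≤ x i} := by
    ext x
    simp [simplexCone]
  rw [this]
  refine IsClosed.inter (isClosed_eq (by fun_prop) continuous_const) ?_
  exact isClosed_iInter fun i => isClosed_iInter fun _ =>
    isClosed_le continuous_const (continuous_apply i)

lemma convex_simplexCone (w₀ : ι → ℝ) : Convex ℝ (simplexCone w₀) := by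
  rintro x ⟨hx, hx'⟩ y ⟨hy, hy'⟩ a b ha hb _
  refine ⟨?_, fun i hi => ?_⟩
  · simp [Finset.sum_add_distrib, ← Finset.mul_sum, hx, hy]
  · have h1 := mul_nonneg ha (hx' i hi)
    have h2 := mul_nonneg hb (hy' i hi)
    simpa using add_nonneg h1 h2

lemma smul_sub_mem_simplexCone {w₀ w : ι → ℝ} (hw₀ : w₀ ∈ stdSimplex ℝ ι)
    (hw : w ∈ stdSimplex ℝ ι) {s : ℝ} (hs : 0 ≤ s) : s • (w - w₀) ∈ simplexCone w₀ := by
  refine ⟨?_, fun i hi => ?_⟩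
  · simp [← Finset.mul_sum, hw.2, hw₀.2]
  · simpa [hi] using mul_nonneg hs (hw.1 i)

/-- The number r is the room left by the constraints that are inactive at w₀. -/
lemma exists_pos_le_of_mem_stdSimplex {w₀ : ι → ℝ} (hw₀ : w₀ ∈ stdSimplex ℝ ι) :
    ∃ r > 0, ∀ i, w₀ i ≠ 0 → r ≤ w₀ i := by
  have hpos : ∀ i, w₀ i ≠ 0 → 0 < w₀ i := fun i h => lt_of_le_of_ne (hw₀.1 i) h.symm
  have : ∀ᶠ r in 𝓝[>] (0 : ℝ), ∀ i, w₀ i ≠ 0 → r ≤ w₀ i := by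
    refine eventually_all.mpr fun i => ?_
    by_cases h : w₀ i = 0
    · simp [h]
    · filter_upwards [nhdsWithin_le_nhds (Iic_mem_nhds (hpos i h))] with r hr _
      exact hr
  obtain ⟨r, hr, hr0⟩ := (this.and self_mem_nhdsWithin).exists
  exact ⟨r, hr0, hr⟩

/-- Polyhedrality: small cone directions are feasible exactly, not merely to first order.
Coordinates where w₀ vanishes can only grow, and the others have room r. This is what reduces the
programme on the simplex to one on the cone. -/
lemma add_inv_smul_mem_stdSimplex {w₀ x : ι → ℝ} (hw₀ : w₀ ∈ stdSimplex ℝ ι)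
    (hx : x ∈ simplexCone w₀) {r s : ℝ} (hr : ∀ i, w₀ i ≠ 0 → r ≤ w₀ i) (hs : 0 < s)
    (hxs : absSum x ≤ s * r) : w₀ + s⁻¹ • x ∈ stdSimplex ℝ ι := by
  refine ⟨fun i => ?_, ?_⟩
  · simp only [Pi.add_apply, Pi.smul_apply, smul_eq_mul]
    by_cases h : w₀ i = 0
    · rw [h, zero_add]
      exact mul_nonneg (inv_nonneg.mpr hs.le) (hx.2 i h)
    · have h1 : -x i ≤ s * w₀ i := by
        calc -x i ≤ |x i| := neg_le_abs _
          _ ≤ absSum x := abs_le_absSum x i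
          _ ≤ s * r := hxs
          _ ≤ s * w₀ i := by gcongr; exact hr i h
      have h2 : s⁻¹ * -x i ≤ w₀ i := by
        rw [← div_eq_inv_mul, div_le_iff₀ hs, mul_comm]
        exact h1
      linarith
  · simp [Finset.sum_add_distrib, ← Finset.mul_sum, hw₀.2, hx.1]

/-- The solution of the variational inequality of the quadratic programme
`min (x ⬝ᵥ A *ᵥ x - 2 * b ⬝ᵥ x)` over the tangent cone. -/
def IsConeSolution (A : Matrix ι ι ℝ) (w₀ b x : ι → ℝ) : Prop :=
  x ∈ simplexCone w₀ ∧ ∀ y ∈ simplexCone w₀, 0 ≤ (A *ᵥ x - b) ⬝ᵥ (y - x)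

/-- Outside the ball of radius R = 2|b|/c the objective is nonnegative, while it is zero at the
origin; so a minimizer over the compact part of the cone is a global one. Convexity keeps segments
inside the cone, and the variational inequality is the first-order condition along them. -/
lemma Matrix.PosDef.exists_isConeSolution {A : Matrix ι ι ℝ} (hA : A.PosDef) (w₀ b : ι → ℝ) :
    ∃ x, IsConeSolution A w₀ b x := by
  obtain ⟨c, hc, hcA⟩ := hA.exists_absSum_sq_le
  set q : (ι → ℝ) → ℝ := fun x => x ⬝ᵥ A *ᵥ x - 2 * (b ⬝ᵥ x) with hq
  have hqc : Continuous q := by fun_prop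
  set R : ℝ := 2 * absSum b / c with hR
  have hR0 : 0 ≤ R := by have := absSum_nonneg b; positivity
  set K : Set (ι → ℝ) := simplexCone w₀ ∩ {x | absSum x ≤ R} with hK
  have hKc : IsCompact K := by
    refine (isCompact_closedBall (0 : ι → ℝ) R).of_isClosed_subset
      ((isClosed_simplexCone w₀).inter (isClosed_le continuous_absSum continuous_const)) ?_
    rintro x ⟨_, hx⟩
    rw [mem_closedBall_zero_iff, pi_norm_le_iff_of_nonneg hR0]
    exact fun i => (abs_le_absSum x i).trans hx
  have h0K : (0 : ι → ℝ) ∈ K := ⟨zero_mem_simplexCone w₀, by simpa [absSum] using hR0⟩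
  obtain ⟨x, hxK, hmin⟩ := hKc.exists_isMinOn ⟨0, h0K⟩ hqc.continuousOn
  have hmin' : ∀ y ∈ simplexCone w₀, q x ≤ q y := by
    intro y hy
    by_cases hyR : absSum y ≤ R
    · exact hmin ⟨hy, hyR⟩
    · push Not at hyR
      have h1 : q x ≤ 0 := by simpa [hq] using hmin h0K
      have h2 : b ⬝ᵥ y ≤ absSum b * absSum y :=
        (le_abs_self _).trans (abs_dotProduct_le (abs_le_absSum b))
      have h3 := hcA y
      have h4 : 2 * absSum b < c * absSum y := by
        rw [hR, div_lt_iff₀ hc] at hyR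
        linarith
      have h5 : 0 ≤ absSum y * (c * absSum y - 2 * absSum b) :=
        mul_nonneg (absSum_nonneg y) (by linarith)
      have : 0 ≤ q y := by simp only [hq]; nlinarith
      linarith
  refine ⟨x, hxK.1, fun y hy => ?_⟩
  have hsym : ∀ u v : ι → ℝ, u ⬝ᵥ A *ᵥ v = v ⬝ᵥ A *ᵥ u := by
    intro u v
    have hT : Aᵀ = A := by simpa using hA.isHermitian.eq
    rw [dotProduct_mulVec, ← mulVec_transpose, hT, dotProduct_comm]
  have key : 0 ≤ 2 * ((A *ᵥ x - b) ⬝ᵥ (y - x)) := by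
    refine nonneg_of_forall_quadratic (a := (y - x) ⬝ᵥ A *ᵥ (y - x)) fun s hs0 hs1 => ?_
    have hmem : x + s • (y - x) ∈ simplexCone w₀ := by
      have := convex_simplexCone w₀ hxK.1 hy (sub_nonneg.mpr hs1) hs0 (by ring)
      convert this using 1
      module
    have h1 := hmin' _ hmem
    simp only [hq, mulVec_add, mulVec_smul, dotProduct_add, add_dotProduct, smul_dotProduct,
      dotProduct_smul, smul_eq_mul] at h1
    rw [hsym x (y - x)] at h1
    rw [sub_dotProduct (A *ᵥ x), dotProduct_comm (A *ᵥ x)]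
    linarith
  linarith

/-- Perturbation bound for two variational inequalities. -/
lemma absSum_sub_le_of_variational {A A' : Matrix ι ι ℝ} {b b' x x' : ι → ℝ} {c δ ε : ℝ}
    (hc : 0 < c) (hcA : ∀ x : ι → ℝ, c * absSum x ^ 2 ≤ x ⬝ᵥ A *ᵥ x)
    (hδ : ∀ i j, |A' i j - A i j| ≤ δ) (hδc : δ ≤ c / 2) (hε : ∀ i, |b' i - b i| ≤ ε)
    (hε0 : 0 ≤ ε) (hδ0 : 0 ≤ δ)
    (hx : 0 ≤ (A *ᵥ x - b) ⬝ᵥ (x' - x)) (hx' : 0 ≤ (A' *ᵥ x' - b') ⬝ᵥ (x - x')) :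
    absSum (x' - x) ≤ 2 * (δ * absSum x + ε) / c := by
  set d := x' - x with hd
  have e : x - x' = -d := by rw [hd]; abel
  have hx'd : x' = x + d := by rw [hd]; abel
  -- The sum of the two variational inequalities. With coercivity it gives c|d|² ≤ δ|x||d| + δ|d|² +
  -- ε|d|; the middle term is absorbed since δ ≤ c/2, and division by |d| finishes when d is
  -- nonzero.
  have h1 : d ⬝ᵥ A *ᵥ d ≤ -(((A' - A) *ᵥ x) ⬝ᵥ d) - ((A' - A) *ᵥ d) ⬝ᵥ d + (b' - b) ⬝ᵥ d := by
    rw [e, hx'd, mulVec_add] at hx'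
    simp only [sub_mulVec, sub_dotProduct, add_dotProduct, dotProduct_neg] at hx hx' ⊢
    rw [dotProduct_comm d]
    linarith
  have hB : ∀ i j, |(A' - A) i j| ≤ δ := fun i j => by simpa using hδ i j
  have h2 := (neg_le_abs _).trans (abs_dotProduct_le (y := d) (abs_mulVec_le hB x))
  have h3 := (neg_le_abs _).trans (abs_dotProduct_le (y := d) (abs_mulVec_le hB d))
  have h4 := (le_abs_self _).trans (abs_dotProduct_le (x := b' - b) (y := d) (M := ε)
    fun i => by simpa using hε i)
  have h5 := hcA d
  have hd0 := absSum_nonneg d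
  rw [le_div_iff₀ hc]
  rcases hd0.eq_or_lt with h0 | hpos
  · rw [← h0]
    have := absSum_nonneg x
    simp only [zero_mul]
    positivity
  · refine le_of_mul_le_mul_right ?_ hpos
    nlinarith [mul_le_mul_of_nonneg_right hδc (sq_nonneg (absSum d))]

open Classical in
/-- The minimizer of `x ⬝ᵥ A *ᵥ x - 2 * b ⬝ᵥ x` over the tangent cone. -/
noncomputable def coneSolution (A : Matrix ι ι ℝ) (w₀ b : ι → ℝ) : ι → ℝ :=
  if h : ∃ x, IsConeSolution A w₀ b x then h.choose else 0

lemma Matrix.PosDef.isConeSolution_coneSolution {A : Matrix ι ι ℝ} (hA : A.PosDef)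
    (w₀ b : ι → ℝ) : IsConeSolution A w₀ b (coneSolution A w₀ b) := by
  have h := hA.exists_isConeSolution w₀ b
  rw [coneSolution, dif_pos h]
  exact h.choose_spec

/-- The perturbation bound with equal matrices, so that only the change of the linear term remains.
-/
lemma absSum_coneSolution_sub_le {A : Matrix ι ι ℝ} (hA : A.PosDef) (w₀ : ι → ℝ) {c : ℝ}
    (hc : 0 < c) (hcA : ∀ x : ι → ℝ, c * absSum x ^ 2 ≤ x ⬝ᵥ A *ᵥ x) (b b' : ι → ℝ) :
    absSum (coneSolution A w₀ b' - coneSolution A w₀ b) ≤ 2 * absSum (b' - b) / c := by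
  have hb := hA.isConeSolution_coneSolution w₀ b
  have hb' := hA.isConeSolution_coneSolution w₀ b'
  have := absSum_sub_le_of_variational (A' := A) (δ := 0) hc hcA (by simp) (by positivity)
    (ε := absSum (b' - b)) (b := b) (b' := b') (fun i => abs_le_absSum (b' - b) i)
    (absSum_nonneg _) le_rfl (hb.2 _ hb'.1) (hb'.2 _ hb.1)
  simpa using this

/-- The variational inequality tested at the origin, which lies in the cone, gives x'Ax ≤ b'x. -/
lemma absSum_coneSolution_le {A : Matrix ι ι ℝ} (hA : A.PosDef) (w₀ : ι → ℝ) {c : ℝ}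
    (hc : 0 < c) (hcA : ∀ x : ι → ℝ, c * absSum x ^ 2 ≤ x ⬝ᵥ A *ᵥ x) (b : ι → ℝ) :
    absSum (coneSolution A w₀ b) ≤ absSum b / c := by
  have hb := hA.isConeSolution_coneSolution w₀ b
  set x := coneSolution A w₀ b
  have h1 := hb.2 0 (zero_mem_simplexCone w₀)
  have h2 : x ⬝ᵥ A *ᵥ x ≤ b ⬝ᵥ x := by
    rw [zero_sub, dotProduct_neg, sub_dotProduct, dotProduct_comm (A *ᵥ x)] at h1
    linarith
  have h3 : b ⬝ᵥ x ≤ absSum b * absSum x :=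
    (le_abs_self _).trans (abs_dotProduct_le (abs_le_absSum b))
  have h4 := hcA x
  rw [le_div_iff₀ hc]
  rcases (absSum_nonneg x).eq_or_lt with h0 | hpos
  · rw [← h0, zero_mul]
    exact absSum_nonneg b
  · refine le_of_mul_le_mul_right ?_ hpos
    nlinarith

/-- Continuity follows from the Lipschitz bound. It is all that the continuous mapping theorem
needs, so the boundary of the simplex requires no separate treatment. -/
lemma continuous_coneSolution {A : Matrix ι ι ℝ} (hA : A.PosDef) (w₀ : ι → ℝ) :
    Continuous (coneSolution A w₀) := by
  obtain ⟨c, hc, hcA⟩ := hA.exists_absSum_sq_le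
  refine continuous_pi fun i => ?_
  rw [continuous_iff_continuousAt]
  intro b
  rw [ContinuousAt, tendsto_iff_dist_tendsto_zero]
  have hlim : Tendsto (fun b' => 2 * absSum (b' - b) / c) (𝓝 b) (𝓝 0) := by
    have hcont : Continuous fun b' => 2 * absSum (b' - b) / c :=
      ((continuous_absSum.comp (continuous_id.sub continuous_const)).const_mul 2).div_const c
    simpa [absSum] using hcont.tendsto b
  refine squeeze_zero (fun _ => dist_nonneg) (fun b' => ?_) hlim
  rw [Real.dist_eq]
  exact (abs_le_absSum (coneSolution A w₀ b' - coneSolution A w₀ b) i).trans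
    (absSum_coneSolution_sub_le hA w₀ hc hcA b b')

/-- Sum of squared residuals of the rows `(y r, z r)`. -/
def residualSS {R : Type*} (s : Finset R) (y : R → ℝ) (z : R → ι → ℝ) (w : ι → ℝ) : ℝ :=
  ∑ r ∈ s, (y r - w ⬝ᵥ z r) ^ 2

/-- First-order condition for least squares over the simplex. -/
lemma sum_residual_mul_le_of_forall_residualSS_le {R : Type*} {s : Finset R} {y : R → ℝ}
    {z : R → ι → ℝ} {w : ι → ℝ} (hw : w ∈ stdSimplex ℝ ι)
    (hmin : ∀ w' ∈ stdSimplex ℝ ι, residualSS s y z w ≤ residualSS s y z w') {w' : ι → ℝ}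
    (hw' : w' ∈ stdSimplex ℝ ι) :
    ∑ r ∈ s, (y r - w ⬝ᵥ z r) * ((w' - w) ⬝ᵥ z r) ≤ 0 := by
  have key : 0 ≤ -2 * ∑ r ∈ s, (y r - w ⬝ᵥ z r) * ((w' - w) ⬝ᵥ z r) := by
    refine nonneg_of_forall_quadratic (a := ∑ r ∈ s, ((w' - w) ⬝ᵥ z r) ^ 2) fun t ht0 ht1 => ?_
    have hmem : w + t • (w' - w) ∈ stdSimplex ℝ ι := by
      have := convex_stdSimplex ℝ ι hw hw' (sub_nonneg.mpr ht1) ht0 (by ring)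
      convert this using 1
      module
    have h1 := hmin _ hmem
    have h2 : residualSS s y z (w + t • (w' - w)) = residualSS s y z w +
        ((∑ r ∈ s, ((w' - w) ⬝ᵥ z r) ^ 2) * t ^ 2 +
        -2 * (∑ r ∈ s, (y r - w ⬝ᵥ z r) * ((w' - w) ⬝ᵥ z r)) * t) := by
      simp only [residualSS]
      rw [Finset.sum_mul, Finset.mul_sum, Finset.sum_mul, ← Finset.sum_add_distrib,
        ← Finset.sum_add_distrib]
      refine Finset.sum_congr rfl fun r _ => ?_
      rw [add_dotProduct, smul_dotProduct, smul_eq_mul]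
      ring
    linarith
  linarith

/-- Gram matrix of the rows `z r`, divided by `n`. -/
noncomputable def gramMatrix {R : Type*} (s : Finset R) (z : R → ι → ℝ) (n : ℝ) : Matrix ι ι ℝ :=
  Matrix.of fun i j => n⁻¹ * ∑ r ∈ s, z r i * z r j

/-- Score of the rows `z r` for the errors `u r`, divided by `√n`. -/
noncomputable def scoreVector {R : Type*} (s : Finset R) (z : R → ι → ℝ) (u : R → ℝ) (n : ℝ) :
    ι → ℝ :=
  fun i => (√n)⁻¹ * ∑ r ∈ s, z r i * u r

lemma gramMatrix_mulVec_dotProduct {R : Type*} (s : Finset R) (z : R → ι → ℝ) (n : ℝ)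
    (x d : ι → ℝ) :
    (gramMatrix s z n *ᵥ x) ⬝ᵥ d = n⁻¹ * ∑ r ∈ s, (x ⬝ᵥ z r) * (d ⬝ᵥ z r) := by
  simp only [gramMatrix, dotProduct, mulVec, of_apply, Finset.mul_sum, Finset.sum_mul]
  rw [Finset.sum_comm]
  refine Eq.trans (Finset.sum_congr rfl fun i _ => Finset.sum_comm) ?_
  rw [Finset.sum_comm]
  refine Finset.sum_congr rfl fun r _ => ?_
  rw [Finset.sum_comm]
  exact Finset.sum_congr rfl fun i _ => Finset.sum_congr rfl fun j _ => by ring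

lemma scoreVector_dotProduct {R : Type*} (s : Finset R) (z : R → ι → ℝ) (u : R → ℝ) (n : ℝ)
    (d : ι → ℝ) : scoreVector s z u n ⬝ᵥ d = (√n)⁻¹ * ∑ r ∈ s, u r * (d ⬝ᵥ z r) := by
  simp only [scoreVector, dotProduct, Finset.mul_sum, Finset.sum_mul]
  rw [Finset.sum_comm]
  refine Finset.sum_congr rfl fun r _ => Finset.sum_congr rfl fun i _ => by ring

/-- The rescaled deviation of the constrained least squares weights from `w₀` is close to the
solution of the limiting quadratic programme on the tangent cone. -/
theorem absSum_smul_sub_coneSolution_le {A : Matrix ι ι ℝ} (hA : A.PosDef) {w₀ w : ι → ℝ}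
    {c δ ε r n : ℝ} (hc : 0 < c) (hcA : ∀ x : ι → ℝ, c * absSum x ^ 2 ≤ x ⬝ᵥ A *ᵥ x)
    (hw₀ : w₀ ∈ stdSimplex ℝ ι) (hr : ∀ i, w₀ i ≠ 0 → r ≤ w₀ i) (hn : 0 < n)
    {R : Type*} {s : Finset R} {y : R → ℝ} {z : R → ι → ℝ} (hw : w ∈ stdSimplex ℝ ι)
    (hmin : ∀ w' ∈ stdSimplex ℝ ι, residualSS s y z w ≤ residualSS s y z w') {b : ι → ℝ}
    (hδ : ∀ i j, |gramMatrix s z n i j - A i j| ≤ δ) (hδc : δ ≤ c / 2)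
    (hε : ∀ i, |scoreVector s z (fun r => y r - w₀ ⬝ᵥ z r) n i - b i| ≤ ε)
    (hε0 : 0 ≤ ε) (hδ0 : 0 ≤ δ) (hbr : absSum b / c ≤ √n * r) :
    absSum (√n • (w - w₀) - coneSolution A w₀ b) ≤ 2 * (δ * (absSum b / c) + ε) / c := by
  have hsn : 0 < √n := Real.sqrt_pos.mpr hn
  have hsol := hA.isConeSolution_coneSolution w₀ b
  have hle := absSum_coneSolution_le hA w₀ hc hcA b
  set x := coneSolution A w₀ b with hx
  -- Feasibility of the rescaled cone solution; here n has to be large compared with b.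
  have hw'mem := add_inv_smul_mem_stdSimplex hw₀ hsol.1 hr hsn (hle.trans hbr)
  set w' := w₀ + (√n)⁻¹ • x with hw'
  have hxw : x = √n • (w' - w₀) := by
    rw [hw', add_sub_cancel_left, smul_smul, mul_inv_cancel₀ hsn.ne', one_smul]
  have hfoc := sum_residual_mul_le_of_forall_residualSS_le hw hmin hw'mem
  -- The perturbation bound needs each variational inequality at a single test point. Optimality of
  -- w against the feasible w' gives the one for the sample programme; the cone solution satisfies
  -- the other at √n(w - w₀), which lies in the cone.
  have hvar : 0 ≤ (gramMatrix s z n *ᵥ (√n • (w - w₀)) -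
      scoreVector s z (fun r => y r - w₀ ⬝ᵥ z r) n) ⬝ᵥ (x - √n • (w - w₀)) := by
    have e1 : x - √n • (w - w₀) = √n • (w' - w) := by
      rw [hxw]; module
    rw [e1, sub_dotProduct, gramMatrix_mulVec_dotProduct, scoreVector_dotProduct]
    simp only [smul_dotProduct, smul_eq_mul]
    have e2 : n⁻¹ * ∑ r ∈ s, √n * ((w - w₀) ⬝ᵥ z r) * (√n * ((w' - w) ⬝ᵥ z r)) =
        ∑ r ∈ s, ((w - w₀) ⬝ᵥ z r) * ((w' - w) ⬝ᵥ z r) := by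
      rw [Finset.mul_sum]
      refine Finset.sum_congr rfl fun r _ => ?_
      have := Real.mul_self_sqrt hn.le
      calc n⁻¹ * (√n * ((w - w₀) ⬝ᵥ z r) * (√n * ((w' - w) ⬝ᵥ z r)))
          = n⁻¹ * (√n * √n) * (((w - w₀) ⬝ᵥ z r) * ((w' - w) ⬝ᵥ z r)) := by ring
        _ = _ := by rw [this, inv_mul_cancel₀ hn.ne', one_mul]
    have e3 : (√n)⁻¹ * ∑ r ∈ s, (y r - w₀ ⬝ᵥ z r) * (√n * ((w' - w) ⬝ᵥ z r)) =
        ∑ r ∈ s, (y r - w₀ ⬝ᵥ z r) * ((w' - w) ⬝ᵥ z r) := by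
      rw [Finset.mul_sum]
      refine Finset.sum_congr rfl fun r _ => ?_
      field_simp
    rw [e2, e3, ← Finset.sum_sub_distrib]
    rw [← neg_nonneg, ← Finset.sum_neg_distrib] at hfoc
    refine hfoc.trans_eq (Finset.sum_congr rfl fun r _ => ?_)
    rw [sub_dotProduct w w₀]
    ring
  have hmemC := smul_sub_mem_simplexCone hw₀ hw hsn.le
  refine (absSum_sub_le_of_variational hc hcA hδ hδc hε hε0 hδ0 (hsol.2 _ hmemC) hvar).trans ?_
  gcongr

end QuadraticProgram

/-! The limiting distribution function, and sums of asymptotically independent variables. -/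

section NormalCDF

/-- The standard normal distribution function. -/
noncomputable def stdNormalCDF (y : ℝ) : ℝ := (gaussianReal 0 1).real (Set.Iic y)

lemma stdNormalCDF_nonneg (y : ℝ) : 0 ≤ stdNormalCDF y := measureReal_nonneg

lemma stdNormalCDF_le_one (y : ℝ) : stdNormalCDF y ≤ 1 := measureReal_le_one

lemma gaussianPDFReal_zero_one_le (x : ℝ) : gaussianPDFReal 0 1 x ≤ 1 := by
  rw [gaussianPDFReal]
  have h1 : (1 : ℝ) ≤ √(2 * Real.pi * (1 : NNReal)) := by
    rw [Real.one_le_sqrt]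
    have := Real.pi_gt_three
    norm_num
    linarith
  have h2 : Real.exp (-(x - 0) ^ 2 / (2 * (1 : NNReal))) ≤ 1 := by
    rw [Real.exp_le_one_iff]
    have := sq_nonneg (x - 0)
    norm_num
    linarith
  calc _ ≤ (1 : ℝ)⁻¹ * 1 := by gcongr
    _ = 1 := by norm_num

lemma stdNormalCDF_sub_eq {a b : ℝ} (hab : a ≤ b) :
    stdNormalCDF b - stdNormalCDF a = (gaussianReal 0 1).real (Set.Ioc a b) := by
  rw [stdNormalCDF, stdNormalCDF, ← Set.Iic_union_Ioc_eq_Iic hab,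
    measureReal_union (Set.Iic_disjoint_Ioc le_rfl) measurableSet_Ioc]
  ring

lemma strictMono_stdNormalCDF : StrictMono stdNormalCDF := by
  intro a b hab
  rw [← sub_pos, stdNormalCDF_sub_eq hab.le, measureReal_def, ENNReal.toReal_pos_iff]
  refine ⟨pos_iff_ne_zero.mpr fun h0 => ?_, measure_lt_top _ _⟩
  have := gaussianReal_absolutelyContinuous' 0 one_ne_zero h0
  rw [Real.volume_Ioc, ENNReal.ofReal_eq_zero] at this
  linarith

/-- The normal density is at most 1; this crude Lipschitz constant suffices. -/
lemma abs_stdNormalCDF_sub_le (a b : ℝ) : |stdNormalCDF a - stdNormalCDF b| ≤ |a - b| := by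
  wlog hab : b ≤ a generalizing a b
  · rw [abs_sub_comm, abs_sub_comm a]
    exact this b a (not_le.mp hab).le
  rw [stdNormalCDF_sub_eq hab, abs_of_nonneg measureReal_nonneg, abs_of_nonneg (sub_nonneg.mpr hab),
    measureReal_def, gaussianReal_apply_eq_integral _ one_ne_zero,
    ENNReal.toReal_ofReal (integral_nonneg fun _ => gaussianPDFReal_nonneg _ _ _)]
  calc ∫ x in Set.Ioc b a, gaussianPDFReal 0 1 x ≤ ∫ _ in Set.Ioc b a, (1 : ℝ) :=
        integral_mono_of_nonneg (.of_forall fun _ => gaussianPDFReal_nonneg _ _ _)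
          (integrable_const _) (.of_forall gaussianPDFReal_zero_one_le)
    _ = a - b := by simp [hab]

lemma continuous_stdNormalCDF : Continuous stdNormalCDF := by
  rw [Metric.continuous_iff]
  exact fun b ε hε => ⟨ε, hε, fun a ha => (abs_stdNormalCDF_sub_le a b).trans_lt ha⟩

lemma gaussianReal_real_Iic {v : NNReal} (hv : v ≠ 0) (y : ℝ) :
    (gaussianReal 0 v).real (Set.Iic y) = stdNormalCDF (y / √v) := by
  have hs : 0 < √(v : ℝ) := Real.sqrt_pos.mpr (by positivity)
  have hmap : (gaussianReal 0 1).map (√(v : ℝ) * ·) = gaussianReal 0 v := by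
    rw [gaussianReal_map_const_mul]
    congr 1
    · simp
    · ext
      simp [Real.sq_sqrt]
  rw [← hmap, map_measureReal_apply (by fun_prop) measurableSet_Iic, stdNormalCDF]
  congr 1
  ext x
  simp only [Set.mem_preimage, Set.mem_Iic]
  rw [le_div_iff₀ hs, mul_comm]

variable (ν : Measure ℝ) [IsProbabilityMeasure ν] {v : NNReal}

/-- Conditioning on the first summand. The conditional law of the simulated statistic is a mixture
of the same form, with an average over blocks in place of ν. -/
lemma cdf_conv_gaussianReal (hv : v ≠ 0) (x : ℝ) :
    cdf (ν ∗ gaussianReal 0 v) x = ∫ u, stdNormalCDF ((x - u) / √v) ∂ν := by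
  rw [cdf_eq_real, ← integral_indicator_one measurableSet_Iic, integral_conv]
  · refine integral_congr_ae (.of_forall fun u => ?_)
    dsimp only
    rw [← gaussianReal_real_Iic hv, ← integral_indicator_one measurableSet_Iic]
    refine integral_congr_ae (.of_forall fun y => ?_)
    have : u + y ≤ x ↔ y ≤ x - u := by constructor <;> intro h <;> linarith
    simp [Set.indicator_apply, this]
  · exact (integrable_const (1 : ℝ)).indicator measurableSet_Iic

lemma integrable_stdNormalCDF_comp (x : ℝ) :
    Integrable (fun u => stdNormalCDF ((x - u) / √v)) ν :=
  Integrable.of_bound (continuous_stdNormalCDF.comp (by fun_prop)).aestronglyMeasurable 1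
    (.of_forall fun u => by
      rw [Real.norm_of_nonneg (stdNormalCDF_nonneg _)]
      exact stdNormalCDF_le_one _)

lemma strictMono_cdf_conv_gaussianReal (hv : v ≠ 0) :
    StrictMono (cdf (ν ∗ gaussianReal 0 v)) := by
  have hs : 0 < √(v : ℝ) := Real.sqrt_pos.mpr (by positivity)
  intro x y hxy
  rw [cdf_conv_gaussianReal ν hv, cdf_conv_gaussianReal ν hv]
  have hlt : ∀ u, stdNormalCDF ((x - u) / √v) < stdNormalCDF ((y - u) / √v) := fun u =>
    strictMono_stdNormalCDF (by gcongr)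
  rw [← sub_pos, ← integral_sub (integrable_stdNormalCDF_comp ν y)
    (integrable_stdNormalCDF_comp ν x), integral_pos_iff_support_of_nonneg
    (fun u => sub_nonneg.mpr (hlt u).le)
    ((integrable_stdNormalCDF_comp ν y).sub (integrable_stdNormalCDF_comp ν x))]
  have : Function.support (fun u => stdNormalCDF ((y - u) / √v) - stdNormalCDF ((x - u) / √v)) =
      Set.univ := Set.eq_univ_of_forall fun u => (sub_pos.mpr (hlt u)).ne'
  rw [this]
  simp

/-- The normal factor smooths any ν. This is needed because the law of the weight contribution may
have atoms; for φ = 0 it is a point mass. -/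
lemma continuous_cdf_conv_gaussianReal (hv : v ≠ 0) :
    Continuous (cdf (ν ∗ gaussianReal 0 v)) := by
  have : (cdf (ν ∗ gaussianReal 0 v) : ℝ → ℝ) =
      fun x => ∫ u, stdNormalCDF ((x - u) / √v) ∂ν := funext (cdf_conv_gaussianReal ν hv)
  rw [this]
  refine continuous_of_dominated (bound := fun _ => 1)
    (fun x => (integrable_stdNormalCDF_comp ν x).1) (fun x => .of_forall fun u => ?_)
    (integrable_const _) (.of_forall fun u => continuous_stdNormalCDF.comp (by fun_prop))
  rw [Real.norm_of_nonneg (stdNormalCDF_nonneg _)]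
  exact stdNormalCDF_le_one _

lemma exists_cdf_conv_gaussianReal_eq (hv : v ≠ 0) {p : ℝ} (h0 : 0 < p) (h1 : p < 1) :
    ∃ q, cdf (ν ∗ gaussianReal 0 v) q = p := by
  have hc := continuous_cdf_conv_gaussianReal ν hv
  obtain ⟨a, ha⟩ := ((tendsto_cdf_atBot (ν ∗ gaussianReal 0 v)).eventually_lt_const h0).exists
  obtain ⟨b, hb⟩ := ((tendsto_cdf_atTop (ν ∗ gaussianReal 0 v)).eventually_const_lt h1).exists
  exact mem_range_of_exists_le_of_exists_ge hc ⟨a, ha.le⟩ ⟨b, hb.le⟩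

lemma conv_gaussianReal_singleton (hv : v ≠ 0) (x : ℝ) : (ν ∗ gaussianReal 0 v) {x} = 0 := by
  rw [← measure_cdf (ν ∗ gaussianReal 0 v), StieltjesFunction.measure_singleton,
    ((continuous_cdf_conv_gaussianReal ν hv).continuousWithinAt).leftLim_eq]
  simp

end NormalCDF

/-! ### Convergence in distribution: sums, distribution functions, tightness -/

section AsymptoticIndependence

variable {Ω Ω₁ Ω₂ : Type*} [MeasurableSpace Ω] [MeasurableSpace Ω₁] [MeasurableSpace Ω₂]
  {μ : Measure Ω} [IsProbabilityMeasure μ] {μ₁ : Measure Ω₁} [IsProbabilityMeasure μ₁]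
  {μ₂ : Measure Ω₂} [IsProbabilityMeasure μ₂]

/-- Asymptotic independence is available for real test functions, so the real and imaginary parts
are kept apart. -/
lemma charFun_map_eq_integral_cos_add {U : Ω → ℝ} (hU : AEMeasurable U μ) (t : ℝ) :
    charFun (μ.map U) t =
      ((∫ ω, Real.cos (t * U ω) ∂μ : ℝ) : ℂ) + (∫ ω, Real.sin (t * U ω) ∂μ : ℝ) * Complex.I := by
  have hc : Integrable (fun ω => Real.cos (t * U ω)) μ :=
    Integrable.of_bound (Real.continuous_cos.measurable.comp_aemeasurable
      (hU.const_mul t)).aestronglyMeasurable 1 (.of_forall fun ω => Real.abs_cos_le_one _)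
  have hs : Integrable (fun ω => Real.sin (t * U ω)) μ :=
    Integrable.of_bound (Real.continuous_sin.measurable.comp_aemeasurable
      (hU.const_mul t)).aestronglyMeasurable 1 (.of_forall fun ω => Real.abs_sin_le_one _)
  have e1 : ((∫ ω, Real.cos (t * U ω) ∂μ : ℝ) : ℂ) = ∫ ω, (Real.cos (t * U ω) : ℂ) ∂μ :=
    integral_ofReal.symm
  have e2 : ((∫ ω, Real.sin (t * U ω) ∂μ : ℝ) : ℂ) = ∫ ω, (Real.sin (t * U ω) : ℂ) ∂μ :=
    integral_ofReal.symm
  rw [charFun_apply_real, integral_map hU (by fun_prop), e1, e2,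
    ← integral_mul_const, ← integral_add hc.ofReal (hs.ofReal.mul_const _)]
  refine integral_congr_ae (.of_forall fun ω => ?_)
  dsimp only
  rw [Complex.exp_mul_I]
  push_cast
  rfl

/-- The sum of two asymptotically independent sequences converges to the convolution of their
limit laws. -/
theorem tendstoInDistribution_add_of_asymptotically_indep {U V : ℕ → Ω → ℝ} {Z₁ : Ω₁ → ℝ}
    {Z₂ : Ω₂ → ℝ} (hU : TendstoInDistribution U atTop Z₁ (fun _ => μ) μ₁)
    (hV : TendstoInDistribution V atTop Z₂ (fun _ => μ) μ₂)
    (hind : ∀ (f h : ℝ → ℝ) (K : NNReal), Continuous f → LipschitzWith K h → (∀ x, |f x| ≤ 1) →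
      (∀ x, |h x| ≤ 1) →
      Tendsto (fun n => ∫ ω, f (U n ω) * h (V n ω) ∂μ -
        (∫ ω, f (U n ω) ∂μ) * ∫ ω, h (V n ω) ∂μ) atTop (𝓝 0))
    [IsProbabilityMeasure ((μ₁.map Z₁) ∗ (μ₂.map Z₂))] :
    TendstoInDistribution (fun n ω => U n ω + V n ω) atTop id (fun _ => μ)
      ((μ₁.map Z₁) ∗ (μ₂.map Z₂)) := by
  have hUm := hU.forall_aemeasurable
  have hVm := hV.forall_aemeasurable
  refine ⟨fun n => (hUm n).add (hVm n), aemeasurable_id, ?_⟩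
  have hp1 := Measure.isProbabilityMeasure_map hU.aemeasurable_limit
  have hp2 := Measure.isProbabilityMeasure_map hV.aemeasurable_limit
  refine ProbabilityMeasure.tendsto_iff_tendsto_charFun.mpr fun t => ?_
  have hcU := ProbabilityMeasure.tendsto_iff_tendsto_charFun.mp hU.tendsto t
  have hcV := ProbabilityMeasure.tendsto_iff_tendsto_charFun.mp hV.tendsto t
  simp only [ProbabilityMeasure.coe_mk] at hcU hcV ⊢
  rw [Measure.map_id, charFun_conv]
  have hLc : LipschitzWith (‖t‖₊) fun x => Real.cos (t * x) := by
    refine LipschitzWith.of_dist_le_mul fun x y => ?_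
    rw [Real.dist_eq, Real.dist_eq, coe_nnnorm, Real.norm_eq_abs, ← abs_mul, mul_sub]
    exact Real.abs_cos_sub_cos_le _ _
  have hLs : LipschitzWith (‖t‖₊) fun x => Real.sin (t * x) := by
    refine LipschitzWith.of_dist_le_mul fun x y => ?_
    rw [Real.dist_eq, Real.dist_eq, coe_nnnorm, Real.norm_eq_abs, ← abs_mul, mul_sub]
    exact Real.abs_sin_sub_sin_le _ _
  have bc : ∀ x, |Real.cos (t * x)| ≤ 1 := fun x => Real.abs_cos_le_one _
  have bs : ∀ x, |Real.sin (t * x)| ≤ 1 := fun x => Real.abs_sin_le_one _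
  -- The four products of a cosine or sine of tU with one of tV; the addition formulas combine them
  -- into the characteristic function of the sum.
  have hcc := hind _ _ _ hLc.continuous hLc bc bc
  have hss := hind _ _ _ hLs.continuous hLs bs bs
  have hcs := hind _ _ _ hLc.continuous hLs bc bs
  have hsc := hind _ _ _ hLs.continuous hLc bs bc
  have hlim := ((hcc.sub hss).ofReal.add ((hcs.add hsc).ofReal.mul_const Complex.I)).add
    (hcU.mul hcV)
  simp only [sub_zero, add_zero, Complex.ofReal_zero, zero_mul, zero_add] at hlim
  refine hlim.congr fun n => ?_
  have hint : ∀ f h : ℝ → ℝ, Continuous f → Continuous h → (∀ x, |f x| ≤ 1) → (∀ x, |h x| ≤ 1) →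
      Integrable (fun ω => f (U n ω) * h (V n ω)) μ := by
    intro f h hf hh bf bh
    refine Integrable.of_bound ((hf.measurable.comp_aemeasurable (hUm n)).mul
      (hh.measurable.comp_aemeasurable (hVm n))).aestronglyMeasurable 1 (.of_forall fun ω => ?_)
    rw [norm_mul]
    exact mul_le_one₀ (bf _) (norm_nonneg _) (bh _)
  have e1 : ∫ ω, Real.cos (t * (U n ω + V n ω)) ∂μ =
      ∫ ω, Real.cos (t * U n ω) * Real.cos (t * V n ω) ∂μ -
      ∫ ω, Real.sin (t * U n ω) * Real.sin (t * V n ω) ∂μ := by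
    rw [← integral_sub (hint _ _ hLc.continuous hLc.continuous bc bc)
      (hint _ _ hLs.continuous hLs.continuous bs bs)]
    simp_rw [mul_add, Real.cos_add]
  have e2 : ∫ ω, Real.sin (t * (U n ω + V n ω)) ∂μ =
      ∫ ω, Real.sin (t * U n ω) * Real.cos (t * V n ω) ∂μ +
      ∫ ω, Real.cos (t * U n ω) * Real.sin (t * V n ω) ∂μ := by
    rw [← integral_add (hint _ _ hLs.continuous hLc.continuous bs bc)
      (hint _ _ hLc.continuous hLs.continuous bc bs)]
    simp_rw [mul_add, Real.sin_add]
  rw [charFun_map_eq_integral_cos_add (U := fun ω => U n ω + V n ω) ((hUm n).add (hVm n)) t,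
    charFun_map_eq_integral_cos_add (hUm n) t, charFun_map_eq_integral_cos_add (hVm n) t]
  rw [e1, e2]
  push_cast
  ring_nf
  rw [Complex.I_sq]
  ring

/-- Convergence of distribution functions, up to an error that vanishes in probability. -/
lemma tendsto_measureReal_le_of_tendstoInDistribution {X Y : ℕ → Ω → ℝ} {L : Measure ℝ}
    [IsProbabilityMeasure L] (hY : TendstoInDistribution Y atTop id (fun _ => μ) L)
    (hXm : ∀ n, AEMeasurable (X n) μ) (hXY : VanishesInProb μ fun n ω => X n ω - Y n ω) {x : ℝ}
    (hx : L {x} = 0) : Tendsto (fun n => μ.real {ω | X n ω ≤ x}) atTop (𝓝 (cdf L x)) := by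
  have hX := tendstoInDistribution_of_tendstoInMeasure_sub X id hY
    (vanishesInProb_iff_tendstoInMeasure.mp hXY) hXm
  have h := ProbabilityMeasure.tendsto_measure_of_null_frontier_of_tendsto' hX.tendsto
    (E := Set.Iic x) (by simpa [frontier_Iic] using hx)
  simp only [Measure.map_id, ProbabilityMeasure.coe_mk] at h
  have h2 := (ENNReal.continuousAt_toReal (measure_ne_top L _)).tendsto.comp h
  rw [cdf_eq_real, measureReal_def]
  refine h2.congr fun n => ?_
  simp only [Function.comp_apply]
  rw [Measure.map_apply_of_aemeasurable (hXm n) measurableSet_Iic]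
  rfl

/-- A sequence converging in distribution is bounded in probability. -/
lemma MeasureTheory.TendstoInDistribution.boundedInProb {X : ℕ → Ω → ℝ} {Z : Ω₁ → ℝ}
    (hX : TendstoInDistribution X atTop Z (fun _ => μ) μ₁) : BoundedInProb μ X := by
  intro ε hε
  have hp1 := Measure.isProbabilityMeasure_map hX.aemeasurable_limit
  have hclosed : ∀ M : ℝ, IsClosed {x : ℝ | M ≤ |x|} := fun M =>
    isClosed_le continuous_const continuous_abs
  -- The closed sets {k ≤ |x|} decrease to the empty set, so one of them has small limiting mass.
  -- The portmanteau inequality for closed sets transfers this to the sequence.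
  have hzero : Tendsto (fun k : ℕ => (μ₁.map Z) {x : ℝ | (k : ℝ) ≤ |x|}) atTop (𝓝 0) := by
    have h := tendsto_measure_iInter_atTop (μ := μ₁.map Z)
      (s := fun k : ℕ => {x : ℝ | (k : ℝ) ≤ |x|})
      (fun k => (hclosed k).measurableSet.nullMeasurableSet)
      (fun k l hkl x (hx : (l : ℝ) ≤ |x|) => le_trans (by exact_mod_cast hkl) hx)
      ⟨0, measure_ne_top _ _⟩
    have hem : ⋂ k : ℕ, {x : ℝ | (k : ℝ) ≤ |x|} = ∅ := by
      ext x
      simp only [Set.mem_iInter, Set.mem_ofPred_eq, Set.mem_empty_iff_false, iff_false, not_forall,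
        not_le]
      exact exists_nat_gt |x|
    rwa [hem, measure_empty] at h
  obtain ⟨k, hk0, hk⟩ := ((eventually_gt_atTop 0).and
    (hzero.eventually_lt_const (ENNReal.ofReal_pos.mpr hε))).exists
  refine ⟨k, by exact_mod_cast hk0, ?_⟩
  have hlim := ProbabilityMeasure.limsup_measure_closed_le_of_tendsto hX.tendsto (hclosed k)
  filter_upwards [eventually_lt_of_limsup_lt (hlim.trans_lt hk)] with n hn
  simp only [ProbabilityMeasure.coe_mk] at hn
  rw [Measure.map_apply_of_aemeasurable (hX.forall_aemeasurable n) (hclosed k).measurableSet] at hn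
  exact ENNReal.toReal_le_of_le_ofReal hε.le hn.le

end AsymptoticIndependence

/-! Order statistics of simulated values. -/

section OrderStatistics

/-- Empirical distribution function of `N` numbers. -/
noncomputable def empiricalCDF {N : ℕ} (x : Fin N → ℝ) (y : ℝ) : ℝ :=
  (N : ℝ)⁻¹ * ∑ n, (Set.Iic y).indicator (fun _ => 1) (x n)

/-- Sorting permutes the indices, so the count may be taken on the sorted values, where those not
exceeding y form an initial segment. -/
lemma orderStat_le_iff {N k : ℕ} (x : Fin N → ℝ) (hk : 1 ≤ k) (hkN : k ≤ N) (y : ℝ) :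
    orderStat x k ≤ y ↔ k ≤ (Finset.univ.filter fun n => x n ≤ y).card := by
  have hmono := Tuple.monotone_sort x
  have hcard : (Finset.univ.filter fun n => x n ≤ y).card =
      (Finset.univ.filter fun n => x (Tuple.sort x n) ≤ y).card :=
    (Finset.card_bij (fun n _ => Tuple.sort x n) (by simp)
      (fun _ _ _ _ h => (Tuple.sort x).injective h)
      (fun n hn => ⟨(Tuple.sort x).symm n, by simpa using hn, by simp⟩)).symm
  rw [hcard, orderStat, dif_pos ⟨hk, hkN⟩]
  constructor
  · intro h
    have hsub : Finset.univ.filter (fun n : Fin N => n.val < k) ⊆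
        Finset.univ.filter fun n => x (Tuple.sort x n) ≤ y := by
      intro n hn
      simp only [Finset.mem_filter, Finset.mem_univ, true_and] at hn ⊢
      exact (hmono (show n ≤ ⟨k - 1, by omega⟩ from Fin.mk_le_mk.mpr (by omega))).trans h
    have := Finset.card_le_card hsub
    rwa [Fin.card_filter_val_lt, min_eq_right hkN] at this
  · intro h
    by_contra! hlt
    have hsub : (Finset.univ.filter fun n => x (Tuple.sort x n) ≤ y) ⊆
        Finset.univ.filter (fun n : Fin N => n.val < k - 1) := by
      intro n hn
      simp only [Finset.mem_filter, Finset.mem_univ, true_and] at hn ⊢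
      by_contra! hge
      have := hmono (show (⟨k - 1, by omega⟩ : Fin N) ≤ n from Fin.mk_le_mk.mpr hge)
      exact absurd (this.trans hn) (not_le.mpr hlt)
    have := Finset.card_le_card hsub
    rw [Fin.card_filter_val_lt, min_eq_right (by omega)] at this
    omega

/-- The order statistic of rank `⌈p * N⌉` is the `p`-quantile of the empirical distribution. -/
lemma orderStat_ceil_le_iff {N : ℕ} (x : Fin N → ℝ) {p : ℝ} (hp : 0 < p) (hp1 : p ≤ 1)
    (hN : 0 < N) (y : ℝ) : orderStat x ⌈p * N⌉₊ ≤ y ↔ p ≤ empiricalCDF x y := by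
  have hN' : (0 : ℝ) < N := by exact_mod_cast hN
  have h1 : 1 ≤ ⌈p * N⌉₊ := Nat.one_le_iff_ne_zero.mpr (Nat.ceil_pos.mpr (by positivity)).ne'
  have h2 : ⌈p * N⌉₊ ≤ N := Nat.ceil_le.mpr (mul_le_of_le_one_left hN'.le hp1)
  have hsum : ∑ n, (Set.Iic y).indicator (fun _ => (1 : ℝ)) (x n) =
      (Finset.univ.filter fun n => x n ≤ y).card := by
    rw [Finset.card_filter]
    push_cast
    exact Finset.sum_congr rfl fun n _ => by simp [Set.indicator_apply]
  rw [orderStat_le_iff x h1 h2, Nat.ceil_le, empiricalCDF, hsum, ← div_eq_inv_mul,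
    le_div_iff₀ hN']

end OrderStatistics

/-! ### The simulation draws and their empirical distribution -/

section Simulation

/-- Chebyshev's inequality for i.i.d. variables in the unit interval, with N as a crude bound for
the variance of the sum. -/
lemma measureReal_le_abs_average_sub_le {α : Type*} [MeasurableSpace α] (P : Measure α)
    [IsProbabilityMeasure P] {N : ℕ} (hN : 0 < N) {f : α → ℝ} (hf : Measurable f)
    (h0 : ∀ x, 0 ≤ f x) (h1 : ∀ x, f x ≤ 1) {δ : ℝ} (hδ : 0 < δ) :
    (Measure.pi fun _ : Fin N => P).real
      {z | δ ≤ |(N : ℝ)⁻¹ * ∑ n, f (z n) - ∫ x, f x ∂P|} ≤ 1 / (N * δ ^ 2) := by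
  have hN' : (0 : ℝ) < N := by exact_mod_cast hN
  set π := Measure.pi fun _ : Fin N => P
  have hfm : ∀ n : Fin N, Measurable fun z : Fin N → α => f (z n) := fun n =>
    hf.comp (measurable_pi_apply n)
  have hL : ∀ n : Fin N, MemLp (fun z : Fin N → α => f (z n)) 2 π := fun n =>
    MemLp.of_bound (hfm n).aestronglyMeasurable 1 (.of_forall fun z => by
      rw [Real.norm_of_nonneg (h0 _)]; exact h1 _)
  have hint : ∀ n : Fin N, ∫ z, f (z n) ∂π = ∫ x, f x ∂P := fun n =>
    integral_comp_eval (μ := fun _ : Fin N => P) hf.aestronglyMeasurable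
  have hind : iIndepFun (fun n (z : Fin N → α) => f (z n)) π :=
    iIndepFun_pi (X := fun _ => f) fun _ => hf.aemeasurable
  set W : (Fin N → α) → ℝ := fun z => ∑ n, f (z n) with hW
  have hWL : MemLp W 2 π := memLp_finsetSum _ fun n _ => hL n
  have hWmean : ∫ z, W z ∂π = N * ∫ x, f x ∂P := by
    simp only [hW]
    rw [integral_finsetSum _ fun n _ => (hL n).integrable one_le_two]
    simp [hint]
  have hWvar : variance W π ≤ N := by
    have : W = ∑ n, fun z : Fin N → α => f (z n) := by
      ext z; simp [hW]
    rw [this, IndepFun.variance_sum (fun n _ => hL n) fun i _ j _ hij => hind.indepFun hij]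
    refine (Finset.sum_le_sum fun n _ => variance_le_sq_of_bounded (a := 0) (b := 1)
      (.of_forall fun z => ⟨h0 _, h1 _⟩) (hfm n).aemeasurable).trans ?_
    simp only [Finset.sum_const, Finset.card_univ, Fintype.card_fin, nsmul_eq_mul]
    nlinarith
  have hset : {z : Fin N → α | δ ≤ |(N : ℝ)⁻¹ * ∑ n, f (z n) - ∫ x, f x ∂P|} ⊆
      {z | N * δ ≤ |W z - ∫ z, W z ∂π|} := by
    intro z hz
    simp only [Set.mem_ofPred_eq] at hz ⊢
    rw [hWmean]
    have : (N : ℝ)⁻¹ * ∑ n, f (z n) - ∫ x, f x ∂P = (N : ℝ)⁻¹ * (W z - N * ∫ x, f x ∂P) := by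
      simp only [hW]; field_simp
    rw [this, abs_mul, abs_of_pos (inv_pos.mpr hN'), ← div_eq_inv_mul, le_div_iff₀ hN'] at hz
    linarith
  have hch := meas_ge_le_variance_div_sq hWL (c := N * δ) (by positivity)
  calc π.real _ ≤ π.real {z | N * δ ≤ |W z - ∫ z, W z ∂π|} := measureReal_mono hset
    _ ≤ variance W π / (N * δ) ^ 2 :=
      ENNReal.toReal_le_of_le_ofReal (div_nonneg (variance_nonneg _ _) (by positivity)) hch
    _ ≤ N / (N * δ) ^ 2 := by gcongr
    _ = 1 / (N * δ ^ 2) := by field_simp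

/-- Law of one simulation draw. -/
noncomputable def drawLaw (K T : ℕ) : Measure (Fin (K + 1) × (Fin T → ℝ)) :=
  (uniformOn Set.univ).prod (Measure.pi fun _ => gaussianReal 0 1)

instance isProbabilityMeasure_uniformOn_fin (K : ℕ) :
    IsProbabilityMeasure (uniformOn (Set.univ : Set (Fin (K + 1)))) :=
  isProbabilityMeasure_uniformOn Set.finite_univ Set.univ_nonempty

instance isProbabilityMeasure_drawLaw (K T : ℕ) : IsProbabilityMeasure (drawLaw K T) := by
  unfold drawLaw
  infer_instance

instance isProbabilityMeasure_simLaw (N K T : ℕ) : IsProbabilityMeasure (simLaw N K T) := by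
  unfold simLaw
  infer_instance

/-- Once the pair of arrays is read as an array of pairs, the replications are i.i.d. with law
`drawLaw`. The bound does not involve E, hence is uniform over the data on which E depends. -/
lemma simLaw_real_le_abs_empiricalCDF_sub_le {N K T : ℕ} (hN : 0 < N)
    {E : Fin (K + 1) → (Fin T → ℝ) → ℝ} (hE : ∀ b, Measurable (E b)) (y : ℝ) {δ : ℝ}
    (hδ : 0 < δ) :
    (simLaw N K T).real {z | δ ≤ |empiricalCDF (fun n => E (z.1 n) (z.2 n)) y -
      (drawLaw K T).real {d | E d.1 d.2 ≤ y}|} ≤ 1 / (N * δ ^ 2) := by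
  have hE' : Measurable fun d : Fin (K + 1) × (Fin T → ℝ) => E d.1 d.2 :=
    measurable_from_prod_countable_right hE
  set A : Set (Fin (K + 1) × (Fin T → ℝ)) := {d | E d.1 d.2 ≤ y} with hA
  have hAm : MeasurableSet A := hE' measurableSet_Iic
  have hmp := measurePreserving_arrowProdEquivProdArrow (Fin (K + 1)) (Fin T → ℝ) (Fin N)
    (fun _ => uniformOn Set.univ) (fun _ => Measure.pi fun _ => gaussianReal 0 1)
  have hf : Measurable (A.indicator (1 : Fin (K + 1) × (Fin T → ℝ) → ℝ)) :=
    measurable_one.indicator hAm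
  have key := measureReal_le_abs_average_sub_le (drawLaw K T) hN hf
    (fun x => Set.indicator_nonneg (fun _ _ => zero_le_one) x)
    (fun x => Set.indicator_le_self' (fun _ _ => zero_le_one) x) hδ
  rw [integral_indicator_one hAm] at key
  refine le_trans (le_of_eq ?_) key
  unfold simLaw
  rw [← hmp.map_eq, map_measureReal_apply hmp.measurable]
  · rfl
  · refine measurableSet_le measurable_const (Measurable.abs (Measurable.sub_const ?_ _))
    unfold empiricalCDF
    refine Measurable.const_mul (Finset.measurable_sum _ fun n _ => ?_) _
    refine (measurable_const.indicator measurableSet_Iic).comp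
      (hE'.comp (f := fun z : (Fin N → Fin (K + 1)) × (Fin N → Fin T → ℝ) => (z.1 n, z.2 n)) ?_)
    fun_prop

lemma drawLaw_real_apply {K T : ℕ} {A : Set (Fin (K + 1) × (Fin T → ℝ))} (hA : MeasurableSet A) :
    (drawLaw K T).real A = ((K + 1 : ℕ) : ℝ)⁻¹ *
      ∑ b : Fin (K + 1),
        (Measure.pi fun _ => gaussianReal 0 1).real {ξ : Fin T → ℝ | (b, ξ) ∈ A} := by
  have hsing : ∀ b : Fin (K + 1), uniformOn Set.univ {b} = ((K + 1 : ℕ) : ENNReal)⁻¹ := by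
    intro b
    rw [uniformOn_univ, Measure.count_singleton, Fintype.card_fin, one_div]
  rw [measureReal_def, drawLaw, Measure.prod_apply hA, lintegral_fintype, Finset.mul_sum,
    ENNReal.toReal_sum fun b _ => ENNReal.mul_ne_top (measure_ne_top _ _) (measure_ne_top _ _)]
  refine Finset.sum_congr rfl fun b _ => ?_
  rw [hsing, ENNReal.toReal_mul, ENNReal.toReal_inv, ENNReal.toReal_natCast, mul_comm]
  rfl

/-- A linear combination of independent normal variables is normal, so only its mean and variance
have to be computed. -/
lemma pi_gaussianReal_map_normalized_sum {T : ℕ} (hT : 0 < T) :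
    (Measure.pi fun _ : Fin T => gaussianReal 0 1).map (fun ξ => (√(T : ℝ))⁻¹ * ∑ t, ξ t) =
      gaussianReal 0 1 := by
  set π := Measure.pi fun _ : Fin T => gaussianReal 0 1
  have hlaw : ∀ t : Fin T, π.map (fun ξ => ξ t) = gaussianReal 0 1 := fun t =>
    (measurePreserving_eval (fun _ : Fin T => gaussianReal 0 1) t).map_eq
  have hG : ∀ t : Fin T, HasGaussianLaw (fun ξ : Fin T → ℝ => ξ t) π := fun t =>
    ⟨by rw [hlaw t]; infer_instance⟩
  have hind : iIndepFun (fun t (ξ : Fin T → ℝ) => ξ t) π :=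
    iIndepFun_pi (X := fun _ x => x) fun _ => aemeasurable_id
  have hL : ∀ t : Fin T, MemLp (fun ξ : Fin T → ℝ => ξ t) 2 π := fun t => (hG t).memLp_two
  have hmean : ∀ t : Fin T, ∫ ξ, ξ t ∂π = 0 := by
    intro t
    have h := integral_map (μ := π) (φ := fun ξ : Fin T → ℝ => ξ t)
      (measurable_pi_apply t).aemeasurable (f := fun x : ℝ => x) (by fun_prop)
    rw [hlaw t] at h
    exact h.symm.trans (by simp)
  have hvar : ∀ t : Fin T, Var[fun ξ : Fin T → ℝ => ξ t; π] = 1 := by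
    intro t
    have := variance_map (X := fun x : ℝ => x) (μ := π) (Y := fun ξ : Fin T → ℝ => ξ t)
      (by fun_prop) (measurable_pi_apply t).aemeasurable
    rw [hlaw t] at this
    rw [← Function.id_comp (fun ξ : Fin T → ℝ => ξ t)]
    exact this.symm.trans (by simp)
  have hsum : HasGaussianLaw (fun ξ : Fin T → ℝ => (√(T : ℝ))⁻¹ * ∑ t, ξ t) π := by
    have h := hind.hasGaussianLaw_fun_sum hG
    exact h.fun_smul (√(T : ℝ))⁻¹
  have hS : (fun ξ : Fin T → ℝ => ∑ t, ξ t) = ∑ t, fun ξ : Fin T → ℝ => ξ t := by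
    ext ξ; simp
  rw [hsum.map_eq_gaussianReal]
  congr 1
  · rw [integral_const_mul, integral_finsetSum _ fun t _ => (hL t).integrable one_le_two]
    simp [hmean]
  · rw [variance_const_mul, hS,
      IndepFun.variance_sum (fun t _ => hL t) fun i _ j _ hij => hind.indepFun hij]
    have : (0 : ℝ) < T := by exact_mod_cast hT
    simp [hvar, this.ne']

/-- Given the data and the block, the statistic is exactly normal with location c and standard
deviation s. -/
lemma pi_gaussianReal_real_affine_le {T : ℕ} (hT : 0 < T) (c y : ℝ) {s : ℝ} (hs : 0 < s) :
    (Measure.pi fun _ : Fin T => gaussianReal 0 1).real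
      {ξ | c + (√(T : ℝ))⁻¹ * ∑ t, s * ξ t ≤ y} = stdNormalCDF ((y - c) / s) := by
  have h := congrArg (fun ν : Measure ℝ => ν.real (Set.Iic ((y - c) / s)))
    (pi_gaussianReal_map_normalized_sum hT)
  rw [map_measureReal_apply (by fun_prop) measurableSet_Iic] at h
  rw [stdNormalCDF, ← h]
  refine congrArg _ (Set.ext fun ξ => ?_)
  change c + (√(T : ℝ))⁻¹ * ∑ t : Fin T, s * ξ t ≤ y ↔
    (√(T : ℝ))⁻¹ * ∑ t : Fin T, ξ t ≤ (y - c) / s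
  rw [le_div_iff₀ hs, ← Finset.mul_sum]
  constructor <;> intro h <;> linarith

end Simulation

/-! ### Coverage of intervals between simulated quantiles -/

section QuantileInterval

variable {Ω : Type*} [MeasurableSpace Ω] {μ : Measure Ω} [IsProbabilityMeasure μ]

/-- If the conditional distribution function of the simulated values converges in probability to
the limit distribution function of `X n`, then the empirical distribution function of the
simulated values converges as well. -/
lemma tendsto_prod_simLaw_abs_empiricalCDF_sub {N K T : ℕ → ℕ} (hN : Tendsto N atTop atTop)
    {E : (n : ℕ) → Ω → Fin (K n + 1) → (Fin (T n) → ℝ) → ℝ}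
    (hE : ∀ n b, Measurable fun p : Ω × (Fin (T n) → ℝ) => E n p.1 b p.2) {y a : ℝ}
    (hcond : VanishesInProb μ fun n ω =>
      (drawLaw (K n) (T n)).real {d | E n ω d.1 d.2 ≤ y} - a) {δ : ℝ} (hδ : 0 < δ) :
    Tendsto (fun n => (μ.prod (simLaw (N n) (K n) (T n))).real
      {p | δ ≤ |empiricalCDF (fun i => E n p.1 (p.2.1 i) (p.2.2 i)) y - a|}) atTop (𝓝 0) := by
  set G : (n : ℕ) → Ω → ℝ := fun n ω => (drawLaw (K n) (T n)).real {d | E n ω d.1 d.2 ≤ y} with hG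
  have hEd : ∀ n, Measurable fun p : Ω × (Fin (K n + 1) × (Fin (T n) → ℝ)) =>
      E n p.1 p.2.1 p.2.2 := by
    intro n
    have h1 : Measurable fun q : Fin (K n + 1) × (Ω × (Fin (T n) → ℝ)) => E n q.2.1 q.1 q.2.2 :=
      measurable_from_prod_countable_right (hE n)
    exact h1.comp (g := fun q : Fin (K n + 1) × (Ω × (Fin (T n) → ℝ)) => E n q.2.1 q.1 q.2.2)
      (f := fun p : Ω × (Fin (K n + 1) × (Fin (T n) → ℝ)) => (p.2.1, (p.1, p.2.2))) (by fun_prop)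
  have hGm : ∀ n, Measurable (G n) := by
    intro n
    have : MeasurableSet {p : Ω × (Fin (K n + 1) × (Fin (T n) → ℝ)) | E n p.1 p.2.1 p.2.2 ≤ y} :=
      hEd n measurableSet_Iic
    exact (measurable_measure_prodMk_left (ν := drawLaw (K n) (T n)) this).ennreal_toReal
  have hEm : ∀ n, Measurable fun p : Ω × ((Fin (N n) → Fin (K n + 1)) ×
      (Fin (N n) → Fin (T n) → ℝ)) =>
      empiricalCDF (fun i => E n p.1 (p.2.1 i) (p.2.2 i)) y := by
    intro n
    unfold empiricalCDF
    refine Measurable.const_mul (Finset.measurable_sum _ fun i _ => ?_) _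
    refine (measurable_const.indicator measurableSet_Iic).comp
      ((hEd n).comp (f := fun p : Ω × ((Fin (N n) → Fin (K n + 1)) ×
      (Fin (N n) → Fin (T n) → ℝ)) => (p.1, (p.2.1 i, p.2.2 i))) ?_)
    fun_prop
  have hbound : Tendsto (fun n => 1 / ((N n : ℝ) * (δ / 2) ^ 2) +
      μ.real {ω | δ / 2 ≤ |G n ω - a|}) atTop (𝓝 0) := by
    have h1 : Tendsto (fun n => 1 / ((N n : ℝ) * (δ / 2) ^ 2)) atTop (𝓝 0) := by
      refine tendsto_const_nhds.div_atTop ?_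
      exact (tendsto_natCast_atTop_atTop.comp hN).atTop_mul_const (by positivity)
    simpa using h1.add (hcond.tendsto (ε := δ / 2) (by positivity))
  refine squeeze_zero' (.of_forall fun _ => measureReal_nonneg) ?_ hbound
  filter_upwards [hN.eventually_gt_atTop 0] with n hn
  set P := μ.prod (simLaw (N n) (K n) (T n)) with hP
  set F : Ω × ((Fin (N n) → Fin (K n + 1)) × (Fin (N n) → Fin (T n) → ℝ)) → ℝ := fun p =>
    empiricalCDF (fun i => E n p.1 (p.2.1 i) (p.2.2 i)) y with hF
  -- The deviation splits into the simulation error given the data, controlled by Chebyshev for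
  -- every ω, and the error of the conditional distribution function.
  have hsub : {p | δ ≤ |F p - a|} ⊆
      {p | δ / 2 ≤ |F p - G n p.1|} ∪ (Prod.fst ⁻¹' {ω | δ / 2 ≤ |G n ω - a|}) := by
    intro p hp
    simp only [Set.mem_union, Set.mem_ofPred_eq, Set.mem_preimage] at hp ⊢
    by_contra! hcon
    linarith [abs_sub_le (F p) (G n p.1) a]
  refine (measureReal_mono hsub).trans ((measureReal_union_le _ _).trans (add_le_add ?_ ?_))
  · have hm : MeasurableSet {p | δ / 2 ≤ |F p - G n p.1|} :=
      measurableSet_le measurable_const (((hEm n).sub ((hGm n).comp measurable_fst)).abs)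
    rw [measureReal_def, hP, Measure.prod_apply hm]
    refine ENNReal.toReal_le_of_le_ofReal (by positivity) ?_
    calc ∫⁻ ω, simLaw (N n) (K n) (T n) (Prod.mk ω ⁻¹' {p | δ / 2 ≤ |F p - G n p.1|}) ∂μ
        ≤ ∫⁻ _, ENNReal.ofReal (1 / ((N n : ℝ) * (δ / 2) ^ 2)) ∂μ := by
          refine lintegral_mono fun ω => ?_
          have := simLaw_real_le_abs_empiricalCDF_sub_le (N := N n) (K := K n) (T := T n) hn
            (E := E n ω) (fun b => (hE n b).comp measurable_prodMk_left) y
            (δ := δ / 2) (by positivity)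
          rw [measureReal_def] at this
          exact (ENNReal.le_ofReal_iff_toReal_le (measure_ne_top _ _) (by positivity)).mpr this
      _ = _ := by simp
  · have hm : MeasurableSet {ω | δ / 2 ≤ |G n ω - a|} :=
      measurableSet_le measurable_const (((hGm n).sub_const a).abs)
    rw [measureReal_def, hP, ← Measure.map_apply measurable_fst hm, Measure.map_fst_prod]
    simp [measureReal_def]

/-- Validity of the interval between two simulated quantiles. -/
theorem tendsto_prod_simLaw_quantile_interval {N K T : ℕ → ℕ} (hN : Tendsto N atTop atTop)
    {E : (n : ℕ) → Ω → Fin (K n + 1) → (Fin (T n) → ℝ) → ℝ}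
    (hE : ∀ n b, Measurable fun p : Ω × (Fin (T n) → ℝ) => E n p.1 b p.2)
    {X : ℕ → Ω → ℝ} (hX : ∀ n, Measurable (X n)) {F : ℝ → ℝ} (hFc : Continuous F)
    (hFm : StrictMono F)
    (hXF : ∀ x, Tendsto (fun n => μ.real {ω | X n ω ≤ x}) atTop (𝓝 (F x)))
    (hcond : ∀ y, VanishesInProb μ fun n ω =>
      (drawLaw (K n) (T n)).real {d | E n ω d.1 d.2 ≤ y} - F y)
    {q₁ q₂ : ℝ} (h0 : 0 < F q₁) (h12 : F q₁ < F q₂) (h1 : F q₂ ≤ 1) :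
    Tendsto (fun n => (μ.prod (simLaw (N n) (K n) (T n))).real
      {p | orderStat (fun i => E n p.1 (p.2.1 i) (p.2.2 i)) ⌈F q₁ * N n⌉₊ ≤ X n p.1 ∧
        X n p.1 ≤ orderStat (fun i => E n p.1 (p.2.1 i) (p.2.2 i)) ⌈F q₂ * N n⌉₊})
      atTop (𝓝 (F q₂ - F q₁)) := by
  have hq : q₁ < q₂ := hFm.lt_iff_lt.mp h12
  have hemp : ∀ y δ : ℝ, 0 < δ → Tendsto (fun n => (μ.prod (simLaw (N n) (K n) (T n))).real
      {p | δ ≤ |empiricalCDF (fun i => E n p.1 (p.2.1 i) (p.2.2 i)) y - F y|}) atTop (𝓝 0) :=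
    fun y δ hδ => tendsto_prod_simLaw_abs_empiricalCDF_sub hN hE (hcond y) hδ
  -- an order statistic stays on its side of every other point
  have hup : ∀ q y : ℝ, 0 < F q → F q ≤ 1 → q < y →
      Tendsto (fun n => (μ.prod (simLaw (N n) (K n) (T n))).real
        {p | y < orderStat (fun i => E n p.1 (p.2.1 i) (p.2.2 i)) ⌈F q * N n⌉₊}) atTop (𝓝 0) := by
    intro q y hq0 hq1 hqy
    -- If the order statistic exceeds y, the empirical distribution function at y is below F q,
    -- hence off by more than F y - F q.
    refine squeeze_zero' (.of_forall fun _ => measureReal_nonneg) ?_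
      (hemp y (F y - F q) (sub_pos.mpr (hFm hqy)))
    filter_upwards [hN.eventually_gt_atTop 0] with n hn
    refine measureReal_mono fun p hp => ?_
    have hp' := not_le.mpr (show y < _ from hp)
    rw [orderStat_ceil_le_iff _ hq0 hq1 hn, not_le] at hp'
    simp only [Set.mem_ofPred_eq]
    rw [abs_sub_comm]
    exact le_trans (by linarith) (le_abs_self _)
  have hlow : ∀ q y : ℝ, 0 < F q → F q ≤ 1 → y < q →
      Tendsto (fun n => (μ.prod (simLaw (N n) (K n) (T n))).real
        {p | orderStat (fun i => E n p.1 (p.2.1 i) (p.2.2 i)) ⌈F q * N n⌉₊ ≤ y}) atTop (𝓝 0) := by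
    intro q y hq0 hq1 hqy
    refine squeeze_zero' (.of_forall fun _ => measureReal_nonneg) ?_
      (hemp y (F q - F y) (sub_pos.mpr (hFm hqy)))
    filter_upwards [hN.eventually_gt_atTop 0] with n hn
    refine measureReal_mono fun p hp => ?_
    have hp' : orderStat _ _ ≤ y := hp
    rw [orderStat_ceil_le_iff _ hq0 hq1 hn] at hp'
    exact le_trans (sub_le_sub_right hp' _) (le_abs_self _)
  have hIoc : ∀ a b : ℝ, a ≤ b → ∀ n, (μ.prod (simLaw (N n) (K n) (T n))).real
      {p | a < X n p.1 ∧ X n p.1 ≤ b} = μ.real {ω | X n ω ≤ b} - μ.real {ω | X n ω ≤ a} := by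
    intro a b hab n
    have hm : MeasurableSet {ω | a < X n ω ∧ X n ω ≤ b} := hX n measurableSet_Ioc
    have e1 : (μ.prod (simLaw (N n) (K n) (T n))).real {p | a < X n p.1 ∧ X n p.1 ≤ b} =
        μ.real {ω | a < X n ω ∧ X n ω ≤ b} := by
      rw [measureReal_def, show {p : Ω × _ | a < X n p.1 ∧ X n p.1 ≤ b} =
        Prod.fst ⁻¹' {ω | a < X n ω ∧ X n ω ≤ b} from rfl, ← Measure.map_apply measurable_fst hm,
        Measure.map_fst_prod]
      simp [measureReal_def]
    have e2 : {ω | X n ω ≤ b} = {ω | X n ω ≤ a} ∪ {ω | a < X n ω ∧ X n ω ≤ b} := by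
      ext ω
      simp only [Set.mem_ofPred_eq, Set.mem_union]
      constructor
      · intro h
        rcases le_or_gt (X n ω) a with h' | h'
        · exact .inl h'
        · exact .inr ⟨h', h⟩
      · rintro (h | h)
        · exact h.trans hab
        · exact h.2
    have hdis : Disjoint {ω | X n ω ≤ a} {ω | a < X n ω ∧ X n ω ≤ b} := by
      rw [Set.disjoint_left]
      intro ω h h'
      exact absurd h (not_le.mpr h'.1)
    rw [e1, e2, measureReal_union hdis hm]
    ring
  rw [Metric.tendsto_nhds]
  intro ε hε
  have hcont : ∀ q : ℝ, ∀ᶠ d in 𝓝[>] (0 : ℝ),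
      |F (q + d) - F q| < ε / 8 ∧ |F (q - d) - F q| < ε / 8 := by
    intro q
    have t1 : Tendsto (fun d : ℝ => F (q + d)) (𝓝[>] 0) (𝓝 (F q)) := by
      have : Continuous fun d : ℝ => F (q + d) := by fun_prop
      simpa using (this.tendsto 0).mono_left nhdsWithin_le_nhds
    have t2 : Tendsto (fun d : ℝ => F (q - d)) (𝓝[>] 0) (𝓝 (F q)) := by
      have : Continuous fun d : ℝ => F (q - d) := by fun_prop
      simpa using (this.tendsto 0).mono_left nhdsWithin_le_nhds
    have := Metric.tendsto_nhds.mp t1 (ε / 8) (by positivity)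
    filter_upwards [this, Metric.tendsto_nhds.mp t2 (ε / 8) (by positivity)] with d h1 h2
    exact ⟨h1, h2⟩
  -- This keeps q₁ + d below q₂ - d, so that the inner interval used for the lower bound is not
  -- reversed.
  have hsmall : ∀ᶠ d in 𝓝[>] (0 : ℝ), d < (q₂ - q₁) / 2 :=
    nhdsWithin_le_nhds (Iio_mem_nhds (by linarith))
  obtain ⟨d, ⟨⟨⟨h1a, h1b⟩, h2a, h2b⟩, hd2⟩, hd⟩ :=
    ((((hcont q₁).and (hcont q₂)).and hsmall).and self_mem_nhdsWithin).exists
  have hd : 0 < d := hd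
  have hq20 : 0 < F q₂ := h0.trans h12
  have hq11 : F q₁ ≤ 1 := h12.le.trans h1
  filter_upwards [(hup q₁ (q₁ + d) h0 hq11 (by linarith)).eventually_lt_const
      (show (0 : ℝ) < ε / 8 by positivity),
    (hlow q₁ (q₁ - d) h0 hq11 (by linarith)).eventually_lt_const
      (show (0 : ℝ) < ε / 8 by positivity),
    (hup q₂ (q₂ + d) hq20 h1 (by linarith)).eventually_lt_const
      (show (0 : ℝ) < ε / 8 by positivity),
    (hlow q₂ (q₂ - d) hq20 h1 (by linarith)).eventually_lt_const
      (show (0 : ℝ) < ε / 8 by positivity),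
    Metric.tendsto_nhds.mp (hXF (q₁ + d)) (ε / 8) (by positivity),
    Metric.tendsto_nhds.mp (hXF (q₁ - d)) (ε / 8) (by positivity),
    Metric.tendsto_nhds.mp (hXF (q₂ + d)) (ε / 8) (by positivity),
    Metric.tendsto_nhds.mp (hXF (q₂ - d)) (ε / 8) (by positivity)] with n b1 b2 b3 b4 x1 x2 x3 x4
  set P := μ.prod (simLaw (N n) (K n) (T n))
  set O₁ : Ω × ((Fin (N n) → Fin (K n + 1)) × (Fin (N n) → Fin (T n) → ℝ)) → ℝ := fun p =>
    orderStat (fun i => E n p.1 (p.2.1 i) (p.2.2 i)) ⌈F q₁ * N n⌉₊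
  set O₂ : Ω × ((Fin (N n) → Fin (K n + 1)) × (Fin (N n) → Fin (T n) → ℝ)) → ℝ := fun p =>
    orderStat (fun i => E n p.1 (p.2.1 i) (p.2.2 i)) ⌈F q₂ * N n⌉₊
  -- The random endpoints are replaced by fixed ones at distance d, outside two events of small
  -- probability. Each of the two bounds collects six errors below ε/8.
  have hupper : P.real {p | O₁ p ≤ X n p.1 ∧ X n p.1 ≤ O₂ p} ≤
      P.real {p | q₁ - d < X n p.1 ∧ X n p.1 ≤ q₂ + d} +
      (P.real {p | O₁ p ≤ q₁ - d} + P.real {p | q₂ + d < O₂ p}) := by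
    refine (measureReal_mono (s₂ := {p | q₁ - d < X n p.1 ∧ X n p.1 ≤ q₂ + d} ∪
      ({p | O₁ p ≤ q₁ - d} ∪ {p | q₂ + d < O₂ p})) ?_).trans
      ((measureReal_union_le _ _).trans (by gcongr; exact measureReal_union_le _ _))
    intro p hp
    simp only [Set.mem_union, Set.mem_ofPred_eq] at hp ⊢
    by_contra! hcon
    have := hcon.1 (by linarith [hcon.2.1])
    linarith [hcon.2.2]
  have hlower : P.real {p | q₁ + d < X n p.1 ∧ X n p.1 ≤ q₂ - d} ≤
      P.real {p | O₁ p ≤ X n p.1 ∧ X n p.1 ≤ O₂ p} +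
      (P.real {p | q₁ + d < O₁ p} + P.real {p | O₂ p ≤ q₂ - d}) := by
    refine (measureReal_mono (s₂ := {p | O₁ p ≤ X n p.1 ∧ X n p.1 ≤ O₂ p} ∪
      ({p | q₁ + d < O₁ p} ∪ {p | O₂ p ≤ q₂ - d})) ?_).trans
      ((measureReal_union_le _ _).trans (by gcongr; exact measureReal_union_le _ _))
    intro p hp
    simp only [Set.mem_union, Set.mem_ofPred_eq] at hp ⊢
    by_contra! hcon
    have := hcon.1 (by linarith [hcon.2.1])
    linarith [hcon.2.2]
  rw [hIoc _ _ (by linarith)] at hupper hlower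
  rw [Real.dist_eq, abs_lt] at x1 x2 x3 x4 ⊢
  rw [abs_lt] at h1a h1b h2a h2b
  obtain ⟨_, _⟩ := x1
  obtain ⟨_, _⟩ := x2
  obtain ⟨_, _⟩ := x3
  obtain ⟨_, _⟩ := x4
  obtain ⟨_, _⟩ := h1a
  obtain ⟨_, _⟩ := h1b
  obtain ⟨_, _⟩ := h2a
  obtain ⟨_, _⟩ := h2b
  change P.real {p | q₁ + d < O₁ p} < _ at b1
  change P.real {p | O₁ p ≤ q₁ - d} < _ at b2
  change P.real {p | q₂ + d < O₂ p} < _ at b3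
  change P.real {p | O₂ p ≤ q₂ - d} < _ at b4
  change _ < P.real {p | O₁ p ≤ X n p.1 ∧ X n p.1 ≤ O₂ p} - _ ∧
    P.real {p | O₁ p ≤ X n p.1 ∧ X n p.1 ≤ O₂ p} - _ < _
  constructor <;> linarith

end QuantileInterval

/-! ### Laws of large numbers for stationary mixing arrays -/

section StationaryArrays

variable {ι Ω E : Type*} [MeasurableSpace Ω] [MeasurableSpace E] {μ : Measure Ω}
  {I : ι → Set ℕ} {ξ : ι → ℕ → Ω → E}

lemma StrictlyStationary.identDistrib (h : StrictlyStationary μ I ξ) {i i' : ι} {s s' : ℕ}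
    (hs : s ∈ I i) (hs' : s' ∈ I i') : IdentDistrib (ξ i s) (ξ i' s') μ μ :=
  (h i i' 1 s s' (fun r hr => by simpa [Nat.lt_one_iff.mp hr] using hs)
    (fun r hr => by simpa [Nat.lt_one_iff.mp hr] using hs')).comp
    (u := fun x : Fin 1 → E => x 0) (measurable_pi_apply 0)

lemma StrictlyStationary.map_eq (h : StrictlyStationary μ I ξ) {i i' : ι} {s s' : ℕ}
    (hs : s ∈ I i) (hs' : s' ∈ I i') : μ.map (ξ i s) = μ.map (ξ i' s') :=
  (h.identDistrib hs hs').map_eq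

/-- Weak law of large numbers along windows of growing length. -/
lemma StronglyMixing.vanishesInProb_average_sub [IsProbabilityMeasure μ]
    (h : StronglyMixing μ I ξ) (hξ : ∀ i t, Measurable (ξ i t)) {ρ : Measure E} {f : E → ℝ}
    (hf : Measurable f) (hfi : Integrable f ρ) {i : ℕ → ι} {s k : ℕ → ℕ}
    (hk : Tendsto k atTop atTop) (hI : ∀ᶠ n in atTop, ∀ r < k n, s n + r ∈ I (i n))
    (hρ : ∀ᶠ n in atTop, ∀ r < k n, μ.map (ξ (i n) (s n + r)) = ρ) :
    VanishesInProb μ fun n ω =>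
      (k n : ℝ)⁻¹ * ∑ r ∈ Finset.range (k n), f (ξ (i n) (s n + r) ω) - ∫ x, f x ∂ρ := by
  refine .of_integral_abs ?_ ?_
  · filter_upwards [hρ] with n hn
    refine ((integrable_finsetSum _ fun r hr => ?_).const_mul _).sub (integrable_const _)
    have := hn r (Finset.mem_range.mp hr)
    rw [← this] at hfi
    exact hfi.comp_measurable (hξ _ _)
  · rw [Metric.tendsto_nhds]
    intro ε hε
    obtain ⟨K, hK⟩ := h.exists_integral_abs_average_sub_le hξ hf hfi (half_pos hε)
    filter_upwards [hI, hρ, hk.eventually_ge_atTop K] with n h1 h2 h3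
    rw [Real.dist_eq, sub_zero, abs_of_nonneg (integral_nonneg fun _ => abs_nonneg _)]
    exact (hK (i n) (s n) (k n) h3 h1 h2).trans_lt (half_lt_self hε)

lemma sum_Icc_succ_eq_sum_range {M : Type*} [AddCommMonoid M] (f : ℕ → M) (b m : ℕ) :
    ∑ t ∈ Finset.Icc (b + 1) (b + m), f t = ∑ r ∈ Finset.range m, f (b + 1 + r) := by
  have : Finset.Icc (b + 1) (b + m) = Finset.Ico (b + 1) (b + 1 + m) := by
    ext t; simp only [Finset.mem_Icc, Finset.mem_Ico]; omega
  rw [this, Finset.sum_Ico_eq_sum_range, Nat.add_sub_cancel_left]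

lemma sum_Ioc_eq_sum_range {M : Type*} [AddCommMonoid M] (f : ℕ → M) (b m : ℕ) :
    ∑ t ∈ Finset.Ioc b (b + m), f t = ∑ r ∈ Finset.range m, f (b + 1 + r) := by
  rw [← sum_Icc_succ_eq_sum_range]
  refine Finset.sum_congr ?_ fun _ _ => rfl
  ext t; simp only [Finset.mem_Icc, Finset.mem_Ioc]; omega

end StationaryArrays

/-! ### Stochastic expansion of simplex-constrained least squares -/

section LeastSquaresExpansion

open Matrix

variable {ι Ω : Type*} [Fintype ι] [MeasurableSpace Ω] {μ : Measure Ω} [IsProbabilityMeasure μ]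

lemma BoundedInProb.absSum {b : ℕ → Ω → ι → ℝ}
    (hb : ∀ i, BoundedInProb μ fun n ω => b n ω i) :
    BoundedInProb μ fun n ω => absSum (b n ω) :=
  BoundedInProb.sum Finset.univ fun i _ => (hb i).of_abs_le
    (.of_forall fun _ => .of_forall fun _ => by rw [abs_abs])

/-- Asymptotic expansion of least squares weights constrained to the simplex. -/
theorem vanishesInProb_sqrt_mul_sub_coneSolution {A : Matrix ι ι ℝ} (hA : A.PosDef)
    {w₀ : ι → ℝ} (hw₀ : w₀ ∈ stdSimplex ℝ ι) {N : ℕ → ℝ} (hN : Tendsto N atTop atTop) {R : Type*}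
    {s : ℕ → Finset R} {y : ℕ → Ω → R → ℝ} {z : ℕ → Ω → R → ι → ℝ} {w : ℕ → Ω → ι → ℝ}
    (hmin : ∀ᶠ n in atTop, ∀ᵐ ω ∂μ, w n ω ∈ stdSimplex ℝ ι ∧ ∀ w' ∈ stdSimplex ℝ ι,
      residualSS (s n) (y n ω) (z n ω) (w n ω) ≤ residualSS (s n) (y n ω) (z n ω) w')
    {b : ℕ → Ω → ι → ℝ} (hb : ∀ i, BoundedInProb μ fun n ω => b n ω i)
    (hgram : ∀ i j, VanishesInProb μ fun n ω => gramMatrix (s n) (z n ω) (N n) i j - A i j)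
    (hscore : ∀ i, VanishesInProb μ fun n ω =>
      scoreVector (s n) (z n ω) (fun r => y n ω r - w₀ ⬝ᵥ z n ω r) (N n) i - b n ω i) (i : ι) :
    VanishesInProb μ fun n ω => √(N n) * (w n ω i - w₀ i) - coneSolution A w₀ (b n ω) i := by
  obtain ⟨c, hc, hcA⟩ := hA.exists_absSum_sq_le
  obtain ⟨r, hr0, hr⟩ := exists_pos_le_of_mem_stdSimplex hw₀
  set Δ : ℕ → Ω → ℝ := fun n ω => ∑ i, ∑ j, |gramMatrix (s n) (z n ω) (N n) i j - A i j| with hΔ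
  set e : ℕ → Ω → ℝ := fun n ω =>
    ∑ i, |scoreVector (s n) (z n ω) (fun r => y n ω r - w₀ ⬝ᵥ z n ω r) (N n) i - b n ω i| with he
  have hΔv : VanishesInProb μ Δ := VanishesInProb.sum Finset.univ fun i _ =>
    VanishesInProb.sum Finset.univ fun j _ => (hgram i j).abs
  have hev : VanishesInProb μ e := VanishesInProb.sum Finset.univ fun i _ => (hscore i).abs
  have hbb := BoundedInProb.absSum hb
  -- The deterministic bound of `absSum_smul_sub_coneSolution_le`, with the sums of absolute errors
  -- of the Gram matrix and of the score as δ and ε.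
  have hX : VanishesInProb μ fun n ω => 2 * (Δ n ω * (absSum (b n ω) / c) + e n ω) / c :=
    (((hΔv.mul_bounded (hbb.mul (boundedInProb_const c⁻¹))).add hev).const_mul (2 / c)).congr
      fun n ω => by ring
  refine .of_exceptional fun ε hε => ?_
  obtain ⟨M, hM, hbM⟩ := hbb (ε / 3) (by positivity)
  have hsq : Tendsto (fun n => √(N n) * r) atTop atTop :=
    (Real.tendsto_sqrt_atTop.comp hN).atTop_mul_const hr0
  filter_upwards [hX.exceptional hε (show 0 < ε / 3 by positivity), hbM, hmin,
    hΔv.exceptional (show 0 < c / 2 by positivity) (show 0 < ε / 3 by positivity),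
    hN.eventually_gt_atTop 0, hsq.eventually_ge_atTop (M / c)] with n h1 h2 h3 h4 h5 h6
  -- Three exceptional events of probability at most ε/3: the bound is not small, the vector b is
  -- too large for the rescaled cone solution to be feasible, or the Gram matrix error exceeds c/2.
  refine ⟨_, ((measureReal_union_le _ _).trans (add_le_add ((measureReal_union_le _ _).trans
    (add_le_add h1 h2)) h4)).trans (by linarith), ?_⟩
  filter_upwards [h3] with ω ⟨hwm, hwmin⟩ hω
  simp only [Set.mem_union, Set.mem_ofPred_eq, not_or, not_le] at hω
  obtain ⟨⟨g1, g2⟩, g3⟩ := hω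
  have hΔ0 : 0 ≤ Δ n ω := Finset.sum_nonneg fun _ _ => Finset.sum_nonneg fun _ _ => abs_nonneg _
  have he0 : 0 ≤ e n ω := Finset.sum_nonneg fun _ _ => abs_nonneg _
  have key := absSum_smul_sub_coneSolution_le hA hc hcA hw₀ hr h5 hwm hwmin (b := b n ω)
    (δ := Δ n ω) (ε := e n ω)
    (fun i j => (Finset.single_le_sum (f := fun j =>
      |gramMatrix (s n) (z n ω) (N n) i j - A i j|) (fun _ _ => abs_nonneg _)
      (Finset.mem_univ j)).trans (Finset.single_le_sum (f := fun i => ∑ j,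
      |gramMatrix (s n) (z n ω) (N n) i j - A i j|)
      (fun _ _ => Finset.sum_nonneg fun _ _ => abs_nonneg _) (Finset.mem_univ i)))
    ((le_abs_self _).trans g3.le)
    (fun i => Finset.single_le_sum (f := fun i => |scoreVector (s n) (z n ω)
      (fun r => y n ω r - w₀ ⬝ᵥ z n ω r) (N n) i - b n ω i|) (fun _ _ => abs_nonneg _)
      (Finset.mem_univ i)) he0 hΔ0
    ((div_le_div_of_nonneg_right ((le_abs_self _).trans g2.le) hc.le).trans h6)
  refine lt_of_le_of_lt ?_ (lt_of_le_of_lt key ((le_abs_self _).trans_lt g1))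
  exact abs_le_absSum (√(N n) • (w n ω - w₀) - coneSolution A w₀ (b n ω)) i

end LeastSquaresExpansion

/-! ### Regression arrays and block scores -/

section RegressionArrays

open Matrix

variable {ι Ω : Type*} [Fintype ι] [MeasurableSpace Ω] {μ : Measure Ω}

/-- Error of the outcome `x.1` for the weights `w₀` of the controls `x.2.1`. -/
def modelError (w₀ : ι → ℝ) (x : ℝ × (ι → ℝ) × ℝ) : ℝ := x.1 - w₀ ⬝ᵥ x.2.1

lemma measurable_modelError (w₀ : ι → ℝ) : Measurable (modelError w₀) := by
  unfold modelError dotProduct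
  fun_prop

section Moments

variable {X : Ω → ℝ × (ι → ℝ) × ℝ}

lemma MeasureTheory.MemLp.fst_comp (hX : MemLp X 2 μ) : MemLp (fun ω => (X ω).1) 2 μ :=
  hX.of_le hX.1.fst (.of_forall fun _ => norm_fst_le _)

lemma MeasureTheory.MemLp.control (hX : MemLp X 2 μ) (j : ι) :
    MemLp (fun ω => (X ω).2.1 j) 2 μ :=
  hX.of_le (by have := hX.1; fun_prop) (.of_forall fun ω =>
    ((norm_le_pi_norm _ j).trans (norm_fst_le _)).trans (norm_snd_le _))

lemma MeasureTheory.MemLp.modelError (hX : MemLp X 2 μ) (w₀ : ι → ℝ) :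
    MemLp (fun ω => modelError w₀ (X ω)) 2 μ :=
  hX.fst_comp.sub (memLp_finsetSum _ fun j _ => (hX.control j).const_mul (w₀ j))

end Moments

/-- A square integrable, strongly mixing array of outcomes and controls which is stationary up to
the time `n` and from then on up to `n + T n`, in its `n`-th row. -/
structure IsRegressionArray (μ : Measure Ω) (T : ℕ → ℕ) (ξ : ℕ → ℕ → Ω → ℝ × (ι → ℝ) × ℝ) :
    Prop where
  measurable : ∀ n t, Measurable (ξ n t)
  memLp : ∀ n, ∀ t ∈ Finset.Icc 1 (n + T n), MemLp (ξ n t) 2 μ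
  stationary_pre : StrictlyStationary μ (fun n => Set.Icc 1 n) ξ
  stationary_post : StrictlyStationary μ (fun n => Set.Ioc n (n + T n)) ξ
  mixing : StronglyMixing μ (fun n => Set.Icc 1 (n + T n)) ξ

/-- Score of the times `b + 1, …, b + m` in row `n`. -/
noncomputable def blockScore (w₀ : ι → ℝ) (ξ : ℕ → ℕ → Ω → ℝ × (ι → ℝ) × ℝ) (n m b : ℕ) (ω : Ω) :
    ι → ℝ :=
  scoreVector (Finset.Icc (b + 1) (b + m)) (fun t => (ξ n t ω).2.1)
    (fun t => modelError w₀ (ξ n t ω)) m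

variable {w₀ : ι → ℝ} {ξ : ℕ → ℕ → Ω → ℝ × (ι → ℝ) × ℝ} {T : ℕ → ℕ}

omit [MeasurableSpace Ω] in
lemma blockScore_eq (n m b : ℕ) (ω : Ω) (i : ι) : blockScore w₀ ξ n m b ω i =
    (√(m : ℝ))⁻¹ * ∑ r ∈ Finset.range m,
      (ξ n (b + 1 + r) ω).2.1 i * modelError w₀ (ξ n (b + 1 + r) ω) := by
  rw [blockScore, scoreVector, sum_Icc_succ_eq_sum_range]

omit [MeasurableSpace Ω] in
lemma measurable_blockScore_of {m₀ : MeasurableSpace Ω} {n m b : ℕ}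
    (h : ∀ t ∈ Finset.Icc (b + 1) (b + m), Measurable[m₀] (ξ n t)) :
    Measurable[m₀] (blockScore w₀ ξ n m b) := by
  refine measurable_pi_lambda _ fun i => ?_
  unfold blockScore scoreVector
  refine Measurable.const_mul (Finset.measurable_sum _ fun t ht => ?_) _
  have hr := (measurable_modelError w₀).comp (h t ht)
  exact ((measurable_pi_apply i).comp (measurable_fst.comp (measurable_snd.comp (h t ht)))).mul hr

namespace IsRegressionArray

variable (hξ : IsRegressionArray μ T ξ)

include hξ

lemma measurable_blockScore (n m b : ℕ) : Measurable (blockScore w₀ ξ n m b) :=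
  measurable_blockScore_of fun t _ => hξ.measurable n t

/-- The law of the score of a pre-treatment block depends on its length only. -/
lemma identDistrib_blockScore {n m b : ℕ} (h : b + m ≤ n) :
    IdentDistrib (blockScore w₀ ξ m m 0) (blockScore w₀ ξ n m b) μ μ := by
  -- Row m has exactly m pre-treatment periods, so its full score is the reference for all blocks of
  -- length m.
  have hid := hξ.stationary_pre m n m (0 + 1) (b + 1)
    (fun r hr => ⟨by omega, by omega⟩) (fun r hr => ⟨by omega, by omega⟩)
  have hg : Measurable fun (x : Fin m → ℝ × (ι → ℝ) × ℝ) (i : ι) =>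
      (√(m : ℝ))⁻¹ * ∑ r, (x r).2.1 i * modelError w₀ (x r) := by
    have := measurable_modelError w₀
    fun_prop
  have e : ∀ n b, blockScore w₀ ξ n m b =
      (fun (x : Fin m → ℝ × (ι → ℝ) × ℝ) (i : ι) =>
        (√(m : ℝ))⁻¹ * ∑ r, (x r).2.1 i * modelError w₀ (x r)) ∘
        fun ω (r : Fin m) => ξ n (b + 1 + r) ω := by
    intro n b
    ext ω i
    rw [blockScore_eq, Finset.sum_range]
    rfl
  rw [e, e]
  exact hid.comp hg

variable [IsProbabilityMeasure μ]

/-- Weak law for products of square integrable controls. The limit is written with period 1 of row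
1, as the pre-treatment law is common to all rows. -/
lemma vanishesInProb_gramMatrix_sub {n m b : ℕ → ℕ} (hm : Tendsto m atTop atTop)
    (hb : ∀ᶠ k in atTop, b k + m k ≤ n k) (i j : ι) :
    VanishesInProb μ fun k ω =>
      gramMatrix (Finset.Icc (b k + 1) (b k + m k)) (fun t => (ξ (n k) t ω).2.1) (m k) i j -
        ∫ ω, (ξ 1 1 ω).2.1 i * (ξ 1 1 ω).2.1 j ∂μ := by
  have h11 : MemLp (ξ 1 1) 2 μ := hξ.memLp 1 1 (by simp)
  have hint : Integrable (fun ω => (ξ 1 1 ω).2.1 i * (ξ 1 1 ω).2.1 j) μ :=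
    (h11.control i).integrable_mul (h11.control j)
  have hf : Measurable fun x : ℝ × (ι → ℝ) × ℝ => x.2.1 i * x.2.1 j := by fun_prop
  have hfi : Integrable (fun x : ℝ × (ι → ℝ) × ℝ => x.2.1 i * x.2.1 j) (μ.map (ξ 1 1)) :=
    (integrable_map_measure hf.aestronglyMeasurable (hξ.measurable 1 1).aemeasurable).mpr hint
  have key := hξ.mixing.vanishesInProb_average_sub hξ.measurable hf hfi (i := n)
    (s := fun k => b k + 1) hm
    (by filter_upwards [hb] with k hk r hr using ⟨by omega, by omega⟩)
    (by filter_upwards [hb] with k hk r hr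
        exact hξ.stationary_pre.map_eq ⟨by omega, by omega⟩ ⟨le_rfl, le_rfl⟩)
  rw [integral_map (hξ.measurable 1 1).aemeasurable hf.aestronglyMeasurable] at key
  refine key.congr fun k ω => ?_
  rw [gramMatrix, Matrix.of_apply, sum_Icc_succ_eq_sum_range]

/-- The average of a bounded function of the block scores over all blocks is close to its
expectation. -/
theorem vanishesInProb_average_blockScore_sub {m : ℕ → ℕ}
    (hmn : Tendsto (fun n : ℕ => (m n : ℝ) / n) atTop (𝓝 0)) {h : (ι → ℝ) → ℝ} (hh : Measurable h)
    (h0 : ∀ x, 0 ≤ h x) (h1 : ∀ x, h x ≤ 1) :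
    VanishesInProb μ fun n ω => ((n - m n + 1 : ℕ) : ℝ)⁻¹ *
      ∑ b ∈ Finset.range (n - m n + 1), h (blockScore w₀ ξ n (m n) b ω) -
        ∫ ω, h (blockScore w₀ ξ (m n) (m n) 0 ω) ∂μ := by
  obtain ⟨a, ha, hcov⟩ := hξ.mixing.exists_covariance_le hξ.measurable
  set K : ℕ → ℕ := fun n => n - m n + 1 with hK
  have hKdef : ∀ n, K n = n - m n + 1 := fun _ => rfl
  set e : ℕ → ℝ := fun n => ∫ ω, h (blockScore w₀ ξ (m n) (m n) 0 ω) ∂μ with he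
  set Z : ℕ → ℕ → Ω → ℝ := fun n b ω => h (blockScore w₀ ξ n (m n) b ω) - e n with hZ
  have hbi : ∀ n m b, Integrable (fun ω => h (blockScore w₀ ξ n m b ω)) μ := fun n m b =>
    Integrable.of_bound (hh.comp (hξ.measurable_blockScore n m b)).aestronglyMeasurable 1
      (.of_forall fun ω => by rw [Real.norm_of_nonneg (h0 _)]; exact h1 _)
  have he0 : ∀ n, 0 ≤ e n := fun n => integral_nonneg fun _ => h0 _
  have he1 : ∀ n, e n ≤ 1 := fun n => by
    simpa using integral_mono (hbi (m n) (m n) 0) (integrable_const (1 : ℝ)) fun ω => h1 _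
  have hZb : ∀ n b ω, |Z n b ω| ≤ 1 := fun n b ω => by
    rw [abs_le]
    constructor <;> simp only [hZ] <;> linarith [h0 (blockScore w₀ ξ n (m n) b ω),
      h1 (blockScore w₀ ξ n (m n) b ω), he0 n, he1 n]
  have hZm : ∀ n b, Measurable (Z n b) := fun n b =>
    (hh.comp (hξ.measurable_blockScore n (m n) b)).sub_const _
  have hmle : ∀ᶠ n in atTop, m n ≤ n := by
    filter_upwards [hmn.eventually_lt_const one_pos, eventually_gt_atTop 0] with n h1 h2
    have : (0 : ℝ) < n := by exact_mod_cast h2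
    rw [div_lt_one this] at h1
    exact_mod_cast h1.le
  have hZ0 : ∀ n b, m n ≤ n → b < K n → ∫ ω, Z n b ω ∂μ = 0 := by
    intro n b hn hb
    have := ((hξ.identDistrib_blockScore (w₀ := w₀)
      (show b + m n ≤ n by have := hKdef n; omega)).comp hh).integral_eq
    simp only [hZ]
    rw [integral_sub (hbi _ _ _) (integrable_const _)]
    simpa [he, sub_eq_zero] using this.symm
  -- Blocks whose starting points differ by at least m + g are separated by a gap of g. The
  -- remaining pairs are a fraction of order (m + g)/K, which vanishes as m/n → 0.
  have hsq : ∀ g : ℕ, ∀ n, m n ≤ n →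
      ∫ ω, ((K n : ℝ)⁻¹ * ∑ b ∈ Finset.range (K n), Z n b ω) ^ 2 ∂μ ≤
        4 * |a g| + (1 : ℝ) ^ 2 * (2 * (m n + g : ℕ)) / K n := by
    intro g n hn
    refine integral_sq_average_le (Nat.succ_pos _) (by positivity) (fun t _ => hZm n t)
      (fun t _ => hZb n t) fun s t hst ht => ?_
    have key := hcov n (s + m n) g (Z n s) (Z n t) 1 one_pos
      ((hh.comp (measurable_blockScore_of fun r hr => measurable_pastAlgebra
        (J := Set.Icc 1 (n + T n)) (by
          rw [Finset.mem_Icc] at hr; have := hKdef n; exact ⟨by omega, by omega⟩)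
        (Finset.mem_Icc.mp hr).2)).sub_const _)
      ((hh.comp (measurable_blockScore_of fun r hr => measurable_futureAlgebra
        (J := Set.Icc 1 (n + T n)) (by
          rw [Finset.mem_Icc] at hr; have := hKdef n; exact ⟨by omega, by omega⟩)
        (by rw [Finset.mem_Icc] at hr; omega))).sub_const _)
      (hZb n s) (hZb n t)
    rw [hZ0 n s hn (by have := hKdef n; omega), zero_mul, sub_zero] at key
    refine key.trans ?_
    nlinarith [le_abs_self (a g)]
  have hKn : Tendsto (fun n => (m n : ℝ) / K n) atTop (𝓝 0) := by
    have hb : ∀ᶠ n : ℕ in atTop, (m n : ℝ) / K n ≤ 2 * ((m n : ℝ) / n) := by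
      filter_upwards [hmn.eventually_lt_const (show (0 : ℝ) < 1 / 2 by norm_num),
        eventually_gt_atTop 0, hmle] with n h1 h2 h3
      have h2' : (0 : ℝ) < n := by exact_mod_cast h2
      rw [div_lt_iff₀ h2'] at h1
      have hK' : (n : ℝ) / 2 ≤ K n := by
        simp only [hK]; push_cast [Nat.cast_sub h3]; linarith
      calc (m n : ℝ) / K n ≤ m n / (n / 2) := by gcongr
        _ = _ := by field_simp
    refine squeeze_zero' (.of_forall fun _ => by positivity) hb ?_
    simpa using hmn.const_mul 2
  have hKinf : Tendsto (fun n => (K n : ℝ)) atTop atTop := by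
    have hb : ∀ᶠ n : ℕ in atTop, (n : ℝ) / 2 ≤ K n := by
      filter_upwards [hmn.eventually_lt_const (show (0 : ℝ) < 1 / 2 by norm_num),
        eventually_gt_atTop 0, hmle] with n h1 h2 h3
      have h2' : (0 : ℝ) < n := by exact_mod_cast h2
      rw [div_lt_iff₀ h2'] at h1
      simp only [hK]; push_cast [Nat.cast_sub h3]; linarith
    exact tendsto_atTop_mono' _ hb (tendsto_natCast_atTop_atTop.atTop_div_const (by norm_num))
  set Y : ℕ → Ω → ℝ := fun n ω => (K n : ℝ)⁻¹ * ∑ b ∈ Finset.range (K n), Z n b ω with hY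
  have hYm : ∀ n, Measurable (Y n) := fun n =>
    (Finset.measurable_sum _ fun b _ => hZm n b).const_mul _
  have hYb : ∀ n ω, |Y n ω| ≤ 1 := by
    intro n ω
    have hK0 : (0 : ℝ) < K n := by simp only [hK]; positivity
    rw [hY, abs_mul, abs_of_pos (inv_pos.mpr hK0), ← div_eq_inv_mul, div_le_one hK0]
    refine (Finset.abs_sum_le_sum_abs _ _).trans ?_
    simpa using Finset.sum_le_sum fun b (_ : b ∈ Finset.range (K n)) => hZb n b ω
  have hlim : Tendsto (fun n => ∫ ω, Y n ω ^ 2 ∂μ) atTop (𝓝 0) := by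
    rw [Metric.tendsto_nhds]
    intro ε hε
    have : Tendsto (fun g => 4 * |a g|) atTop (𝓝 0) := by simpa using ha.abs.const_mul 4
    -- The gap is fixed before n grows.
    obtain ⟨g, hg⟩ := (this.eventually_lt_const (half_pos hε)).exists
    have hlim2 : Tendsto (fun n => (1 : ℝ) ^ 2 * (2 * (m n + g : ℕ)) / K n) atTop (𝓝 0) := by
      have h3 := (hKn.add (tendsto_const_nhds (x := (g : ℝ)) |>.div_atTop hKinf)).const_mul 2
      simp only [add_zero, mul_zero] at h3
      refine h3.congr fun n => ?_
      push_cast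
      ring
    filter_upwards [hlim2.eventually_lt_const (half_pos hε), hmle] with n hn hle
    rw [Real.dist_eq, sub_zero, abs_of_nonneg (integral_nonneg fun _ => sq_nonneg _)]
    linarith [hsq g n hle]
  have hY2 : VanishesInProb μ fun n ω => Y n ω ^ 2 := by
    refine .of_integral_abs (.of_forall fun n => ?_) (by simpa using hlim)
    exact Integrable.of_bound ((hYm n).pow_const 2).aestronglyMeasurable 1 (.of_forall fun ω => by
      rw [norm_pow, Real.norm_eq_abs]; exact pow_le_one₀ (abs_nonneg _) (hYb n ω))
  have hYv : VanishesInProb μ Y := by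
    have h3 := VanishesInProb.comp_continuousAt (a := 0) (hY2.congr fun n ω => sub_zero _)
      Real.continuous_sqrt.continuousAt
    refine h3.of_abs_le (.of_forall fun n => .of_forall fun ω => ?_)
    simp [Real.sqrt_sq_eq_abs]
  refine hYv.congr fun n ω => ?_
  have hK0 : (K n : ℝ) ≠ 0 := by simp only [hK]; positivity
  simp only [hY, hZ, Finset.sum_sub_distrib, Finset.sum_const, Finset.card_range, nsmul_eq_mul]
  rw [mul_sub, inv_mul_cancel_left₀ hK0]

end IsRegressionArray

end RegressionArrays

/-! ### Averages over blocks and scaled sums in probability -/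

section Averages

variable {Ω : Type*} [MeasurableSpace Ω] {μ : Measure Ω} [IsProbabilityMeasure μ]

omit [IsProbabilityMeasure μ] in
lemma BoundedInProb.comp_tendsto {X : ℕ → Ω → ℝ} (hX : BoundedInProb μ X) {k : ℕ → ℕ}
    (hk : Tendsto k atTop atTop) : BoundedInProb μ fun n => X (k n) := by
  intro ε hε
  obtain ⟨M, hM, h⟩ := hX ε hε
  exact ⟨M, hM, hk.eventually h⟩

/-- If every choice of one member from each row vanishes, then so do the averages of the rows. -/
lemma VanishesInProb.average_of_forall_sequence {K : ℕ → ℕ} {H : ℕ → ℕ → Ω → ℝ}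
    (hHm : ∀ n b, Measurable (H n b)) {C : ℝ} (hC : ∀ n b ω, |H n b ω| ≤ C)
    (h : ∀ b : ℕ → ℕ, (∀ n, b n ≤ K n) → VanishesInProb μ fun n => H n (b n)) :
    VanishesInProb μ fun n ω => ((K n + 1 : ℕ) : ℝ)⁻¹ * ∑ b ∈ Finset.range (K n + 1), H n b ω := by
  have hint : ∀ n b, Integrable (H n b) μ := fun n b =>
    Integrable.of_bound (hHm n b).aestronglyMeasurable C (.of_forall (hC n b))
  -- The member of the row with the largest L¹ norm dominates the average, and these choices form
  -- one admissible sequence. Thus no uniformity over blocks has to be assumed.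
  have hmax : ∀ n, ∃ b ≤ K n, ∀ b' ≤ K n, ∫ ω, |H n b' ω| ∂μ ≤ ∫ ω, |H n b ω| ∂μ := by
    intro n
    obtain ⟨b, hb, hb'⟩ := Finset.exists_max_image (Finset.range (K n + 1))
      (fun b => ∫ ω, |H n b ω| ∂μ) ⟨0, by simp⟩
    simp only [Finset.mem_range, Nat.lt_succ_iff] at hb hb'
    exact ⟨b, hb, hb'⟩
  choose b hb hbmax using hmax
  have hlim := (h b hb).tendsto_integral_abs (fun n => (hHm n _).aestronglyMeasurable)
    fun n ω => hC n _ ω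
  refine .of_integral_abs (.of_forall fun n =>
    (integrable_finsetSum _ fun b _ => hint n b).const_mul _) ?_
  refine squeeze_zero (fun _ => integral_nonneg fun _ => abs_nonneg _) (fun n => ?_) hlim
  have hK : (0 : ℝ) < (K n + 1 : ℕ) := by positivity
  calc ∫ ω, |((K n + 1 : ℕ) : ℝ)⁻¹ * ∑ b ∈ Finset.range (K n + 1), H n b ω| ∂μ
      ≤ ∫ ω, ((K n + 1 : ℕ) : ℝ)⁻¹ * ∑ b ∈ Finset.range (K n + 1), |H n b ω| ∂μ := by
        refine integral_mono ((integrable_finsetSum _ fun b _ => hint n b).const_mul _).abs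
          ((integrable_finsetSum _ fun b _ => (hint n b).abs).const_mul _) fun ω => ?_
        dsimp only
        rw [abs_mul, abs_of_pos (inv_pos.mpr hK)]
        gcongr
        exact Finset.abs_sum_le_sum_abs _ _
    _ = ((K n + 1 : ℕ) : ℝ)⁻¹ * ∑ b ∈ Finset.range (K n + 1), ∫ ω, |H n b ω| ∂μ := by
        rw [integral_const_mul, integral_finsetSum _ fun b _ => (hint n b).abs]
    _ ≤ ((K n + 1 : ℕ) : ℝ)⁻¹ * ∑ _ ∈ Finset.range (K n + 1), ∫ ω, |H n (b n) ω| ∂μ := by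
        refine mul_le_mul_of_nonneg_left (Finset.sum_le_sum fun b' hb' => ?_) (by positivity)
        exact hbmax n b' (Nat.lt_succ_iff.mp (Finset.mem_range.mp hb'))
    _ = ∫ ω, |H n (b n) ω| ∂μ := by
        rw [Finset.sum_const, Finset.card_range, nsmul_eq_mul, inv_mul_cancel_left₀ hK.ne']

/-- Limits of scaled sums of products. -/
lemma vanishesInProb_mul_sum_mul_sub {ι : Type*} [Fintype ι] {r : ℕ → ℝ} {φ : ℝ}
    (hr : Tendsto r atTop (𝓝 φ)) {z x p : ℕ → Ω → ι → ℝ} {M : ι → ℝ}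
    (hz : ∀ j, VanishesInProb μ fun n ω => z n ω j - M j)
    (hx : ∀ j, VanishesInProb μ fun n ω => x n ω j - p n ω j)
    (hp : ∀ j, BoundedInProb μ fun n ω => p n ω j) :
    VanishesInProb μ fun n ω => r n * ∑ j, z n ω j * x n ω j - φ * ∑ j, M j * p n ω j := by
  have hzx : ∀ j, VanishesInProb μ fun n ω => z n ω j * x n ω j - M j * p n ω j := fun j =>
    (((hx j).mul_bounded (.of_sub_const (hz j))).add ((hz j).mul_bounded (hp j))).congr
      fun n ω => by ring
  have hS := VanishesInProb.sum Finset.univ fun j _ => hzx j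
  have hB : BoundedInProb μ fun n ω => ∑ j, M j * p n ω j :=
    BoundedInProb.sum Finset.univ fun j _ => (boundedInProb_const (M j)).mul (hp j)
  have hr0 : VanishesInProb μ fun n (_ : Ω) => r n - φ :=
    .of_tendsto_const (by simpa using hr.sub_const φ)
  refine (((BoundedInProb.of_tendsto_const (μ := μ) hr).mul_vanishes hS).add
    (hr0.mul_bounded hB)).congr fun n ω => ?_
  rw [Finset.sum_sub_distrib]
  ring

end Averages

/-! ### Conditional distribution function of the subsampled statistic -/

section BootstrapLaw

variable {ι Ω Ω' : Type*} [Fintype ι] [MeasurableSpace Ω] [MeasurableSpace Ω'] {μ : Measure Ω}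
  [IsProbabilityMeasure μ] {μ' : Measure Ω'} [IsProbabilityMeasure μ']
  {w₀ : ι → ℝ} {ξ : ℕ → ℕ → Ω → ℝ × (ι → ℝ) × ℝ} {T : ℕ → ℕ}

/-- Uniform approximation of normal distribution functions with estimated location and scale. -/
lemma vanishesInProb_stdNormalCDF_sub {C u s : ℕ → Ω → ℝ} {σ : ℝ} (hσ : 0 < σ) (y : ℝ)
    (hC : VanishesInProb μ fun n ω => C n ω - u n ω) (hu : BoundedInProb μ u)
    (hs : VanishesInProb μ fun n ω => s n ω - σ) :
    VanishesInProb μ fun n ω =>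
      stdNormalCDF ((y - C n ω) / s n ω) - stdNormalCDF ((y - u n ω) / σ) := by
  have hinv : VanishesInProb μ fun n ω => (s n ω)⁻¹ - σ⁻¹ :=
    hs.comp_continuousAt (continuousAt_inv₀ hσ.ne')
  have hyu : BoundedInProb μ fun n ω => y - u n ω :=
    ((boundedInProb_const y).add ((boundedInProb_const (-1)).mul hu)).congr fun _ _ => by ring
  -- The arguments differ by (y - u)(1/s - 1/σ) - (C - u)/s.
  refine ((hyu.mul_vanishes hinv).sub (hC.mul_bounded (.of_sub_const hinv))).of_abs_le
    (.of_forall fun n => .of_forall fun ω => (abs_stdNormalCDF_sub_le _ _).trans_eq ?_)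
  congr 1
  rw [div_eq_mul_inv, div_eq_mul_inv]
  ring

/-- Convergence of the conditional distribution function of the subsampled statistic. -/
theorem IsRegressionArray.vanishesInProb_average_stdNormalCDF_sub (hξ : IsRegressionArray μ T ξ)
    {m : ℕ → ℕ} (hm : Tendsto m atTop atTop)
    (hmn : Tendsto (fun n : ℕ => (m n : ℝ) / n) atTop (𝓝 0))
    {Z : Ω' → ι → ℝ} (hZ : TendstoInDistribution (fun n => blockScore w₀ ξ n n 0) atTop Z
      (fun _ => μ) μ') {u : (ι → ℝ) → ℝ} (hu : Continuous u) {σ : ℝ} (hσ : 0 < σ)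
    {s : ℕ → Ω → ℝ} (hsm : ∀ n, Measurable (s n)) (hs : VanishesInProb μ fun n ω => s n ω - σ)
    {C : ℕ → ℕ → Ω → ℝ} (hCm : ∀ n b, Measurable (C n b))
    (hC : ∀ b : ℕ → ℕ, (∀ n, b n ≤ n - m n) → VanishesInProb μ fun n ω =>
      C n (b n) ω - u (blockScore w₀ ξ n (m n) (b n) ω)) (y : ℝ) :
    VanishesInProb μ fun n ω => ((n - m n + 1 : ℕ) : ℝ)⁻¹ *
      ∑ b ∈ Finset.range (n - m n + 1), stdNormalCDF ((y - C n b ω) / s n ω) -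
        ∫ ω', stdNormalCDF ((y - u (Z ω')) / σ) ∂μ' := by
  have hmle : ∀ᶠ n in atTop, m n ≤ n := by
    filter_upwards [hmn.eventually_lt_const one_pos, eventually_gt_atTop 0] with n h1 h2
    have : (0 : ℝ) < n := by exact_mod_cast h2
    rw [div_lt_one this] at h1
    exact_mod_cast h1.le
  have hΦ : Measurable stdNormalCDF := continuous_stdNormalCDF.measurable
  set h : (ι → ℝ) → ℝ := fun x => stdNormalCDF ((y - u x) / σ) with hh
  have hhc : Continuous h := continuous_stdNormalCDF.comp (by fun_prop)
  -- Three replacements: the statistic of each block by u of its score (`hav`), the average over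
  -- blocks by an expectation (`hd`), and that expectation by its limit (`hlim`).
  have hd := hξ.vanishesInProb_average_blockScore_sub (w₀ := w₀) hmn hhc.measurable
    (fun _ => stdNormalCDF_nonneg _) (fun _ => stdNormalCDF_le_one _)
  have hav : VanishesInProb μ fun n ω => ((n - m n + 1 : ℕ) : ℝ)⁻¹ *
      ∑ b ∈ Finset.range (n - m n + 1), (stdNormalCDF ((y - C n b ω) / s n ω) -
        h (blockScore w₀ ξ n (m n) b ω)) := by
    refine VanishesInProb.average_of_forall_sequence (K := fun n => n - m n) (C := 1)
      (H := fun n b ω => stdNormalCDF ((y - C n b ω) / s n ω) -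
        h (blockScore w₀ ξ n (m n) b ω)) (fun n b => ?_) (fun n b ω => ?_) fun b hb => ?_
    · exact (hΦ.comp (((hCm n b).const_sub y).div (hsm n))).sub
        (hhc.measurable.comp (hξ.measurable_blockScore n (m n) b))
    · rw [abs_le]
      constructor <;> linarith [stdNormalCDF_nonneg ((y - C n b ω) / s n ω),
        stdNormalCDF_le_one ((y - C n b ω) / s n ω),
        stdNormalCDF_nonneg ((y - u (blockScore w₀ ξ n (m n) b ω)) / σ),
        stdNormalCDF_le_one ((y - u (blockScore w₀ ξ n (m n) b ω)) / σ)]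
    · refine vanishesInProb_stdNormalCDF_sub hσ y (hC b hb) ?_ hs
      have h1 : BoundedInProb μ fun n ω => u (blockScore w₀ ξ n n 0 ω) :=
        (hZ.continuous_comp hu).boundedInProb
      -- Tightness of the full scores along the lengths m n passes to the blocks, since it depends
      -- on laws only.
      refine (h1.comp_tendsto hm).of_identDistrib ?_
      filter_upwards [hmle] with n hn
      exact (hξ.identDistrib_blockScore (by have := hb n; omega)).comp hu.measurable
  have hlim : Tendsto (fun n => ∫ ω, h (blockScore w₀ ξ (m n) (m n) 0 ω) ∂μ) atTop
      (𝓝 (∫ ω', h (Z ω') ∂μ')) := by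
    have hb : ∀ x y : ι → ℝ, dist (h x) (h y) ≤ 1 := by
      intro x y'
      rw [Real.dist_eq, abs_le]
      constructor <;> linarith [stdNormalCDF_nonneg ((y - u x) / σ),
        stdNormalCDF_le_one ((y - u x) / σ), stdNormalCDF_nonneg ((y - u y') / σ),
        stdNormalCDF_le_one ((y - u y') / σ)]
    have h1 := ProbabilityMeasure.tendsto_iff_forall_integral_tendsto.mp hZ.tendsto
      (BoundedContinuousFunction.mkOfBound ⟨h, hhc⟩ 1 hb)
    simp only [ProbabilityMeasure.coe_mk, BoundedContinuousFunction.mkOfBound_coe,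
      ContinuousMap.coe_mk] at h1
    rw [integral_map hZ.aemeasurable_limit hhc.aestronglyMeasurable] at h1
    refine (h1.comp hm).congr fun n => ?_
    simp only [Function.comp_apply]
    rw [integral_map (hZ.forall_aemeasurable _) hhc.aestronglyMeasurable]
  refine ((hav.add hd).add (.of_tendsto_const (c := fun n =>
    ∫ ω, h (blockScore w₀ ξ (m n) (m n) 0 ω) ∂μ - ∫ ω', h (Z ω') ∂μ')
    (by simpa using hlim.sub_const (∫ ω', h (Z ω') ∂μ')))).congr fun n ω => ?_
  rw [Finset.sum_sub_distrib]
  ring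

end BootstrapLaw

/-! ### Post-treatment averages, asymptotic independence of past and future -/

section PostTreatment

open Matrix

variable {ι Ω : Type*} [Fintype ι] [MeasurableSpace Ω] {μ : Measure Ω} [IsProbabilityMeasure μ]
  {w₀ : ι → ℝ} {ξ : ℕ → ℕ → Ω → ℝ × (ι → ℝ) × ℝ} {T : ℕ → ℕ}

namespace IsRegressionArray

variable (hξ : IsRegressionArray μ T ξ) (hT : Tendsto T atTop atTop)
include hξ hT

/-- The window moves with the row but its law does not. The first post-treatment period of any row
n₀ that has one represents the common law. -/
lemma vanishesInProb_post_average_sub {n₀ : ℕ} (hn₀ : 0 < T n₀) {f : ℝ × (ι → ℝ) × ℝ → ℝ}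
    (hf : Measurable f) (hfi : Integrable (fun ω => f (ξ n₀ (n₀ + 1) ω)) μ) :
    VanishesInProb μ fun n ω => (T n : ℝ)⁻¹ * ∑ t ∈ Finset.Ioc n (n + T n), f (ξ n t ω) -
      ∫ ω, f (ξ n₀ (n₀ + 1) ω) ∂μ := by
  have hm := (hξ.measurable n₀ (n₀ + 1)).aemeasurable (μ := μ)
  have key := hξ.mixing.vanishesInProb_average_sub hξ.measurable hf
    ((integrable_map_measure hf.aestronglyMeasurable hm).mpr hfi) (i := fun n => n)
    (s := fun n => n + 1) hT (.of_forall fun n r hr => ⟨by omega, by omega⟩)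
    (.of_forall fun n r hr => hξ.stationary_post.map_eq ⟨by omega, by omega⟩
      ⟨by omega, by omega⟩)
  rw [integral_map hm hf.aestronglyMeasurable] at key
  exact key.congr fun n ω => by rw [sum_Ioc_eq_sum_range]

/-- Functions of the pre-treatment data are asymptotically independent of normalized sums over
the post-treatment period. -/
theorem tendsto_integral_mul_sub_past_post {n₀ : ℕ} (hn₀ : 0 < T n₀) {U : ℕ → Ω → ℝ}
    (hU : ∀ n, Measurable[pastAlgebra (Set.Icc 1 (n + T n)) (ξ n) n] (U n))
    {p : ℝ × (ι → ℝ) × ℝ → ℝ} (hp : Measurable p)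
    (hpi : Integrable (fun ω => p (ξ n₀ (n₀ + 1) ω)) μ) {f h : ℝ → ℝ} {K : NNReal}
    (hf : Continuous f) (hh : LipschitzWith K h) (hf1 : ∀ x, |f x| ≤ 1) (hh1 : ∀ x, |h x| ≤ 1) :
    Tendsto (fun n =>
      ∫ ω, f (U n ω) * h ((√(T n : ℝ))⁻¹ * ∑ t ∈ Finset.Ioc n (n + T n), p (ξ n t ω)) ∂μ -
        (∫ ω, f (U n ω) ∂μ) *
          ∫ ω, h ((√(T n : ℝ))⁻¹ * ∑ t ∈ Finset.Ioc n (n + T n), p (ξ n t ω)) ∂μ)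
      atTop (𝓝 0) := by
  obtain ⟨a, ha, hcov⟩ := hξ.mixing.exists_covariance_le hξ.measurable
  set B := ∫ ω, |p (ξ n₀ (n₀ + 1) ω)| ∂μ with hB
  have hid : ∀ n, ∀ t ∈ Finset.Ioc n (n + T n), IdentDistrib (fun ω => p (ξ n₀ (n₀ + 1) ω))
      (fun ω => p (ξ n t ω)) μ μ := fun n t ht =>
    (hξ.stationary_post.identDistrib ⟨by omega, by omega⟩ (by simpa using ht)).comp hp
  have hint : ∀ n, ∀ t ∈ Finset.Ioc n (n + T n), Integrable (fun ω => p (ξ n t ω)) μ :=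
    fun n t ht => (hid n t ht).integrable_iff.mp hpi
  have hEB : ∀ n, ∀ t ∈ Finset.Ioc n (n + T n), ∫ ω, |p (ξ n t ω)| ∂μ = B := fun n t ht =>
    ((hid n t ht).comp measurable_abs).integral_eq.symm
  set V : ℕ → Ω → ℝ := fun n ω =>
    (√(T n : ℝ))⁻¹ * ∑ t ∈ Finset.Ioc n (n + T n), p (ξ n t ω) with hV
  -- The post-treatment sum without the terms before n + g, which leaves a gap after the
  -- pre-treatment data.
  set W : ℕ → ℕ → Ω → ℝ := fun g n ω =>
    (√(T n : ℝ))⁻¹ * ∑ t ∈ (Finset.Ioc n (n + T n)).filter (n + g ≤ ·), p (ξ n t ω) with hW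
  have hpm : ∀ n t, Measurable fun ω => p (ξ n t ω) := fun n t => hp.comp (hξ.measurable n t)
  have hVm : ∀ n, Measurable (V n) := fun n =>
    (Finset.measurable_sum _ fun t _ => hpm n t).const_mul _
  have hWm : ∀ g n, Measurable (W g n) := fun g n =>
    (Finset.measurable_sum _ fun t _ => hpm n t).const_mul _
  have hUm : ∀ n, Measurable (U n) := fun n =>
    (hU n).mono (pastAlgebra_le (hξ.measurable n) n) le_rfl
  have hVi : ∀ n, Integrable (V n) μ := fun n =>
    (integrable_finsetSum _ fun t ht => hint n t ht).const_mul _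
  have hWi : ∀ g n, Integrable (W g n) μ := fun g n =>
    (integrable_finsetSum _ fun t ht => hint n t (Finset.mem_of_mem_filter t ht)).const_mul _
  have hB0 : 0 ≤ B := integral_nonneg fun _ => abs_nonneg _
  have hVW : ∀ g n, ∫ ω, |V n ω - W g n ω| ∂μ ≤ (√(T n : ℝ))⁻¹ * (g * B) := by
    intro g n
    set J := (Finset.Ioc n (n + T n)).filter fun t => ¬ n + g ≤ t with hJ
    have hJc : J.card ≤ g := by
      have : J ⊆ Finset.Ico n (n + g) := by
        intro t ht
        simp only [hJ, Finset.mem_filter, Finset.mem_Ioc, Finset.mem_Ico] at ht ⊢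
        omega
      simpa using Finset.card_le_card this
    have hdiff : ∀ ω, V n ω - W g n ω = (√(T n : ℝ))⁻¹ * ∑ t ∈ J, p (ξ n t ω) := by
      intro ω
      simp only [hV, hW, hJ]
      rw [← Finset.sum_filter_add_sum_filter_not (Finset.Ioc n (n + T n)) (n + g ≤ ·)]
      ring
    have hJi : ∀ t ∈ J, Integrable (fun ω => |p (ξ n t ω)|) μ := fun t ht =>
      (hint n t (Finset.mem_of_mem_filter t ht)).abs
    calc ∫ ω, |V n ω - W g n ω| ∂μ
        ≤ ∫ ω, (√(T n : ℝ))⁻¹ * ∑ t ∈ J, |p (ξ n t ω)| ∂μ := by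
          refine integral_mono ((hVi n).sub (hWi g n)).abs
            ((integrable_finsetSum _ hJi).const_mul _) fun ω => ?_
          dsimp only
          rw [hdiff, abs_mul, abs_of_nonneg (by positivity : 0 ≤ (√(T n : ℝ))⁻¹)]
          gcongr
          exact Finset.abs_sum_le_sum_abs _ _
      _ = (√(T n : ℝ))⁻¹ * (J.card * B) := by
          rw [integral_const_mul, integral_finsetSum _ hJi,
            Finset.sum_congr rfl fun t ht => hEB n t (Finset.mem_of_mem_filter t ht),
            Finset.sum_const, nsmul_eq_mul]
      _ ≤ _ := by gcongr
  have hfi : ∀ n, Measurable fun ω => f (U n ω) := fun n => hf.measurable.comp (hUm n)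
  have hbd : ∀ {X : Ω → ℝ}, Measurable X → (∀ ω, |X ω| ≤ 1) → Integrable X μ := fun hX h1 =>
    Integrable.of_bound hX.aestronglyMeasurable 1 (.of_forall h1)
  have hhm := hh.continuous.measurable
  have hmul1 : ∀ x y : ℝ, |x| ≤ 1 → |y| ≤ 1 → |x * y| ≤ 1 := fun x y hx hy => by
    rw [abs_mul]; exact mul_le_one₀ hx (abs_nonneg _) hy
  -- Replacing V by W costs the Lipschitz constant times their L¹ distance twice, in the joint
  -- integral and in the product of integrals. The covariance with W is bounded by mixing at gap g.
  have key : ∀ g n, |∫ ω, f (U n ω) * h (V n ω) ∂μ - (∫ ω, f (U n ω) ∂μ) * ∫ ω, h (V n ω) ∂μ| ≤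
      2 * (K * ((√(T n : ℝ))⁻¹ * (g * B))) + 4 * |a g| := by
    intro g n
    have hLip : ∀ ω, |h (V n ω) - h (W g n ω)| ≤ K * |V n ω - W g n ω| := fun ω => by
      simpa [Real.dist_eq] using hh.dist_le_mul (V n ω) (W g n ω)
    have iV : Integrable (fun ω => h (V n ω)) μ := hbd (hhm.comp (hVm n)) fun ω => hh1 _
    have iW : Integrable (fun ω => h (W g n ω)) μ := hbd (hhm.comp (hWm g n)) fun ω => hh1 _
    have iF := hbd (hfi n) fun ω => hf1 _
    have iFV : Integrable (fun ω => f (U n ω) * h (V n ω)) μ :=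
      hbd ((hfi n).mul (hhm.comp (hVm n))) fun ω => hmul1 _ _ (hf1 _) (hh1 _)
    have iFW : Integrable (fun ω => f (U n ω) * h (W g n ω)) μ :=
      hbd ((hfi n).mul (hhm.comp (hWm g n))) fun ω => hmul1 _ _ (hf1 _) (hh1 _)
    have iD : Integrable (fun ω => K * |V n ω - W g n ω|) μ :=
      ((hVi n).sub (hWi g n)).abs.const_mul _
    have hD : ∫ ω, K * |V n ω - W g n ω| ∂μ ≤ K * ((√(T n : ℝ))⁻¹ * (g * B)) := by
      rw [integral_const_mul]
      exact mul_le_mul_of_nonneg_left (hVW g n) K.2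
    have e1 : |∫ ω, f (U n ω) * h (V n ω) ∂μ - ∫ ω, f (U n ω) * h (W g n ω) ∂μ| ≤
        ∫ ω, K * |V n ω - W g n ω| ∂μ := by
      rw [← integral_sub iFV iFW]
      refine (abs_integral_le_integral_abs).trans (integral_mono (iFV.sub iFW).abs iD fun ω => ?_)
      dsimp only [Pi.sub_apply]
      rw [← mul_sub, abs_mul]
      exact (mul_le_of_le_one_left (abs_nonneg _) (hf1 _)).trans (hLip ω)
    have e2 : |∫ ω, h (V n ω) ∂μ - ∫ ω, h (W g n ω) ∂μ| ≤ ∫ ω, K * |V n ω - W g n ω| ∂μ := by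
      rw [← integral_sub iV iW]
      exact (abs_integral_le_integral_abs).trans (integral_mono (iV.sub iW).abs iD hLip)
    have e3 : |∫ ω, f (U n ω) ∂μ| ≤ 1 := by
      refine (abs_integral_le_integral_abs).trans ?_
      simpa using integral_mono iF.abs (integrable_const (1 : ℝ)) fun ω => hf1 (U n ω)
    have e4 := hcov n n g (fun ω => f (U n ω)) (fun ω => h (W g n ω)) 1 one_pos
      (hf.measurable.comp (hU n))
      (hhm.comp (Measurable.const_mul (Finset.measurable_sum _ fun t ht => hp.comp
        (measurable_futureAlgebra (J := Set.Icc 1 (n + T n)) (by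
          have := Finset.mem_Ioc.mp (Finset.mem_of_mem_filter t ht)
          exact ⟨by omega, by omega⟩) (Finset.mem_filter.mp ht).2)) _))
      (fun ω => hf1 _) (fun ω => hh1 _)
    have e5 : |(∫ ω, f (U n ω) ∂μ) * (∫ ω, h (V n ω) ∂μ - ∫ ω, h (W g n ω) ∂μ)| ≤
        ∫ ω, K * |V n ω - W g n ω| ∂μ := by
      rw [abs_mul]
      exact (mul_le_of_le_one_left (abs_nonneg _) e3).trans e2
    have e6 := le_abs_self (a g)
    rw [mul_sub] at e5
    rw [abs_le] at e1 e4 e5 ⊢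
    obtain ⟨_, _⟩ := e1
    obtain ⟨_, _⟩ := e4
    obtain ⟨_, _⟩ := e5
    constructor <;> linarith
  rw [Metric.tendsto_nhds]
  intro ε hε
  have h4 : Tendsto (fun g => 4 * |a g|) atTop (𝓝 0) := by simpa using ha.abs.const_mul 4
  obtain ⟨g, hg⟩ := (h4.eventually_lt_const (half_pos hε)).exists
  have hT0 : Tendsto (fun n => 2 * (K * ((√(T n : ℝ))⁻¹ * (g * B)))) atTop (𝓝 0) := by
    have : Tendsto (fun n => (√(T n : ℝ))⁻¹) atTop (𝓝 0) :=
      (Real.tendsto_sqrt_atTop.comp (tendsto_natCast_atTop_atTop.comp hT)).inv_tendsto_atTop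
    simpa using ((this.mul_const (g * B)).const_mul (K : ℝ)).const_mul 2
  filter_upwards [hT0.eventually_lt_const (half_pos hε)] with n hn
  rw [Real.dist_eq, sub_zero]
  exact (key g n).trans_lt (by linarith)

/-- Consistency of the sample variance of the residuals for estimated weights. -/
theorem vanishesInProb_sampleVariance_sub {n₀ : ℕ} (hn₀ : 0 < T n₀) {W : ℕ → Ω → ι → ℝ}
    (hW : ∀ j, VanishesInProb μ fun n ω => W n ω j - w₀ j) :
    VanishesInProb μ fun n ω => (T n : ℝ)⁻¹ * ∑ t ∈ Finset.Ioc n (n + T n),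
      (modelError (W n ω) (ξ n t ω) -
        (T n : ℝ)⁻¹ * ∑ s ∈ Finset.Ioc n (n + T n), modelError (W n ω) (ξ n s ω)) ^ 2 -
      (∫ ω, modelError w₀ (ξ n₀ (n₀ + 1) ω) ^ 2 ∂μ -
        (∫ ω, modelError w₀ (ξ n₀ (n₀ + 1) ω) ∂μ) ^ 2) := by
  have hL : MemLp (ξ n₀ (n₀ + 1)) 2 μ := hξ.memLp _ _ (Finset.mem_Icc.mpr ⟨by omega, by omega⟩)
  have hLe := hL.modelError w₀
  have hLz := fun j => hL.control j
  have hme := measurable_modelError w₀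
  set av : ((ℝ × (ι → ℝ) × ℝ) → ℝ) → ℕ → Ω → ℝ := fun f n ω =>
    (T n : ℝ)⁻¹ * ∑ t ∈ Finset.Ioc n (n + T n), f (ξ n t ω) with hav
  have vE2 : VanishesInProb μ fun n ω => av (fun x => modelError w₀ x ^ 2) n ω - _ :=
    hξ.vanishesInProb_post_average_sub hT hn₀ (f := fun x => modelError w₀ x ^ 2)
      (hme.pow_const 2) hLe.integrable_sq
  have vE : VanishesInProb μ fun n ω => av (modelError w₀) n ω - _ :=
    hξ.vanishesInProb_post_average_sub hT hn₀ hme (hLe.integrable one_le_two)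
  have vEz : ∀ j, BoundedInProb μ (av fun x => modelError w₀ x * x.2.1 j) := fun j =>
    .of_sub_const (hξ.vanishesInProb_post_average_sub hT hn₀
      (f := fun x => modelError w₀ x * x.2.1 j) (by fun_prop) (hLe.integrable_mul (hLz j)))
  have vzz : ∀ i j, BoundedInProb μ (av fun x => x.2.1 i * x.2.1 j) := fun i j =>
    .of_sub_const (hξ.vanishesInProb_post_average_sub hT hn₀
      (f := fun x => x.2.1 i * x.2.1 j) (by fun_prop) ((hLz i).integrable_mul (hLz j)))
  have vz : ∀ j, BoundedInProb μ (av fun x => x.2.1 j) := fun j =>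
    .of_sub_const (hξ.vanishesInProb_post_average_sub hT hn₀
      (f := fun x => x.2.1 j) (by fun_prop) ((hLz j).integrable one_le_two))
  -- Residuals at the estimated weights are expanded in W - w₀. Every correction is a vanishing
  -- weight error times an average bounded in probability.
  have hmean : VanishesInProb μ fun n ω => (av (modelError w₀) n ω -
      ∑ j, (W n ω j - w₀ j) * av (fun x => x.2.1 j) n ω) -
        ∫ ω, modelError w₀ (ξ n₀ (n₀ + 1) ω) ∂μ :=
    (vE.sub (VanishesInProb.sum Finset.univ fun j _ => (hW j).mul_bounded (vz j))).congr
      fun n ω => by ring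
  have hsecond : VanishesInProb μ fun n ω => (av (fun x => modelError w₀ x ^ 2) n ω -
      2 * ∑ j, (W n ω j - w₀ j) * av (fun x => modelError w₀ x * x.2.1 j) n ω +
      ∑ i, ∑ j, (W n ω i - w₀ i) * ((W n ω j - w₀ j) * av (fun x => x.2.1 i * x.2.1 j) n ω)) -
        ∫ ω, modelError w₀ (ξ n₀ (n₀ + 1) ω) ^ 2 ∂μ :=
    ((vE2.sub ((VanishesInProb.sum Finset.univ fun j _ =>
      (hW j).mul_bounded (vEz j)).const_mul 2)).add
      (VanishesInProb.sum Finset.univ fun i _ => VanishesInProb.sum Finset.univ fun j _ =>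
        (hW i).mul_bounded (((hW j).mul_bounded (vzz i j)).boundedInProb))).congr
      fun n ω => by ring
  refine (hsecond.sub (hmean.mul_sub_mul hmean)).congr' ?_
  filter_upwards [hT.eventually_gt_atTop 0] with n hn
  refine .of_forall fun ω => ?_
  have hTn : (T n : ℝ) ≠ 0 := by positivity
  have hsplit : ∀ x : ℝ × (ι → ℝ) × ℝ, modelError (W n ω) x =
      modelError w₀ x - ∑ j, (W n ω j - w₀ j) * x.2.1 j := by
    intro x
    simp only [modelError, dotProduct, sub_mul, Finset.sum_sub_distrib]
    ring
  have hm1 : (T n : ℝ)⁻¹ * ∑ s ∈ Finset.Ioc n (n + T n), modelError (W n ω) (ξ n s ω) =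
      av (modelError w₀) n ω - ∑ j, (W n ω j - w₀ j) * av (fun x => x.2.1 j) n ω := by
    simp only [hsplit, hav, Finset.sum_sub_distrib, mul_sub]
    congr 1
    rw [Finset.sum_comm, Finset.mul_sum]
    refine Finset.sum_congr rfl fun j _ => ?_
    rw [← Finset.mul_sum]
    ring
  have hm2 : (T n : ℝ)⁻¹ * ∑ s ∈ Finset.Ioc n (n + T n), modelError (W n ω) (ξ n s ω) ^ 2 =
      av (fun x => modelError w₀ x ^ 2) n ω -
      2 * ∑ j, (W n ω j - w₀ j) * av (fun x => modelError w₀ x * x.2.1 j) n ω +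
      ∑ i, ∑ j, (W n ω i - w₀ i) * ((W n ω j - w₀ j) * av (fun x => x.2.1 i * x.2.1 j) n ω) := by
    have hsq : ∀ x : ℝ × (ι → ℝ) × ℝ, modelError (W n ω) x ^ 2 = modelError w₀ x ^ 2 -
        2 * ∑ j, (W n ω j - w₀ j) * (modelError w₀ x * x.2.1 j) +
        ∑ i, ∑ j, (W n ω i - w₀ i) * ((W n ω j - w₀ j) * (x.2.1 i * x.2.1 j)) := by
      intro x
      have e1 : ∑ j, (W n ω j - w₀ j) * (modelError w₀ x * x.2.1 j) =
          modelError w₀ x * ∑ j, (W n ω j - w₀ j) * x.2.1 j := by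
        rw [Finset.mul_sum]
        exact Finset.sum_congr rfl fun j _ => by ring
      have e2 : ∑ i, ∑ j, (W n ω i - w₀ i) * ((W n ω j - w₀ j) * (x.2.1 i * x.2.1 j)) =
          (∑ i, (W n ω i - w₀ i) * x.2.1 i) * ∑ j, (W n ω j - w₀ j) * x.2.1 j := by
        rw [Finset.sum_mul_sum]
        exact Finset.sum_congr rfl fun i _ => Finset.sum_congr rfl fun j _ => by ring
      rw [hsplit, e1, e2]
      ring
    simp only [hsq, hav, Finset.sum_sub_distrib, Finset.sum_add_distrib, mul_add, mul_sub]
    congr 1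
    · congr 1
      rw [← Finset.mul_sum, Finset.sum_comm, mul_left_comm, Finset.mul_sum]
      congr 1
      refine Finset.sum_congr rfl fun j _ => ?_
      rw [← Finset.mul_sum]
      ring
    · rw [Finset.sum_comm, Finset.mul_sum]
      refine Finset.sum_congr rfl fun i _ => ?_
      rw [Finset.sum_comm, Finset.mul_sum]
      refine Finset.sum_congr rfl fun j _ => ?_
      rw [← Finset.mul_sum, ← Finset.mul_sum]
      ring
  rw [← hm1, ← hm2]
  set e := (T n : ℝ)⁻¹ * ∑ s ∈ Finset.Ioc n (n + T n), modelError (W n ω) (ξ n s ω) with he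
  -- Sample variance as the mean of squares minus the square of the mean; this needs T n to be
  -- nonzero.
  have hvar : (T n : ℝ)⁻¹ * ∑ t ∈ Finset.Ioc n (n + T n), (modelError (W n ω) (ξ n t ω) - e) ^ 2 =
      (T n : ℝ)⁻¹ * (∑ t ∈ Finset.Ioc n (n + T n), modelError (W n ω) (ξ n t ω) ^ 2) - e * e := by
    simp only [sub_sq, Finset.sum_add_distrib, Finset.sum_sub_distrib]
    rw [← Finset.sum_mul, ← Finset.mul_sum, Finset.sum_const, Nat.card_Ioc,
      Nat.add_sub_cancel_left, nsmul_eq_mul]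
    have : ∑ s ∈ Finset.Ioc n (n + T n), modelError (W n ω) (ξ n s ω) = T n * e := by
      rw [he, mul_inv_cancel_left₀ hTn]
    rw [this]
    field_simp
    ring
  rw [hvar]
  ring

end IsRegressionArray

end PostTreatment

/-! ### Limit law of the estimator and validity of the subsampling interval -/

section SubsamplingBootstrap

variable {ι Ω Ω' : Type*} [Fintype ι] [MeasurableSpace Ω] [MeasurableSpace Ω'] {μ : Measure Ω}
  [IsProbabilityMeasure μ] {μ' : Measure Ω'} [IsProbabilityMeasure μ']
  {w₀ : ι → ℝ} {ξ : ℕ → ℕ → Ω → ℝ × (ι → ℝ) × ℝ} {T m : ℕ → ℕ}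

/-- Average of the controls over the times `n + 1, …, n + T n`. -/
noncomputable def controlMean (T : ℕ → ℕ) (ξ : ℕ → ℕ → Ω → ℝ × (ι → ℝ) × ℝ) (n : ℕ) (ω : Ω)
    (j : ι) : ℝ :=
  (T n : ℝ)⁻¹ * ∑ t ∈ Finset.Ioc n (n + T n), (ξ n t ω).2.1 j

/-- Average of the residuals for the weights `W n ω` over the times `n + 1, …, n + T n`. -/
noncomputable def residualMean (T : ℕ → ℕ) (ξ : ℕ → ℕ → Ω → ℝ × (ι → ℝ) × ℝ) (W : ℕ → Ω → ι → ℝ)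
    (n : ℕ) (ω : Ω) : ℝ :=
  (T n : ℝ)⁻¹ * ∑ t ∈ Finset.Ioc n (n + T n), modelError (W n ω) (ξ n t ω)

/-- Sample variance of the residuals for the weights `W n ω` over the times
`n + 1, …, n + T n`. -/
noncomputable def residualVariance (T : ℕ → ℕ) (ξ : ℕ → ℕ → Ω → ℝ × (ι → ℝ) × ℝ)
    (W : ℕ → Ω → ι → ℝ) (n : ℕ) (ω : Ω) : ℝ :=
  (T n : ℝ)⁻¹ * ∑ t ∈ Finset.Ioc n (n + T n),
    (modelError (W n ω) (ξ n t ω) - residualMean T ξ W n ω) ^ 2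

/-- Part of the subsampling statistic that comes from the weights. -/
noncomputable def subsampleShift (T m : ℕ → ℕ) (ξ : ℕ → ℕ → Ω → ℝ × (ι → ℝ) × ℝ)
    (W : ℕ → Ω → ι → ℝ) (Wb : ℕ → ℕ → Ω → ι → ℝ) (n b : ℕ) (ω : Ω) : ℝ :=
  -√((T n : ℝ) / n) * ∑ j, controlMean T ξ n ω j * (√(m n : ℝ) * (Wb n b ω j - W n ω j))

lemma measurable_modelError_comp {w : Ω → ι → ℝ} (hw : Measurable w)
    {X : Ω → ℝ × (ι → ℝ) × ℝ} (hX : Measurable X) : Measurable fun ω => modelError (w ω) (X ω) := by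
  unfold modelError dotProduct
  fun_prop

variable {W : ℕ → Ω → ι → ℝ} {Wb : ℕ → ℕ → Ω → ι → ℝ}

omit [Fintype ι] in
lemma measurable_controlMean (hξ : ∀ n t, Measurable (ξ n t)) (n : ℕ) (j : ι) :
    Measurable fun ω => controlMean T ξ n ω j := by
  unfold controlMean
  fun_prop

lemma measurable_residualMean (hξ : ∀ n t, Measurable (ξ n t)) (hW : ∀ n, Measurable (W n))
    (n : ℕ) : Measurable (residualMean T ξ W n) :=
  (Finset.measurable_sum _ fun t _ => measurable_modelError_comp (hW n) (hξ n t)).const_mul _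

lemma measurable_residualVariance (hξ : ∀ n t, Measurable (ξ n t)) (hW : ∀ n, Measurable (W n))
    (n : ℕ) : Measurable (residualVariance T ξ W n) :=
  (Finset.measurable_sum _ fun t _ => ((measurable_modelError_comp (hW n) (hξ n t)).sub
    (measurable_residualMean hξ hW n)).pow_const 2).const_mul _

lemma measurable_subsampleShift (hξ : ∀ n t, Measurable (ξ n t)) (hW : ∀ n, Measurable (W n))
    (hWb : ∀ n b, Measurable (Wb n b)) (n b : ℕ) : Measurable (subsampleShift T m ξ W Wb n b) := by
  refine Measurable.const_mul (Finset.measurable_sum _ fun j _ =>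
    (measurable_controlMean hξ n j).mul (Measurable.const_mul ?_ _)) _
  exact ((measurable_pi_apply j).comp (hWb n b)).sub ((measurable_pi_apply j).comp (hW n))

/-- Limit of the contribution of the weights, as a function of the limit of the score. -/
noncomputable def weightEffect (φ : ℝ) (M : ι → ℝ) (P : (ι → ℝ) → ι → ℝ) (s : ι → ℝ) : ℝ :=
  -(φ * ∑ j, M j * P s j)

lemma continuous_weightEffect {φ : ℝ} {M : ι → ℝ} {P : (ι → ℝ) → ι → ℝ} (hP : Continuous P) :
    Continuous (weightEffect φ M P) := by
  unfold weightEffect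
  fun_prop

namespace IsRegressionArray

variable (hξ : IsRegressionArray μ T ξ) (hT : Tendsto T atTop atTop) {φ : ℝ}
  (hφ : Tendsto (fun n : ℕ => √((T n : ℝ) / n)) atTop (𝓝 φ)) {n₀ : ℕ} (hn₀ : 0 < T n₀)
  {P : (ι → ℝ) → ι → ℝ} (hP : Continuous P) {Z : Ω' → ι → ℝ}
  (hZ : TendstoInDistribution (fun n => blockScore w₀ ξ n n 0) atTop Z (fun _ => μ) μ')
  (hWm : ∀ n, Measurable (W n))
  (hW : ∀ j, VanishesInProb μ fun n ω =>
    √(n : ℝ) * (W n ω j - w₀ j) - P (blockScore w₀ ξ n n 0 ω) j)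

include hP hZ in
lemma boundedInProb_comp_blockScore (j : ι) :
    BoundedInProb μ fun n ω => P (blockScore w₀ ξ n n 0 ω) j :=
  (hZ.continuous_comp ((continuous_apply j).comp hP)).boundedInProb

include hP hZ hW in
lemma boundedInProb_sqrt_mul_weight_sub (j : ι) :
    BoundedInProb μ fun n ω => √(n : ℝ) * (W n ω j - w₀ j) := by
  have h1 : BoundedInProb μ fun n ω =>
      √(n : ℝ) * (W n ω j - w₀ j) - P (blockScore w₀ ξ n n 0 ω) j := (hW j).boundedInProb
  exact (h1.add (boundedInProb_comp_blockScore hP hZ j)).congr fun n ω => by ring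

include hP hZ hW in
lemma vanishesInProb_weight_sub (j : ι) : VanishesInProb μ fun n ω => W n ω j - w₀ j := by
  have h1 : VanishesInProb μ fun n (_ : Ω) => (√(n : ℝ))⁻¹ := .of_tendsto_const
    (Real.tendsto_sqrt_atTop.comp tendsto_natCast_atTop_atTop).inv_tendsto_atTop
  refine (h1.mul_bounded (boundedInProb_sqrt_mul_weight_sub hP hZ hW j)).congr' ?_
  filter_upwards [eventually_gt_atTop 0] with n hn
  have : √(n : ℝ) ≠ 0 := (Real.sqrt_pos.mpr (by exact_mod_cast hn)).ne'
  exact .of_forall fun ω => by rw [inv_mul_cancel_left₀ this]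

include hξ hT hn₀ in
lemma vanishesInProb_controlMean_sub (j : ι) : VanishesInProb μ fun n ω =>
    controlMean T ξ n ω j - ∫ ω, (ξ n₀ (n₀ + 1) ω).2.1 j ∂μ :=
  hξ.vanishesInProb_post_average_sub hT hn₀ (f := fun x => x.2.1 j) (by fun_prop)
    (((hξ.memLp n₀ (n₀ + 1) (Finset.mem_Icc.mpr ⟨by omega, by omega⟩)).control j).integrable
      one_le_two)

variable {ate : ℝ} {v : NNReal} (hv : v ≠ 0)
  (hate : ∫ ω, modelError w₀ (ξ n₀ (n₀ + 1) ω) ∂μ = ate)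
  (hV : TendstoInDistribution (fun n ω => (√(T n : ℝ))⁻¹ *
    ∑ t ∈ Finset.Ioc n (n + T n), (modelError w₀ (ξ n t ω) - ate)) atTop id (fun _ => μ)
    (gaussianReal 0 v))

include hξ hT hφ hn₀ hP hZ hWm hW hv hV in
/-- Limit distribution of the normalized average residual. -/
theorem tendsto_measureReal_residualMean_le (x : ℝ) :
    Tendsto (fun n => μ.real {ω | √(T n : ℝ) * (residualMean T ξ W n ω - ate) ≤ x}) atTop
      (𝓝 (cdf (μ'.map (weightEffect φ (fun j => ∫ ω, (ξ n₀ (n₀ + 1) ω).2.1 j ∂μ) P ∘ Z) ∗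
        gaussianReal 0 v) x)) := by
  set M : ι → ℝ := fun j => ∫ ω, (ξ n₀ (n₀ + 1) ω).2.1 j ∂μ with hM
  set u := weightEffect φ M P with hu
  have huc : Continuous u := continuous_weightEffect hP
  have hU := hZ.continuous_comp huc
  have hν : IsProbabilityMeasure (μ'.map (u ∘ Z)) :=
    Measure.isProbabilityMeasure_map hU.aemeasurable_limit
  have hem := measurable_modelError w₀
  have hL : MemLp (ξ n₀ (n₀ + 1)) 2 μ := hξ.memLp _ _ (Finset.mem_Icc.mpr ⟨by omega, by omega⟩)
  -- The score lives on times up to n; this makes it eligible for asymptotic independence from the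
  -- post-treatment sum.
  have hpast : ∀ n, Measurable[pastAlgebra (Set.Icc 1 (n + T n)) (ξ n) n]
      (blockScore w₀ ξ n n 0) := fun n =>
    measurable_blockScore_of fun t ht => by
      rw [Finset.mem_Icc] at ht
      exact measurable_pastAlgebra ⟨by omega, by omega⟩ (by omega)
  have hid : IsProbabilityMeasure (μ'.map (u ∘ Z) ∗ (gaussianReal 0 v).map id) := by
    rw [Measure.map_id]; infer_instance
  have hsum := tendstoInDistribution_add_of_asymptotically_indep hU hV
    fun f h K hf hh hf1 hh1 => hξ.tendsto_integral_mul_sub_past_post hT hn₀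
      (U := fun n => u ∘ blockScore w₀ ξ n n 0) (fun n => huc.measurable.comp (hpast n))
      (hem.sub_const ate) (((hL.modelError w₀).integrable one_le_two).sub (integrable_const _))
      hf hh hf1 hh1
  simp only [Measure.map_id] at hsum
  refine tendsto_measureReal_le_of_tendstoInDistribution hsum (fun n =>
    (((measurable_residualMean hξ.measurable hWm n).sub_const ate).const_mul _).aemeasurable) ?_
    (conv_gaussianReal_singleton _ hv x)
  -- The normalized error is exactly the normalized sum of e_t - `ate` minus √(T/n) times the
  -- control means paired with √n(W - w₀). Only the second term is approximated.
  have key := vanishesInProb_mul_sum_mul_sub hφ (z := controlMean T ξ)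
    (x := fun n ω j => √(n : ℝ) * (W n ω j - w₀ j)) (p := fun n ω => P (blockScore w₀ ξ n n 0 ω))
    (M := M) (hξ.vanishesInProb_controlMean_sub hT hn₀) hW (boundedInProb_comp_blockScore hP hZ)
  refine key.neg.congr' ?_
  filter_upwards [hT.eventually_gt_atTop 0, eventually_gt_atTop 0] with n hTn hn
  refine .of_forall fun ω => ?_
  have hT0 : (0 : ℝ) < T n := by exact_mod_cast hTn
  have hn0 : (0 : ℝ) < n := by exact_mod_cast hn
  have hsT := Real.mul_self_sqrt hT0.le
  have hsT0 : √(T n : ℝ) ≠ 0 := (Real.sqrt_pos.mpr hT0).ne'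
  have hsn0 : √(n : ℝ) ≠ 0 := (Real.sqrt_pos.mpr hn0).ne'
  have hsplit : ∀ x : ℝ × (ι → ℝ) × ℝ, modelError (W n ω) x =
      modelError w₀ x - ∑ j, (W n ω j - w₀ j) * x.2.1 j := by
    intro x
    simp only [modelError, dotProduct, sub_mul, Finset.sum_sub_distrib]
    ring
  have e1 : residualMean T ξ W n ω = (T n : ℝ)⁻¹ * (∑ t ∈ Finset.Ioc n (n + T n),
      modelError w₀ (ξ n t ω)) - ∑ j, (W n ω j - w₀ j) * controlMean T ξ n ω j := by
    simp only [residualMean, controlMean, hsplit, Finset.sum_sub_distrib, mul_sub]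
    congr 1
    rw [Finset.sum_comm, Finset.mul_sum]
    refine Finset.sum_congr rfl fun j _ => ?_
    rw [← Finset.mul_sum]
    ring
  have e2 : √((T n : ℝ) / n) * ∑ j, controlMean T ξ n ω j * (√(n : ℝ) * (W n ω j - w₀ j)) =
      √(T n : ℝ) * ∑ j, (W n ω j - w₀ j) * controlMean T ξ n ω j := by
    rw [Real.sqrt_div hT0.le, Finset.mul_sum, Finset.mul_sum]
    refine Finset.sum_congr rfl fun j _ => ?_
    field_simp
  have e3 : √(T n : ℝ) * ((T n : ℝ)⁻¹ * ∑ t ∈ Finset.Ioc n (n + T n),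
      modelError w₀ (ξ n t ω)) - √(T n : ℝ) * ate =
      (√(T n : ℝ))⁻¹ * ∑ t ∈ Finset.Ioc n (n + T n), (modelError w₀ (ξ n t ω) - ate) := by
    rw [Finset.sum_sub_distrib, Finset.sum_const, Nat.card_Ioc, Nat.add_sub_cancel_left,
      nsmul_eq_mul, mul_sub, ← mul_assoc, ← mul_assoc]
    congr 1
    · rw [← div_eq_mul_inv, Real.sqrt_div_self]
    · rw [← div_eq_inv_mul, Real.div_sqrt]
  rw [e2, e1, ← e3]
  simp only [Function.comp_apply, hu, weightEffect]
  ring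

variable (hm : Tendsto m atTop atTop) (hmn : Tendsto (fun n : ℕ => (m n : ℝ) / n) atTop (𝓝 0))
  (hvar : ∫ ω, modelError w₀ (ξ n₀ (n₀ + 1) ω) ^ 2 ∂μ - ate ^ 2 = v)
  (hWbm : ∀ n b, Measurable (Wb n b))
  (hWb : ∀ b : ℕ → ℕ, (∀ n, b n ≤ n - m n) → ∀ j, VanishesInProb μ fun n ω =>
    √(m n : ℝ) * (Wb n (b n) ω j - w₀ j) - P (blockScore w₀ ξ n (m n) (b n) ω) j)

include hξ hT hn₀ hP hZ hW hate hvar in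
lemma vanishesInProb_residualVariance_sub :
    VanishesInProb μ fun n ω => residualVariance T ξ W n ω - v := by
  have := hξ.vanishesInProb_sampleVariance_sub hT hn₀ (vanishesInProb_weight_sub hP hZ hW)
  rw [hate, hvar] at this
  exact this

include hξ hT hφ hn₀ hP hZ hW hm hmn hWb in
-- √m(Wb - W) = √m(Wb - w₀) - √(m/n) √n(W - w₀), and the last term vanishes as m/n → 0. Centring at
-- the estimate thus acts as centring at w₀, and the block statistic becomes the same functional of
-- the score as in the full sample.
lemma vanishesInProb_subsampleShift_sub {b : ℕ → ℕ} (hb : ∀ n, b n ≤ n - m n) :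
    VanishesInProb μ fun n ω => subsampleShift T m ξ W Wb n (b n) ω -
      weightEffect φ (fun j => ∫ ω, (ξ n₀ (n₀ + 1) ω).2.1 j ∂μ) P
        (blockScore w₀ ξ n (m n) (b n) ω) := by
  have hmle : ∀ᶠ n in atTop, m n ≤ n := by
    filter_upwards [hmn.eventually_lt_const one_pos, eventually_gt_atTop 0] with n h1 h2
    have : (0 : ℝ) < n := by exact_mod_cast h2
    rw [div_lt_one this] at h1
    exact_mod_cast h1.le
  have hPb : ∀ j, BoundedInProb μ fun n ω => P (blockScore w₀ ξ n (m n) (b n) ω) j := by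
    intro j
    refine ((boundedInProb_comp_blockScore hP hZ j).comp_tendsto hm).of_identDistrib ?_
    filter_upwards [hmle] with n hn
    exact (hξ.identDistrib_blockScore (by have := hb n; omega)).comp
      (u := fun s => P s j) ((measurable_pi_apply j).comp hP.measurable)
  have hsq : VanishesInProb μ fun n (_ : Ω) => √((m n : ℝ) / n) := .of_tendsto_const (by
    have := (Real.continuous_sqrt.tendsto 0).comp hmn
    rwa [Real.sqrt_zero] at this)
  have hx : ∀ j, VanishesInProb μ fun n ω =>
      √(m n : ℝ) * (Wb n (b n) ω j - W n ω j) - P (blockScore w₀ ξ n (m n) (b n) ω) j := by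
    intro j
    refine ((hWb b hb j).sub (hsq.mul_bounded
      (boundedInProb_sqrt_mul_weight_sub hP hZ hW j))).congr' ?_
    filter_upwards [eventually_gt_atTop 0] with n hn
    have hn0 : √(n : ℝ) ≠ 0 := (Real.sqrt_pos.mpr (by exact_mod_cast hn)).ne'
    refine .of_forall fun ω => ?_
    rw [Real.sqrt_div (Nat.cast_nonneg _)]
    field_simp
    ring
  refine (vanishesInProb_mul_sum_mul_sub hφ (hξ.vanishesInProb_controlMean_sub hT hn₀) hx
    hPb).neg.congr fun n ω => ?_
  simp only [subsampleShift, weightEffect]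
  ring

include hξ hT hφ hn₀ hP hZ hWm hW hv hate hm hmn hvar hWbm hWb in
/-- The conditional distribution function of the subsampling statistic converges to the limit
distribution function of the normalized average residual. -/
theorem vanishesInProb_drawLaw_real_sub (y : ℝ) :
    VanishesInProb μ fun n ω => (drawLaw (n - m n) (T n)).real
      {d | subsampleShift T m ξ W Wb n d.1 ω +
        (√(T n : ℝ))⁻¹ * ∑ t, √(residualVariance T ξ W n ω) * d.2 t ≤ y} -
      cdf (μ'.map (weightEffect φ (fun j => ∫ ω, (ξ n₀ (n₀ + 1) ω).2.1 j ∂μ) P ∘ Z) ∗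
        gaussianReal 0 v) y := by
  set M : ι → ℝ := fun j => ∫ ω, (ξ n₀ (n₀ + 1) ω).2.1 j ∂μ with hM
  set u := weightEffect φ M P with hu
  have huc : Continuous u := continuous_weightEffect hP
  have hU := hZ.continuous_comp huc
  have hν : IsProbabilityMeasure (μ'.map (u ∘ Z)) :=
    Measure.isProbabilityMeasure_map hU.aemeasurable_limit
  have hv0 : (0 : ℝ) < v := by positivity
  have hS := hξ.vanishesInProb_residualVariance_sub hT hn₀ hP hZ hW hate hvar
  have hsd : VanishesInProb μ fun n ω => √(residualVariance T ξ W n ω) - √(v : ℝ) :=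
    hS.comp_continuousAt Real.continuous_sqrt.continuousAt
  have key := hξ.vanishesInProb_average_stdNormalCDF_sub hm hmn hZ huc
    (Real.sqrt_pos.mpr hv0) (s := fun n ω => √(residualVariance T ξ W n ω))
    (fun n => (measurable_residualVariance hξ.measurable hWm n).sqrt) hsd
    (C := subsampleShift T m ξ W Wb) (measurable_subsampleShift hξ.measurable hWm hWbm)
    (fun b hb => hξ.vanishesInProb_subsampleShift_sub hT hφ hn₀ hP hZ hW hm hmn hWb hb) y
  have hcdf : cdf (μ'.map (u ∘ Z) ∗ gaussianReal 0 v) y =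
      ∫ ω', stdNormalCDF ((y - u (Z ω')) / √(v : ℝ)) ∂μ' := by
    have hc : Continuous fun x => stdNormalCDF ((y - x) / √(v : ℝ)) :=
      continuous_stdNormalCDF.comp (by fun_prop)
    rw [cdf_conv_gaussianReal _ hv, integral_map hU.aemeasurable_limit hc.aestronglyMeasurable]
    rfl
  rw [hcdf]
  have hdiff : VanishesInProb μ fun n ω => (drawLaw (n - m n) (T n)).real
      {d | subsampleShift T m ξ W Wb n d.1 ω +
        (√(T n : ℝ))⁻¹ * ∑ t, √(residualVariance T ξ W n ω) * d.2 t ≤ y} -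
      ((n - m n + 1 : ℕ) : ℝ)⁻¹ * ∑ b ∈ Finset.range (n - m n + 1),
        stdNormalCDF ((y - subsampleShift T m ξ W Wb n b ω) / √(residualVariance T ξ W n ω)) := by
    -- When the estimated variance is positive the two expressions agree exactly; at zero the
    -- quotient is meaningless. Deviating from v by less than v ensures positivity.
    refine .of_exceptional fun ε hε => ?_
    filter_upwards [hS.exceptional hv0 hε, hT.eventually_gt_atTop 0] with n hn hTn
    refine ⟨_, hn, .of_forall fun ω hω => ?_⟩
    simp only [Set.mem_ofPred_eq, not_le] at hω
    have hpos : 0 < residualVariance T ξ W n ω := by linarith [(abs_lt.mp hω).1]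
    have hm1 : MeasurableSet {d : Fin (n - m n + 1) × (Fin (T n) → ℝ) |
        subsampleShift T m ξ W Wb n d.1 ω +
        (√(T n : ℝ))⁻¹ * ∑ t, √(residualVariance T ξ W n ω) * d.2 t ≤ y} := by
      refine measurableSet_le (measurable_from_prod_countable_right
        (f := fun d : Fin (n - m n + 1) × (Fin (T n) → ℝ) => subsampleShift T m ξ W Wb n d.1 ω +
        (√(T n : ℝ))⁻¹ * ∑ t, √(residualVariance T ξ W n ω) * d.2 t) fun b => ?_)
        measurable_const
      fun_prop
    rw [drawLaw_real_apply hm1, Finset.sum_range]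
    simp only [Set.mem_ofPred_eq]
    simp only [pi_gaussianReal_real_affine_le hTn _ y (Real.sqrt_pos.mpr hpos), sub_self, abs_zero]
    exact hε
  exact (hdiff.add key).congr fun n ω => by ring

include hξ hT hφ hn₀ hP hZ hWm hW hv hate hV hm hmn hvar hWbm hWb in
/-- Asymptotic level of the interval between two simulated quantiles of the subsampling
statistic. -/
theorem tendsto_prod_simLaw_residualMean_interval {N : ℕ → ℕ} (hN : Tendsto N atTop atTop)
    {p₁ p₂ : ℝ} (h0 : 0 < p₁) (h12 : p₁ < p₂) (h1 : p₂ < 1) :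
    Tendsto (fun n => (μ.prod (simLaw (N n) (n - m n) (T n))).real
      {p | orderStat (fun i => subsampleShift T m ξ W Wb n (p.2.1 i) p.1 +
          (√(T n : ℝ))⁻¹ * ∑ t, √(residualVariance T ξ W n p.1) * p.2.2 i t) ⌈p₁ * N n⌉₊ ≤
          √(T n : ℝ) * (residualMean T ξ W n p.1 - ate) ∧
        √(T n : ℝ) * (residualMean T ξ W n p.1 - ate) ≤
          orderStat (fun i => subsampleShift T m ξ W Wb n (p.2.1 i) p.1 +
          (√(T n : ℝ))⁻¹ * ∑ t, √(residualVariance T ξ W n p.1) * p.2.2 i t) ⌈p₂ * N n⌉₊})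
      atTop (𝓝 (p₂ - p₁)) := by
  set M : ι → ℝ := fun j => ∫ ω, (ξ n₀ (n₀ + 1) ω).2.1 j ∂μ with hM
  have hU := hZ.continuous_comp (continuous_weightEffect (φ := φ) (M := M) hP)
  have hν : IsProbabilityMeasure (μ'.map (weightEffect φ M P ∘ Z)) :=
    Measure.isProbabilityMeasure_map hU.aemeasurable_limit
  -- Limit quantiles exist at every level in (0, 1) by continuity.
  obtain ⟨q₁, hq₁⟩ := exists_cdf_conv_gaussianReal_eq (μ'.map (weightEffect φ M P ∘ Z)) hv h0
    (h12.trans h1)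
  obtain ⟨q₂, hq₂⟩ := exists_cdf_conv_gaussianReal_eq (μ'.map (weightEffect φ M P ∘ Z)) hv
    (h0.trans h12) h1
  have key := tendsto_prod_simLaw_quantile_interval (μ := μ) hN (K := fun n => n - m n) (T := T)
    (E := fun n ω b x => subsampleShift T m ξ W Wb n b ω +
      (√(T n : ℝ))⁻¹ * ∑ t, √(residualVariance T ξ W n ω) * x t) (fun n b => by
        have h1 := measurable_subsampleShift (T := T) (m := m) hξ.measurable hWm hWbm n b
        have h2 := measurable_residualVariance (T := T) hξ.measurable hWm n
        fun_prop)
    (X := fun n ω => √(T n : ℝ) * (residualMean T ξ W n ω - ate))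
    (fun n => ((measurable_residualMean hξ.measurable hWm n).sub_const ate).const_mul _)
    (continuous_cdf_conv_gaussianReal _ hv) (strictMono_cdf_conv_gaussianReal _ hv)
    (hξ.tendsto_measureReal_residualMean_le hT hφ hn₀ hP hZ hWm hW hv hV)
    (hξ.vanishesInProb_drawLaw_real_sub hT hφ hn₀ hP hZ hWm hW hv hate hm hmn hvar hWbm hWb)
    (q₁ := q₁) (q₂ := q₂) (by rwa [hq₁]) (by rwa [hq₁, hq₂]) (by rw [hq₂]; exact h1.le)
  rw [hq₁, hq₂] at key
  exact key

end IsRegressionArray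

end SubsamplingBootstrap

/-! ### The mixed-frequency panel: measurability, covariate rows, score -/

namespace MFPanel

open Matrix

variable {S L H Ω : Type*} [Fintype S] [Fintype L] [Fintype H] [MeasurableSpace Ω] {Q l lag : ℕ}
  {μ : Measure Ω} {D : MFPanel S L H Ω Q l} {est : MFEstimates S L H Ω Q l lag}

section Measurability

omit [Fintype S] [Fintype L] [Fintype H] in
lemma measurable_observed (D : MFPanel S L H Ω Q l) (n t : ℕ) : Measurable (D.observed n t) := by
  unfold observed
  have h1 := D.measurable_treatedN t
  have h2 := D.measurable_effect n t
  split_ifs <;> fun_prop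

omit [Fintype S] [Fintype L] [Fintype H] in
lemma measurable_tildeY (D : MFPanel S L H Ω Q l) (est : MFEstimates S L H Ω Q l lag) (n t : ℕ) :
    Measurable (D.tildeY est n t) := by
  refine measurable_pi_lambda _ fun j => ?_
  have h1 := D.measurable_same
  have h2 := D.measurable_covariate
  have h3 := D.measurable_high
  have h4 := D.measurable_midas
  have h5 := est.measurable_intercept
  have h6 := est.measurable_slope
  have h7 := est.measurable_zeta n
  rcases j with j | j | j
  · exact h1 j t
  · exact (h5 n j).add (Finset.measurable_sum _ fun p _ => Finset.measurable_sum _ fun q _ =>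
      (h6 n j p q).mul (h2 _ _ _))
  · have h8 : ∀ k, Measurable fun ω => D.midas j k (est.zeta n ω j) * D.high j t k ω := fun k =>
      ((h4 j k).comp ((measurable_pi_apply j).comp h7)).mul (h3 j t k)
    exact Finset.measurable_sum Finset.univ fun k _ => h8 k

omit [Fintype S] [Fintype L] [Fintype H] in
lemma measurable_joint (D : MFPanel S L H Ω Q l) (est : MFEstimates S L H Ω Q l lag) (n t : ℕ) :
    Measurable (D.joint est n t) := by
  refine (D.measurable_observed n t).prodMk ((D.measurable_tildeY est n t).prodMk ?_)
  have h2 := D.measurable_effect n t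
  split_ifs <;> fun_prop

end Measurability

lemma JointWeakDependence.isRegressionArray {T1 : ℕ → ℕ} (h : D.JointWeakDependence est T1 μ) :
    IsRegressionArray μ T1 (D.joint est) :=
  ⟨D.measurable_joint est, h.1, h.2.1, h.2.2.1, h.2.2.2.1⟩

lemma sum_rows {M : Type*} [AddCommMonoid M] (n : ℕ) (f : Option (Fin Q) × ℕ → M) :
    ∑ r ∈ rows Q n, f r =
      ∑ t ∈ Finset.Icc 1 n, f (none, t) + ∑ q : Fin Q, ∑ t ∈ Finset.Icc 1 n, f (some q, t) := by
  rw [rows, Finset.sum_product, Fintype.sum_option]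

variable [IsProbabilityMeasure μ]

omit [Fintype S] [Fintype L] [Fintype H] [IsProbabilityMeasure μ] in
/-- Sums of products of covariates are of the order of the number of periods. -/
lemma vanishesInProb_mul_sum_covariate
    (hstat : WeaklyDependentStationary μ
      (fun t ω => fun jq : Option (S ⊕ L ⊕ H) × Fin Q => D.covariate jq.1 jq.2 t ω))
    (hL : ∀ j q (t : ℕ), 1 ≤ t → MemLp (D.covariate j q t) 2 μ) {c : ℕ → ℝ}
    (hc : Tendsto (fun n => c n * n) atTop (𝓝 0)) (i j : Option (S ⊕ L ⊕ H)) :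
    VanishesInProb μ fun n ω => c n * ∑ q : Fin Q, ∑ t ∈ Finset.Icc (1 : ℕ) n,
      D.covariate i q t ω * D.covariate j q t ω := by
  have hint : ∀ q (t : ℕ), 1 ≤ t →
      Integrable (fun ω => D.covariate i q t ω * D.covariate j q t ω) μ :=
    fun q t ht => (hL i q t ht).integrable_mul (hL j q t ht)
  have hE : ∀ q (t : ℕ), 1 ≤ t → ∫ ω, |D.covariate i q t ω * D.covariate j q t ω| ∂μ =
      ∫ ω, |D.covariate i q (1 : ℕ) ω * D.covariate j q (1 : ℕ) ω| ∂μ := by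
    intro q t ht
    exact ((hstat.1.identDistrib (i := ()) (i' := ()) (s := t) (s' := 1) ht (le_refl (1 : ℕ))).comp
      (u := fun x : Option (S ⊕ L ⊕ H) × Fin Q → ℝ => |x (i, q) * x (j, q)|)
      (by fun_prop)).integral_eq
  have hsum : ∀ n, Integrable (fun ω => ∑ q : Fin Q, ∑ t ∈ Finset.Icc (1 : ℕ) n,
      |D.covariate i q t ω * D.covariate j q t ω|) μ := fun n =>
    integrable_finsetSum _ fun q _ => integrable_finsetSum _ fun t ht =>
      (hint q t (Finset.mem_Icc.mp ht).1).abs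
  have hsum' : ∀ n, Integrable (fun ω => ∑ q : Fin Q, ∑ t ∈ Finset.Icc (1 : ℕ) n,
      D.covariate i q t ω * D.covariate j q t ω) μ := fun n =>
    integrable_finsetSum _ fun q _ => integrable_finsetSum _ fun t ht =>
      hint q t (Finset.mem_Icc.mp ht).1
  refine .of_integral_abs (.of_forall fun n => (hsum' n).const_mul _) ?_
  set B := ∑ q : Fin Q, ∫ ω, |D.covariate i q (1 : ℕ) ω * D.covariate j q (1 : ℕ) ω| ∂μ with hB
  have hlim : Tendsto (fun n => |c n * n| * B) atTop (𝓝 0) := by simpa using hc.abs.mul_const B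
  refine squeeze_zero (fun _ => integral_nonneg fun _ => abs_nonneg _) (fun n => ?_) hlim
  calc ∫ ω, |c n * ∑ q : Fin Q, ∑ t ∈ Finset.Icc (1 : ℕ) n,
        D.covariate i q t ω * D.covariate j q t ω| ∂μ
      ≤ ∫ ω, |c n| * ∑ q : Fin Q, ∑ t ∈ Finset.Icc (1 : ℕ) n,
        |D.covariate i q t ω * D.covariate j q t ω| ∂μ := by
        refine integral_mono ((hsum' n).const_mul _).abs ((hsum n).const_mul _) fun ω => ?_
        dsimp only
        rw [abs_mul]
        refine mul_le_mul_of_nonneg_left ((Finset.abs_sum_le_sum_abs _ _).trans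
          (Finset.sum_le_sum fun q _ => Finset.abs_sum_le_sum_abs _ _)) (abs_nonneg _)
    _ = |c n| * ∑ q : Fin Q, ∑ t ∈ Finset.Icc (1 : ℕ) n,
        ∫ ω, |D.covariate i q t ω * D.covariate j q t ω| ∂μ := by
        rw [integral_const_mul, integral_finsetSum _ fun q _ => integrable_finsetSum _ fun t ht =>
          (hint q t (Finset.mem_Icc.mp ht).1).abs]
        congr 1
        exact Finset.sum_congr rfl fun q _ => integral_finsetSum _ fun t ht =>
          (hint q t (Finset.mem_Icc.mp ht).1).abs
    _ = |c n| * (n * B) := by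
        rw [hB, Finset.mul_sum (s := Finset.univ) (a := (n : ℝ))]
        congr 1
        refine Finset.sum_congr rfl fun q _ => ?_
        rw [Finset.sum_congr rfl fun t ht => hE q t (Finset.mem_Icc.mp ht).1]
        simp
    _ = |c n * n| * B := by rw [abs_mul, Nat.abs_cast]; ring

/-- Size of the covariate part of the Gram matrix: 1/n from its normalization, 1/n² from two
rescaled covariates, and of the order of n summands. -/
lemma tendsto_inv_mul_inv_sq_mul :
    Tendsto (fun n : ℕ => ((n : ℝ)⁻¹ * ((n : ℝ)⁻¹) ^ 2) * n) atTop (𝓝 0) := by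
  have h : Tendsto (fun n : ℕ => ((n : ℝ)⁻¹) ^ 2) atTop (𝓝 0) := by
    simpa using (tendsto_inv_atTop_nhds_zero_nat (𝕜 := ℝ)).pow 2
  refine h.congr' ?_
  filter_upwards [eventually_gt_atTop 0] with n hn
  have : (n : ℝ) ≠ 0 := by positivity
  field_simp

/-- The same count for the score, normalized by √n only. -/
lemma tendsto_inv_sqrt_mul_inv_sq_mul :
    Tendsto (fun n : ℕ => ((√(n : ℝ))⁻¹ * ((n : ℝ)⁻¹) ^ 2) * n) atTop (𝓝 0) := by
  have h : Tendsto (fun n : ℕ => (√(n : ℝ))⁻¹ * (n : ℝ)⁻¹) atTop (𝓝 0) := by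
    simpa using ((Real.tendsto_sqrt_atTop.comp
      tendsto_natCast_atTop_atTop).inv_tendsto_atTop).mul (tendsto_inv_atTop_nhds_zero_nat (𝕜 := ℝ))
  refine h.congr' ?_
  filter_upwards [eventually_gt_atTop 0] with n hn
  have : (n : ℝ) ≠ 0 := by positivity
  field_simp

section Score

variable {T1 : ℕ → ℕ} {w₀ : (S ⊕ L ⊕ H) → ℝ}

/-- The contribution of the covariates to the score vanishes. -/
lemma vanishesInProb_sum_covariate_score
    (hstat : WeaklyDependentStationary μ
      (fun t ω => fun jq : Option (S ⊕ L ⊕ H) × Fin Q => D.covariate jq.1 jq.2 t ω))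
    (hL : ∀ j q (t : ℕ), 1 ≤ t → MemLp (D.covariate j q t) 2 μ) (w₀ : (S ⊕ L ⊕ H) → ℝ)
    (j : S ⊕ L ⊕ H) :
    VanishesInProb μ fun n ω => (√(n : ℝ))⁻¹ * ∑ q : Fin Q, ∑ t ∈ Finset.Icc 1 n,
      D.rowControl est n (est.zeta n ω) ω (some q, t) j * D.rowError est w₀ n (some q, t) ω := by
  have h := fun i => vanishesInProb_mul_sum_covariate hstat hL tendsto_inv_sqrt_mul_inv_sq_mul
    (some j) i
  refine ((h none).sub (VanishesInProb.sum Finset.univ fun i _ =>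
    (h (some i)).const_mul (w₀ i))).congr fun n ω => ?_
  have e : ∀ q t, D.rowControl est n (est.zeta n ω) ω (some q, t) j *
      D.rowError est w₀ n (some q, t) ω = ((n : ℝ)⁻¹) ^ 2 *
        (D.covariate (some j) q t ω * D.covariate none q t ω) -
        ∑ i, w₀ i * (((n : ℝ)⁻¹) ^ 2 *
          (D.covariate (some j) q t ω * D.covariate (some i) q t ω)) := by
    intro q t
    simp only [rowControl, rowError, rowTreated, mul_sub, Finset.mul_sum]
    congr 1
    · ring
    · exact Finset.sum_congr rfl fun i _ => by ring
  simp only [e, Finset.sum_sub_distrib, mul_sub, ← Finset.mul_sum]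
  congr 1
  · ring
  · rw [Finset.mul_sum]
    have e2 : ∀ q, ∑ t ∈ Finset.Icc 1 n, ∑ i, w₀ i * (((n : ℝ)⁻¹) ^ 2 *
          (D.covariate (some j) q t ω * D.covariate (some i) q t ω)) =
        ∑ i, ∑ t ∈ Finset.Icc 1 n, w₀ i * (((n : ℝ)⁻¹) ^ 2 *
          (D.covariate (some j) q t ω * D.covariate (some i) q t ω)) := fun q =>
      Finset.sum_comm
    rw [← Finset.mul_sum]
    simp only [e2]
    rw [Finset.sum_comm, Finset.mul_sum]
    refine Finset.sum_congr rfl fun i _ => ?_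
    simp only [← Finset.mul_sum]
    ring

lemma rowError_none_eq (w₀ : (S ⊕ L ⊕ H) → ℝ) (n t : ℕ) (ω : Ω) :
    D.rowError est w₀ n (none, t) ω = modelError w₀ (D.joint est n t ω) := rfl

/-- The outcome rows of the full regression are one block covering the whole pre-treatment period,
so the scores differ by the covariate rows alone. -/
lemma scoreVector_rows_sub_blockScore (w₀ : (S ⊕ L ⊕ H) → ℝ) (n : ℕ) (ω : Ω) (j : S ⊕ L ⊕ H) :
    scoreVector (rows Q n) (D.rowControl est n (est.zeta n ω) ω)
      (fun r => D.rowError est w₀ n r ω) n j - blockScore w₀ (D.joint est) n n 0 ω j =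
    (√(n : ℝ))⁻¹ * ∑ q : Fin Q, ∑ t ∈ Finset.Icc 1 n,
      D.rowControl est n (est.zeta n ω) ω (some q, t) j *
        D.rowError est w₀ n (some q, t) ω := by
  rw [scoreVector, sum_rows, blockScore, scoreVector, zero_add, zero_add, mul_add,
    add_sub_assoc, add_comm, sub_add]
  simp only [rowError_none_eq]
  exact sub_eq_self.mpr (sub_eq_zero.mpr rfl)

/-- Central limit theorem for the score of the outcome rows. -/
lemma ScoreCLT.tendstoInDistribution_blockScore [DecidableEq S] [DecidableEq L] [DecidableEq H]
    {Sig : Matrix (S ⊕ L ⊕ H) (S ⊕ L ⊕ H) ℝ} (hscore : D.ScoreCLT est w₀ μ Sig)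
    (hξ : IsRegressionArray μ T1 (D.joint est))
    (hstat : WeaklyDependentStationary μ
      (fun t ω => fun jq : Option (S ⊕ L ⊕ H) × Fin Q => D.covariate jq.1 jq.2 t ω))
    (hL : ∀ j q (t : ℕ), 1 ≤ t → MemLp (D.covariate j q t) 2 μ) :
    TendstoInDistribution (fun n => blockScore w₀ (D.joint est) n n 0) atTop
      (fun x : EuclideanSpace ℝ (S ⊕ L ⊕ H) => √((Q : ℝ) + 1) • x.ofLp)
      (fun _ => μ) (multivariateGaussian 0 Sig) := by
  -- The factor √(Q + 1) converts the normalization by the number (Q + 1)n of rows into one by the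
  -- number n of periods.
  have hcont : Continuous fun x : EuclideanSpace ℝ (S ⊕ L ⊕ H) => √((Q : ℝ) + 1) • x.ofLp := by
    fun_prop
  have h1 := hscore.2.2.2.continuous_comp hcont
  refine tendstoInDistribution_of_tendstoInMeasure_sub _ _ h1 ?_
    fun n => (hξ.measurable_blockScore n n 0).aemeasurable
  have hcoord := fun j => (vanishesInProb_sum_covariate_score (est := est) hstat hL w₀ j).neg
  have habs := VanishesInProb.sum Finset.univ fun j _ => (hcoord j).abs
  rw [tendstoInMeasure_iff_measureReal_norm]
  intro ε hε
  refine squeeze_zero (fun _ => measureReal_nonneg) (fun n => measureReal_mono fun ω hω => ?_)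
    (habs.tendsto hε)
  refine le_trans (le_trans (show ε ≤ _ from hω) ?_) (le_abs_self _)
  rw [Pi.zero_apply, sub_zero, pi_norm_le_iff_of_nonneg (Finset.sum_nonneg fun _ _ => abs_nonneg _)]
  intro j
  refine le_trans (le_of_eq ?_) (Finset.single_le_sum (fun _ _ => abs_nonneg _) (Finset.mem_univ j))
  rw [Real.norm_eq_abs, ← scoreVector_rows_sub_blockScore, neg_sub]
  congr 1
  simp only [Pi.sub_apply, Function.comp_apply, Pi.smul_apply, smul_eq_mul, scoreVector]
  congr 1
  rw [Nat.cast_mul, Nat.cast_add, Nat.cast_one, Real.sqrt_mul (by positivity), mul_inv, mul_assoc,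
    mul_inv_cancel_left₀ (Real.sqrt_ne_zero'.mpr (by positivity))]

end Score

end MFPanel

/-! ### Panel estimates as constrained least squares; post-treatment errors -/

namespace MFPanel

open Matrix

variable {S L H Ω : Type*} [Fintype S] [Fintype L] [Fintype H] [MeasurableSpace Ω] {Q l lag : ℕ}
  {μ : Measure Ω} [IsProbabilityMeasure μ] {D : MFPanel S L H Ω Q l}
  {est : MFEstimates S L H Ω Q l lag} {T1 m : ℕ → ℕ} {w₀ : (S ⊕ L ⊕ H) → ℝ}
  {A : Matrix (S ⊕ L ⊕ H) (S ⊕ L ⊕ H) ℝ}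

/-- Expansion of the estimated weights. -/
lemma IsEstimate.vanishesInProb_sub_coneSolution (hest : D.IsEstimate est μ)
    (hξ : IsRegressionArray μ T1 (D.joint est)) (hw₀ : w₀ ∈ stdSimplex ℝ (S ⊕ L ⊕ H))
    (hA : A.PosDef)
    (hAξ : ∀ i j, A i j = ∫ ω, D.tildeY est 1 1 ω i * D.tildeY est 1 1 ω j ∂μ)
    (hstat : WeaklyDependentStationary μ
      (fun t ω => fun jq : Option (S ⊕ L ⊕ H) × Fin Q => D.covariate jq.1 jq.2 t ω))
    (hL : ∀ j q (t : ℕ), 1 ≤ t → MemLp (D.covariate j q t) 2 μ)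
    (hb : ∀ j, BoundedInProb μ fun n ω => blockScore w₀ (D.joint est) n n 0 ω j)
    (j : S ⊕ L ⊕ H) :
    VanishesInProb μ fun n ω => √(n : ℝ) * (est.weight n ω j - w₀ j) -
      coneSolution A w₀ (blockScore w₀ (D.joint est) n n 0 ω) j := by
  refine vanishesInProb_sqrt_mul_sub_coneSolution hA hw₀ (N := fun n => (n : ℝ))
    tendsto_natCast_atTop_atTop (s := fun n => rows Q n) (y := fun n ω => D.rowTreated n ω)
    (z := fun n ω => D.rowControl est n (est.zeta n ω) ω) ?_ hb ?_ ?_ j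
  -- In the joint minimization the MIDAS parameters can be kept at their estimates, so the weights
  -- solve the constrained least squares problem for the rows computed with these estimates.
  · filter_upwards [eventually_gt_atTop 0] with n hn
    filter_upwards [hest n] with ω hω
    refine ⟨hω.1, fun w' hw' => ?_⟩
    exact le_of_mul_le_mul_left (hω.2.2 w' hw' _ hω.2.1) (inv_pos.mpr (by exact_mod_cast hn))
  · intro i k
    have h1 := hξ.vanishesInProb_gramMatrix_sub (n := fun n => n) (m := fun n => n)
      (b := fun _ => 0) tendsto_id (.of_forall fun n => by simp) i k
    have h2 := vanishesInProb_mul_sum_covariate hstat hL tendsto_inv_mul_inv_sq_mul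
      (some i) (some k)
    refine (h1.add h2).congr fun n ω => ?_
    rw [hAξ, gramMatrix, Matrix.of_apply, gramMatrix, Matrix.of_apply, sum_rows, zero_add, zero_add]
    have e : ∀ q t, D.rowControl est n (est.zeta n ω) ω (some q, t) i *
        D.rowControl est n (est.zeta n ω) ω (some q, t) k =
        ((n : ℝ)⁻¹) ^ 2 * (D.covariate (some i) q t ω * D.covariate (some k) q t ω) := by
      intro q t
      simp only [rowControl]
      ring
    simp only [e, ← Finset.mul_sum]
    rw [mul_add, ← mul_assoc, add_sub_right_comm]
    rfl
  · intro i
    refine (vanishesInProb_sum_covariate_score (est := est) hstat hL w₀ i).congr fun n ω => ?_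
    rw [← scoreVector_rows_sub_blockScore]
    rfl

/-- Expansion of the weights estimated on a block. -/
lemma IsBlockEstimate.vanishesInProb_sub_coneSolution (hblock : D.IsBlockEstimate est m μ)
    (hξ : IsRegressionArray μ T1 (D.joint est)) (hw₀ : w₀ ∈ stdSimplex ℝ (S ⊕ L ⊕ H))
    (hA : A.PosDef)
    (hAξ : ∀ i j, A i j = ∫ ω, D.tildeY est 1 1 ω i * D.tildeY est 1 1 ω j ∂μ)
    (hm : Tendsto m atTop atTop) (hmle : ∀ᶠ n in atTop, m n ≤ n)
    (hb : ∀ j, BoundedInProb μ fun n ω => blockScore w₀ (D.joint est) n n 0 ω j)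
    {b : ℕ → ℕ} (hbm : ∀ n, b n ≤ n - m n) (j : S ⊕ L ⊕ H) :
    VanishesInProb μ fun n ω => √(m n : ℝ) * (est.blockWeight n (b n) ω j - w₀ j) -
      coneSolution A w₀ (blockScore w₀ (D.joint est) n (m n) (b n) ω) j := by
  have hbn : ∀ᶠ n in atTop, b n + m n ≤ n := by
    filter_upwards [hmle] with n hn
    have := hbm n
    omega
  refine vanishesInProb_sqrt_mul_sub_coneSolution hA hw₀ (N := fun n => (m n : ℝ))
    (tendsto_natCast_atTop_atTop.comp hm) (s := fun n => Finset.Icc (b n + 1) (b n + m n))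
    (y := fun n ω t => D.observed n t ω) (z := fun n ω t => D.tildeY est n t ω)
    (w := fun n => est.blockWeight n (b n))
    (b := fun n => blockScore w₀ (D.joint est) n (m n) (b n)) ?_ ?_ ?_ ?_ j
  · filter_upwards [hbn] with n hn
    exact hblock n (b n) hn
  · intro i
    refine ((hb i).comp_tendsto hm).of_identDistrib ?_
    filter_upwards [hbn] with n hn
    exact (hξ.identDistrib_blockScore hn).comp (u := fun s => s i) (measurable_pi_apply i)
  · intro i k
    refine (hξ.vanishesInProb_gramMatrix_sub (n := fun n => n) hm hbn i k).congr fun n ω => ?_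
    rw [hAξ]
    rfl
  · intro i
    -- Blocks contain no covariate rows, so their score is the block score itself.
    refine vanishesInProb_zero.congr fun n ω => ?_
    exact sub_eq_zero.mpr rfl

omit [IsProbabilityMeasure μ] in
-- The effect inside the observed outcome cancels, which makes v_t a function of the joint
-- observation, to which stationarity and mixing apply.
lemma effectError_eq {ate : ℝ} {n t : ℕ} (ht : n < t) (ω : Ω) :
    D.effectError est w₀ ate n t ω = modelError w₀ (D.joint est n t ω) - ate := by
  simp only [effectError, error, modelError, joint, if_pos ht, dotProduct]
  ring

section Effect

variable {ate : ℝ} {sigv : NNReal}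

/-- Normalized sums of the post-treatment errors are asymptotically normal. -/
lemma EffectCLT.tendstoInDistribution_modelError (h : D.EffectCLT est w₀ T1 μ ate sigv) :
    TendstoInDistribution (fun n ω => (√(T1 n : ℝ))⁻¹ *
      ∑ t ∈ Finset.Ioc n (n + T1 n), (modelError w₀ (D.joint est n t ω) - ate)) atTop id
      (fun _ => μ) (gaussianReal 0 sigv) := by
  refine h.2.2.congr (fun n => .of_forall fun ω => ?_) ae_eq_rfl
  dsimp only
  congr 1
  exact Finset.sum_congr rfl fun t ht => effectError_eq (Finset.mem_Ioc.mp ht).1 ω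

lemma EffectCLT.integral_modelError (h : D.EffectCLT est w₀ T1 μ ate sigv)
    (hξ : IsRegressionArray μ T1 (D.joint est)) {n : ℕ} (hn : 0 < T1 n) :
    ∫ ω, modelError w₀ (D.joint est n (n + 1) ω) ∂μ = ate := by
  have hmem : n + 1 ∈ Finset.Ioc n (n + T1 n) := Finset.mem_Ioc.mpr ⟨by omega, by omega⟩
  have h1 := (h.1 n (n + 1) hmem).2
  have hL := ((hξ.memLp n (n + 1) (Finset.mem_Icc.mpr ⟨by omega, by omega⟩)).modelError
    w₀).integrable one_le_two
  simp only [effectError_eq (Nat.lt_succ_self n)] at h1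
  rw [integral_sub hL (integrable_const _)] at h1
  simpa [sub_eq_zero] using h1

/-- The asymptotic variance of the serially uncorrelated post-treatment errors is their
variance. -/
lemma EffectCLT.integral_modelError_sq (h : D.EffectCLT est w₀ T1 μ ate sigv)
    (hξ : IsRegressionArray μ T1 (D.joint est)) (hT : Tendsto T1 atTop atTop)
    (hunc : D.SeriallyUncorrelated est w₀ T1 μ ate) {n₀ : ℕ} (hn₀ : 0 < T1 n₀) :
    ∫ ω, modelError w₀ (D.joint est n₀ (n₀ + 1) ω) ^ 2 ∂μ - ate ^ 2 = sigv := by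
  set e : ℝ := ∫ ω, (modelError w₀ (D.joint est n₀ (n₀ + 1) ω) - ate) ^ 2 ∂μ with he
  have hem := measurable_modelError w₀
  have hdiag : ∀ n, ∀ t ∈ Finset.Ioc n (n + T1 n),
      ∫ ω, D.effectError est w₀ ate n t ω * D.effectError est w₀ ate n t ω ∂μ = e := by
    intro n t ht
    have hid := (hξ.stationary_post.identDistrib (i := n) (i' := n₀) (s := t) (s' := n₀ + 1)
      (by simpa using ht) ⟨by omega, by omega⟩).comp
      (u := fun x => (modelError w₀ x - ate) ^ 2) (by fun_prop)
    rw [he]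
    refine Eq.trans (integral_congr_ae (.of_forall fun ω => ?_)) hid.integral_eq
    simp only [effectError_eq (Finset.mem_Ioc.mp ht).1, Function.comp_apply]
    ring
  have hoff : ∀ n, ∀ t ∈ Finset.Ioc n (n + T1 n), ∀ s ∈ Finset.Ioc n (n + T1 n), s ≠ t →
      ∫ ω, D.effectError est w₀ ate n t ω * D.effectError est w₀ ate n s ω ∂μ = 0 := by
    intro n t ht s hs hst
    have h1 := hunc.2 n t ht s hs hst.symm
    rw [covariance_eq_sub (h.1 n t ht).1 (h.1 n s hs).1, (h.1 n t ht).2, zero_mul, sub_zero] at h1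
    exact h1
  -- Without correlation the double sum reduces to its diagonal, constant by stationarity, so the
  -- long-run variance is the variance of one error. This is needed because the simulated errors are
  -- independent and carry only the sample variance.
  have hlim : Tendsto (fun _ : ℕ => e) atTop (𝓝 (sigv : ℝ)) := by
    refine h.2.1.congr' ?_
    filter_upwards [hT.eventually_gt_atTop 0] with n hn
    have hn' : (T1 n : ℝ) ≠ 0 := by positivity
    rw [Finset.sum_congr rfl fun t ht => (Finset.sum_eq_single_of_mem t ht fun s hs hst =>
      hoff n t ht s hs hst).trans (hdiag n t ht), Finset.sum_const, Nat.card_Ioc,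
      Nat.add_sub_cancel_left, nsmul_eq_mul, inv_mul_cancel_left₀ hn']
  rw [← tendsto_nhds_unique tendsto_const_nhds hlim, he]
  have hL := (hξ.memLp n₀ (n₀ + 1) (Finset.mem_Icc.mpr ⟨by omega, by omega⟩)).modelError w₀
  have h1 := h.integral_modelError hξ hn₀
  have e1 : ∀ ω, (modelError w₀ (D.joint est n₀ (n₀ + 1) ω) - ate) ^ 2 =
      modelError w₀ (D.joint est n₀ (n₀ + 1) ω) ^ 2 -
        (2 * ate) * modelError w₀ (D.joint est n₀ (n₀ + 1) ω) + ate ^ 2 := fun ω => by ring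
  simp only [e1]
  have hI : Integrable (fun ω => modelError w₀ (D.joint est n₀ (n₀ + 1) ω) ^ 2 -
      (2 * ate) * modelError w₀ (D.joint est n₀ (n₀ + 1) ω)) μ :=
    hL.integrable_sq.sub ((hL.integrable one_le_two).const_mul _)
  rw [integral_add hI (integrable_const _),
    integral_sub hL.integrable_sq ((hL.integrable one_le_two).const_mul _),
    integral_const_mul, h1]
  simp
  ring

end Effect

omit [IsProbabilityMeasure μ] in
lemma bootStat_eq (n : ℕ) (ω : Ω) (b : ℕ) (x : Fin (T1 n) → ℝ) :
    D.bootStat est T1 m n ω b x =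
      subsampleShift T1 m (D.joint est) est.weight est.blockWeight n b ω +
        (√(T1 n : ℝ))⁻¹ * ∑ t, √(residualVariance T1 (D.joint est) est.weight n ω) * x t := by
  have h1 : ∀ t, D.effectHat est n t ω = modelError (est.weight n ω) (D.joint est n t ω) :=
    fun t => rfl
  simp only [bootStat, varHat, ateHat, h1]
  rfl

omit [IsProbabilityMeasure μ] in
lemma ateHat_eq (n : ℕ) (ω : Ω) :
    D.ateHat est T1 n ω = residualMean T1 (D.joint est) est.weight n ω := rfl

end MFPanel

theorem theorem4
    {S L H Ω : Type*} [Fintype S] [Fintype L] [Fintype H] [DecidableEq S] [DecidableEq L]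
    [DecidableEq H] [MeasurableSpace Ω] {Q l lag : ℕ}
    (μ : Measure Ω) [IsProbabilityMeasure μ]
    (D : MFPanel S L H Ω Q l) (est : MFEstimates S L H Ω Q l lag)
    (T1 m N : ℕ → ℕ) (w₀ : (S ⊕ L ⊕ H) → ℝ) (ate φ : ℝ)
    (Sig : Matrix (S ⊕ L ⊕ H) (S ⊕ L ⊕ H) ℝ) (sigv : NNReal)
    (hw₀ : w₀ ∈ stdSimplex ℝ (S ⊕ L ⊕ H))
    (hest : D.IsEstimate est μ)
    (hblock : D.IsBlockEstimate est m μ)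
    (hate : D.IsATE T1 μ ate)
    (hT1 : Tendsto T1 atTop atTop)
    (hdata : D.DataRegular est T1 μ φ)
    (hscore : D.ScoreCLT est w₀ μ Sig)
    (heffect : D.EffectCLT est w₀ T1 μ ate sigv)
    (hsigv : 0 < sigv)
    (hjoint : D.JointWeakDependence est T1 μ)
    (huncorr : D.SeriallyUncorrelated est w₀ T1 μ ate)
    (hm : Tendsto m atTop atTop)
    (hmT0 : Tendsto (fun T0 : ℕ => (m T0 : ℝ) / T0) atTop (𝓝 0))
    (hN : Tendsto N atTop atTop)
    (α : ℝ) (hα : α ∈ Set.Ioo (0 : ℝ) 1) :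
    Tendsto (fun T0 : ℕ =>
        (μ.prod (simLaw (N T0) (T0 - m T0) (T1 T0))).real
          {p | ate ∈ confInterval D est T1 m N α T0 p.1 p.2})
      atTop (𝓝 (1 - α)) := by
  have hξ := hjoint.isRegressionArray
  obtain ⟨-, -, -, hstat, hL, hpos, hφ⟩ := hdata
  have hA := hpos 1 1 (by simp)
  set A : Matrix (S ⊕ L ⊕ H) (S ⊕ L ⊕ H) ℝ :=
    Matrix.of fun i j => ∫ ω, D.tildeY est 1 1 ω i * D.tildeY est 1 1 ω j ∂μ with hAdef
  have hAξ : ∀ i j, A i j = ∫ ω, D.tildeY est 1 1 ω i * D.tildeY est 1 1 ω j ∂μ :=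
    fun _ _ => rfl
  have hZ := hscore.tendstoInDistribution_blockScore hξ hstat hL
  have hb : ∀ j, BoundedInProb μ fun n ω => blockScore w₀ (D.joint est) n n 0 ω j := fun j =>
    (hZ.continuous_comp (continuous_apply j)).boundedInProb
  have hmle : ∀ᶠ n in atTop, m n ≤ n := by
    filter_upwards [hmT0.eventually_lt_const one_pos, eventually_gt_atTop 0] with n h1 h2
    have : (0 : ℝ) < n := by exact_mod_cast h2
    rw [div_lt_one this] at h1
    exact_mod_cast h1.le
  obtain ⟨n₀, hn₀⟩ := (hT1.eventually_gt_atTop 0).exists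
  -- The same cone solution map is supplied for the full-sample weights and for the block weights.
  have key := hξ.tendsto_prod_simLaw_residualMean_interval hT1 hφ hn₀
    (continuous_coneSolution hA w₀) hZ est.measurable_weight
    (hest.vanishesInProb_sub_coneSolution hξ hw₀ hA hAξ hstat hL hb) hsigv.ne'
    (heffect.integral_modelError hξ hn₀) heffect.tendstoInDistribution_modelError hm hmT0
    (heffect.integral_modelError_sq hξ hT1 huncorr hn₀) est.measurable_blockWeight
    (fun b hbm => hblock.vanishesInProb_sub_coneSolution hξ hw₀ hA hAξ hm hmle hb hbm) hN
    (p₁ := α / 2) (p₂ := 1 - α / 2) (by linarith [hα.1]) (by linarith [hα.2]) (by linarith [hα.1])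
  rw [show 1 - α / 2 - α / 2 = 1 - α by ring] at key
  refine key.congr' ?_
  filter_upwards [hT1.eventually_gt_atTop 0] with n hn
  have hs : 0 < √(T1 n : ℝ) := Real.sqrt_pos.mpr (by exact_mod_cast hn)
  congr 1
  ext p
  simp only [Set.mem_ofPred_eq, confInterval, Set.mem_Icc, MFPanel.bootStat_eq, MFPanel.ateHat_eq]
  -- Solving for `ate` reverses the inequalities, which is why the lower endpoint carries the upper
  -- quantile.
  have hlow : ∀ x r : ℝ, r - (√(T1 n : ℝ))⁻¹ * x ≤ ate ↔ √(T1 n : ℝ) * (r - ate) ≤ x := by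
    intro x r
    rw [← div_eq_inv_mul, sub_le_comm, le_div_iff₀ hs, mul_comm]
  have hupp : ∀ x r : ℝ, ate ≤ r - (√(T1 n : ℝ))⁻¹ * x ↔ x ≤ √(T1 n : ℝ) * (r - ate) := by
    intro x r
    rw [← div_eq_inv_mul, le_sub_comm, div_le_iff₀ hs, mul_comm]
  rw [hlow, hupp, and_comm]
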